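/- **Theorem 1 (Clausius–Mossotti formula with error bound).** Let $d\ge1$ and let $B$ be the open unit ball of $\mathbb R^d$. A *point set* is a locally finite $\mathcal P\subset\mathbb R^d$; the space of point sets carries the smallest $\sigma$-algebra making $\mathcal P\mapsto\sum_{x\in\mathcal P}f(x)$ measurable for all $f\in C_c(\mathbb R^d)$, and a point process is a probability measure $\mathbb P$ on it, with expectation $\mathbb E$. Let $\mathbb P$ be stationary and ergodic under translations, set $\mathcal B(\mathcal P)=\bigcup_{x\in\mathcal P}(x+B)$ and $\varphi=\mathbb E[\mathbb 1_{\mathcal B(\mathcal P)}]$. For $\alpha,\beta>0$ let $A_1=\alpha\,\mathrm{Id}$, $A_2=\beta\,\mathrm{Id}$ and $A(y)=A_1+\mathbb 1_{\mathcal B(\mathcal P)}(y)(A_2-A_1)$. The effective conductivity is the matrix $\bar A$ given by $\bar Ae=\mathbb E[A(\nabla\phi_e+e)]$ for $e\in\mathbb R^d$, where the corrector $\phi_e$ is a weak solution of $-\nabla\cdot A(\nabla\phi_e+e)=0$ in $\mathbb R^d$ that is almost surely in $H^1_{\mathrm{loc}}(\mathbb R^d)$, satisfies $\frac1{|B|}\int_B\phi_e=0$,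 and whose gradient is a stationary random field with $\mathbb E[\nabla\phi_e]=0$ and $\mathbb E[|\nabla\phi_e|^2]<\infty$ (such a corrector exists, and $\bar A$ does not depend on its choice). Let $\ell\in[0,\infty]$ be the almost surely constant value of $\inf_{x,y\in\mathcal P,\,x\ne y}|x-y|_\infty$. If $\ell>0$, the second-order intensity is $$\lambda_2=\sup_{z_1,z_2\in\mathbb R^d}\mathbb E\Big[\sum_{x_1,x_2\in\mathcal P,\,x_1\neq x_2}\ell^{-d}\mathbb 1_{Q_\ell(z_1)}(x_1)\,\ell^{-d}\mathbb 1_{Q_\ell(z_2)}(x_2)\Big],$$ where $Q_\ell(z)$ is the cube of sidelength $\ell$ centered at $z$ (so $\lambda_2=0$ if $\mathcal P$ is almost surely empty). If $\ell=0$, then $\lambda_2=\|f_2\|_{L^\infty(\mathbb R^d\times\mathbb R^d)}$, where the two-point density $f_2\ge0$ is defined by $\mathbb E\big[\sum_{x_1\ne x_2\in\mathcal P}\zeta(x_1,x_2)\big]=\int\zeta f_2$ for all $\zeta\in C_c((\mathbb R^d)^2)$, and $\lambda_2=\infty$ if there is no such density. Then for every $\delta>0$ there is a constant $C$ depending only on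 $d,\alpha,\beta,\delta$ such that, for every stationary and ergodic point process with $\lambda_2<\infty$ and $|\lambda_2-1|\ge\delta$, $$\Big|\bar A-\Big(\alpha\,\mathrm{Id}+\varphi\,\frac{\alpha d(\beta-\alpha)}{\beta+\alpha(d-1)}\,\mathrm{Id}\Big)\Big|\le C\,\lambda_2|\log\lambda_2|,$$ with $0\,|\log0|=0$. In particular the bound holds with $C=C(d,\alpha,\beta)$ for all processes with $\lambda_2\le\frac12$. -/

import Mathlib

open MeasureTheory Set Metric
open scoped ENNReal NNReal ContDiff

noncomputable section

namespace ClausiusMossotti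

/-- The space `ℝ^d` with its Euclidean norm. -/
abbrev E (d : ℕ) : Type := EuclideanSpace ℝ (Fin d)

/-- Point sets: locally finite subsets of `ℝ^d`. -/
structure PointSet (d : ℕ) where
  /-- the underlying set of points -/
  carrier : Set (E d)
  finite_inter : ∀ D : Set (E d), Bornology.IsBounded D → (carrier ∩ D).Finite

namespace PointSet

variable {d : ℕ}

@[ext]
theorem ext {S T : PointSet d} (h : S.carrier = T.carrier) : S = T := by
  cases S; cases T; cases h; rfl

/-- The evaluation `S(f) = ∑_{x ∈ S} f x` of a function on a point set. -/
def eval (f : E d → ℝ) (S : PointSet d) : ℝ := ∑' x : S.carrier, f x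

/-- The smallest σ-algebra making all evaluations at continuous compactly supported
functions measurable. -/
instance : MeasurableSpace (PointSet d) :=
  ⨆ (f : E d → ℝ) (_ : Continuous f) (_ : HasCompactSupport f),
    MeasurableSpace.comap (eval f) (borel ℝ)

/-- Translation of point sets: `z +ᵥ S = {z + x : x ∈ S}`. -/
instance : VAdd (E d) (PointSet d) where
  vadd z S :=
    { carrier := (fun x => z + x) '' S.carrier
      finite_inter := by
        intro D hD
        have hb : Bornology.IsBounded ((fun x => -z + x) '' D) := by
          obtain ⟨R, hR⟩ := hD.exists_norm_le
          refine isBounded_iff_forall_norm_le.2 ⟨‖-z‖ + R, ?_⟩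
          rintro _ ⟨y, hy, rfl⟩
          exact (norm_add_le _ _).trans (by have := hR y hy; linarith)
        refine ((S.finite_inter _ hb).image (fun x => z + x)).subset ?_
        rintro _ ⟨⟨x, hx, rfl⟩, hxD⟩
        exact ⟨x, ⟨hx, ⟨z + x, hxD, by simp⟩⟩, rfl⟩ }

theorem carrier_vadd (z : E d) (S : PointSet d) :
    (z +ᵥ S).carrier = (fun x => z + x) '' S.carrier := rfl

instance : AddAction (E d) (PointSet d) where
  zero_vadd S := by ext1; simp [carrier_vadd]
  add_vadd y z S := by
    ext1
    simp only [carrier_vadd, image_image]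
    congr 1
    funext x
    exact add_assoc y z x

/-- The union of the open unit balls centered at the points of `S`. -/
def inclusions (S : PointSet d) : Set (E d) := ⋃ x ∈ S.carrier, ball x 1

/-- `∑ ζ(x₁, x₂)` over ordered pairs of distinct points `x₁ ≠ x₂` of `S`. -/
def pairSum (S : PointSet d) (ζ : E d × E d → ℝ≥0∞) : ℝ≥0∞ :=
  ∑' p : {p : E d × E d // p.1 ∈ S.carrier ∧ p.2 ∈ S.carrier ∧ p.1 ≠ p.2}, ζ p

/-- `inf |x - y|_∞` over distinct points `x ≠ y` of `S`, in `[0, ∞]`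
(and `∞` if `S` has at most one point). -/
def minDist (S : PointSet d) : ℝ≥0∞ :=
  ⨅ (x ∈ S.carrier) (y ∈ S.carrier) (_ : x ≠ y), edist (WithLp.ofLp x) (WithLp.ofLp y)

end PointSet

variable {d : ℕ}

/-- The volume fraction of the inclusions, `φ = 𝔼[𝟙_{inclusions}]` (the indicator being taken
at the origin). -/
def volumeFraction (P : Measure (PointSet d)) : ℝ := P.real {S | (0 : E d) ∈ S.inclusions}

/-- The minimal lengthscale of the point process. For an ergodic process `minDist` is almost surely
constant, and its essential infimum is this constant. -/
def minLength (P : Measure (PointSet d)) : ℝ≥0∞ := essInf (fun S => S.minDist) P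

/-- The cube of sidelength `r` centered at `z`. -/
def cube (r : ℝ≥0∞) (z : E d) : Set (E d) :=
  {x | edist (WithLp.ofLp x) (WithLp.ofLp z) < r / 2}

/-- `f` is a two-point density of the process:
`𝔼[∑_{x₁ ≠ x₂} ζ(x₁, x₂)] = ∫ ζ f` for continuous compactly supported `ζ ≥ 0`. -/
def IsTwoPointDensity (P : Measure (PointSet d)) (f : E d × E d → ℝ≥0∞) : Prop :=
  Measurable f ∧
    ∀ ζ : E d × E d → ℝ≥0, Continuous ζ → HasCompactSupport ζ →
      ∫⁻ S, S.pairSum (fun p => (ζ p : ℝ≥0∞)) ∂P = ∫⁻ p, (ζ p : ℝ≥0∞) * f p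

open Classical in
/-- The second-order intensity `λ₂ ∈ [0, ∞]`. If the minimal lengthscale vanishes, it is the
`L^∞` norm of the two-point density (and `∞` if there is no such density). -/
def secondIntensity (P : Measure (PointSet d)) : ℝ≥0∞ :=
  if minLength P = 0 then
    ⨅ (f : E d × E d → ℝ≥0∞) (_ : IsTwoPointDensity P f), essSup f volume
  else
    ⨆ (z₁ : E d) (z₂ : E d), ∫⁻ S, S.pairSum (fun p =>
      (minLength P ^ d)⁻¹ * (cube (minLength P) z₁).indicator 1 p.1 *
        ((minLength P ^ d)⁻¹ * (cube (minLength P) z₂).indicator 1 p.2)) ∂P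

open Classical in
/-- The two-phase coefficient field `A₁ + 𝟙_{inclusions}(y) (A₂ - A₁)`. -/
def coeff (A₁ A₂ : E d →L[ℝ] E d) (S : PointSet d) (y : E d) : E d →L[ℝ] E d :=
  A₁ + if y ∈ S.inclusions then A₂ - A₁ else 0

/-- Smooth compactly supported real functions on `ℝ^d`. -/
def IsTest (η : E d → ℝ) : Prop := ContDiff ℝ ∞ η ∧ HasCompactSupport η

/-- `G` is the weak gradient of `u` on `ℝ^d`. -/
def IsWeakGradient (u : E d → ℝ) (G : E d → E d) : Prop :=
  ∀ η : E d → ℝ, IsTest η → ∀ v : E d,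
    ∫ x, u x * fderiv ℝ η x v = -∫ x, inner ℝ (G x) v * η x

/-- Local square integrability on `ℝ^d`. -/
def MemL2Loc {F : Type*} [NormedAddCommGroup F] (u : E d → F) : Prop :=
  ∀ R : ℝ, MemLp u 2 (volume.restrict (ball 0 R))

/-- The stationary random field `(S, x) ↦ Φ(S - x)` generated by a random variable `Φ`. -/
def stationaryField (Φ : PointSet d → E d) (S : PointSet d) (x : E d) : E d := Φ (-x +ᵥ S)

/-- `φ` is a corrector in the direction `e`, and its gradient is the stationary random field
generated by `Φ`, so that `Φ` is the value of `∇φ` at the origin. -/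
structure IsCorrector (P : Measure (PointSet d)) (A₁ A₂ : E d →L[ℝ] E d) (e : E d)
    (φ : PointSet d → E d → ℝ) (Φ : PointSet d → E d) : Prop where
  /-- `∇φ` has finite second moments. -/
  memLp : MemLp Φ 2 P
  /-- `∇φ` has vanishing expectation. -/
  mean_zero : ∫ S, Φ S ∂P = 0
  /-- Almost surely, `φ` is in `H¹_loc` with the weak gradient `stationaryField Φ`. -/
  h1loc : ∀ᵐ S ∂P, MemL2Loc (φ S) ∧ MemL2Loc (stationaryField Φ S) ∧
    IsWeakGradient (φ S) (stationaryField Φ S)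
  /-- The anchoring condition. -/
  anchoring : ∀ᵐ S ∂P, ⨍ x in ball (0 : E d) 1, φ S x = 0
  /-- Almost surely, `-∇ · A (∇φ + e) = 0` weakly in `ℝ^d`. -/
  equation : ∀ᵐ S ∂P, ∀ η : E d → ℝ, IsTest η →
    ∫ x, fderiv ℝ η x (coeff A₁ A₂ S x (stationaryField Φ S x + e)) = 0

/-- `Abar` is the effective conductivity: in every direction `e` there is a corrector, and
`Abar e = 𝔼[A (∇φ + e)]` for every corrector. -/
def IsEffectiveConductivity (P : Measure (PointSet d)) (A₁ A₂ Abar : E d →L[ℝ] E d) : Prop :=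
  ∀ e : E d,
    (∃ φ Φ, IsCorrector P A₁ A₂ e φ Φ) ∧
      ∀ φ Φ, IsCorrector P A₁ A₂ e φ Φ → Abar e = ∫ S, coeff A₁ A₂ S 0 (Φ S + e) ∂P

end ClausiusMossotti

end

open MeasureTheory Set Metric
open scoped ENNReal NNReal ContDiff

noncomputable section

namespace ClausiusMossotti

open Filter Topology ProbabilityTheory
open scoped Convolution

variable {d : ℕ}

/-! ### Measurability of counting measures and of translations -/

section

namespace PointSet

/-! The proof compares the corrector with an explicit trial gradient. Around a single ball in
infinite space the corrector is known: its potential is a multiple `c₀` of `e · y` inside the ball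
and of `e · y / |y|^d` outside. Each point `x` of the process receives a copy of this potential,
lowered by `R_x^{-d} e · y` so that it vanishes on the sphere of radius `R_x`. Here `R_x` is half
the distance from `x` to the nearest other point, capped at a length `L`. The balls of radius `R_x`
are disjoint, so no two copies interact, and the superposition `trial` is the gradient of a bounded
potential; it is stationary, curl-free and of mean zero.

The flux of `e + trial` equals a constant, plus a divergence-free field of mean zero, plus `residual
• e` with a scalar residual (`smul_trial_eq`). Let `θ` be the weight `min(1, R_x^{-d})` of the point
whose ball covers the origin. The residual is `(β - α) θ` in the inclusion and `c θ` in the rest of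
that ball, where `c` is the Clausius–Mossotti coefficient (`residual_cases`). The contributions
outside the inclusions are exact multiples of shots of `dipole` or of `weight * dipole`, which are
derivatives and have mean zero. Hence the mean of the residual is `c φ`, and its second moment and
its correlation with `trial` are `0`, all up to a multiple of the expectation of `overlap`, the sum
of the weights of the points within distance one of the origin.

By the stationary div-curl identity, the effective conductivity is `α e · v` plus the expectation of
`residual` times `(Φ + e) · v` (`IsCorrector.inner_integral_flux`). Here `Φ` is replaced by `trial`;
the energy estimate bounds the norm of `Φ - trial` by that of the residual, so the replacement costs
only the second moment of the residual (`norm_effective_sub_le`). The total error is therefore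
linear in the expectation of `overlap`.

It remains to estimate the mean weight of a point (`intensity_weight_le`). Points with a neighbor at
distance of order `2^k` have intensity at most a multiple of `λ₂ 2^{kd}` and weight of order
`2^{-kd}`, so every dyadic scale contributes the same amount, of order `λ₂`. With about `|log λ₂|`
scales the remaining term `2^{-Kd} λ₁` is also of order `λ₂`, because `λ₁² ≤ C λ₂`
(`intensity_one_bound`). This is the source of the logarithm. The gap `δ` keeps `|log λ₂|` away from
zero.

The general theory is the Weyl decomposition of stationary fields. Gradients of mollified random
variables span `potentials`, whose orthogonal complement consists of the divergence-free fields.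
Ergodicity enters through a Liouville theorem, which shows that every curl-free field of mean zero
lies in `potentials`. Lax–Milgram on this space yields the corrector. -/

theorem measurable_eval {f : E d → ℝ} (hf : Continuous f) (hc : HasCompactSupport f) :
    Measurable (eval f) := by
  have h : MeasurableSpace.comap (eval f) (borel ℝ) ≤ (inferInstance : MeasurableSpace (PointSet
      d)) :=
    le_iSup_of_le f (le_iSup_of_le hf (le_iSup_of_le hc le_rfl))
  rw [← BorelSpace.measurable_eq (α := ℝ)] at h
  exact (comap_measurable _).mono h le_rfl

theorem measurable_of_eval {X : Type*} [MeasurableSpace X] {g : X → PointSet d}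
    (h : ∀ f : E d → ℝ, Continuous f → HasCompactSupport f → Measurable fun x => eval f (g x)) :
    Measurable g := by
  rw [measurable_iff_comap_le]
  simp only [instMeasurableSpace, MeasurableSpace.comap_iSup, iSup_le_iff]
  intro f hf hc
  rw [MeasurableSpace.comap_comp, ← BorelSpace.measurable_eq (α := ℝ)]
  exact measurable_iff_comap_le.1 (h f hf hc)

theorem countable (S : PointSet d) : S.carrier.Countable := by
  have : S.carrier = ⋃ n : ℕ, S.carrier ∩ ball 0 n := by
    rw [← inter_iUnion, iUnion_ball_nat, inter_univ]
  rw [this]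
  exact countable_iUnion fun n => (S.finite_inter _ isBounded_ball).countable

theorem measurableSet_carrier (S : PointSet d) : MeasurableSet S.carrier :=
  S.countable.measurableSet

/-- The counting measure of a point set. -/
def counting (S : PointSet d) : Measure (E d) := Measure.count.restrict S.carrier

theorem lintegral_counting (S : PointSet d) (f : E d → ℝ≥0∞) :
    ∫⁻ x, f x ∂S.counting = ∑' x : S.carrier, f x := by
  rw [counting, lintegral_countable f S.countable]
  simp

theorem counting_apply (S : PointSet d) {D : Set (E d)} (hD : MeasurableSet D) :
    S.counting D = (S.carrier ∩ D).encard := by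
  rw [counting, Measure.restrict_apply hD, inter_comm,
    Measure.count_apply (S.measurableSet_carrier.inter hD)]

theorem counting_lt_top (S : PointSet d) {D : Set (E d)} (hD : MeasurableSet D)
    (hb : Bornology.IsBounded D) : S.counting D < ⊤ := by
  rw [S.counting_apply hD]
  simpa using S.finite_inter D hb

theorem integral_counting (S : PointSet d) {F : Type*} [NormedAddCommGroup F] [NormedSpace ℝ F]
    [CompleteSpace F] (f : E d → F) {D : Set (E d)} (hb : Bornology.IsBounded D)
    (hf : ∀ x ∈ S.carrier, x ∉ D → f x = 0) :
    ∫ x, f x ∂S.counting = ∑ x ∈ (S.finite_inter D hb).toFinset, f x := by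
  have h2 : S.carrier ∩ D = ((S.finite_inter D hb).toFinset : Set (E d)) := by simp
  have h1 : ∫ x, f x ∂S.counting =
      ∫ x in ((S.finite_inter D hb).toFinset : Set (E d)), f x ∂Measure.count := by
    rw [counting, ← h2]
    exact setIntegral_eq_of_subset_of_forall_sdiff_eq_zero S.measurableSet_carrier
      inter_subset_left fun x hx => hf x hx.1 fun h => hx.2 ⟨hx.1, h⟩
  rw [h1, setIntegral_finset]
  · simp [Measure.real]
  · rw [← biUnion_of_singleton (((S.finite_inter D hb).toFinset : Finset (E d)) : Set (E d))]
    exact integrableOn_finset_iUnion.2 fun x _ => integrableOn_singleton (hx := by simp)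

theorem eval_eq_integral (S : PointSet d) {f : E d → ℝ} (hc : HasCompactSupport f) :
    eval f S = ∫ x, f x ∂S.counting := by
  have hb := hc.isCompact.isBounded
  rw [S.integral_counting f hb fun x _ hx => image_eq_zero_of_notMem_tsupport hx,
    eval, tsum_subtype S.carrier f, tsum_eq_sum (s := (S.finite_inter _ hb).toFinset)]
  · refine Finset.sum_congr rfl fun x hx => indicator_of_mem ?_ _
    simp only [Finite.mem_toFinset] at hx
    exact hx.1
  · intro x hx
    simp only [Finite.mem_toFinset, mem_inter_iff, not_and] at hx
    by_cases h : x ∈ S.carrier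
    · rw [indicator_of_mem h, image_eq_zero_of_notMem_tsupport (hx h)]
    · exact indicator_of_notMem h _

theorem lintegral_counting_eq_eval (S : PointSet d) {f : E d → ℝ≥0} (hf : Continuous f)
    (hc : HasCompactSupport f) :
    ∫⁻ x, f x ∂S.counting = ENNReal.ofReal (eval (fun x => (f x : ℝ)) S) := by
  have hc' : HasCompactSupport fun x => (f x : ℝ) := hc.comp_left (g := fun r : ℝ≥0 => (r : ℝ)) rfl
  rw [S.eval_eq_integral hc', ofReal_integral_eq_lintegral_ofReal]
  · simp
  · have hb := hc'.isCompact.isBounded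
    have : IntegrableOn (fun x => (f x : ℝ)) (tsupport fun x => (f x : ℝ)) S.counting := by
      refine ContinuousOn.integrableOn_of_subset_isCompact
        (NNReal.continuous_coe.comp hf).continuousOn hc'.isCompact
        (isClosed_tsupport _).measurableSet subset_rfl
        (S.counting_lt_top (isClosed_tsupport _).measurableSet hb).ne
    exact (integrableOn_iff_integrable_of_support_subset (subset_tsupport _)).1 this
  · exact ae_of_all _ fun x => NNReal.coe_nonneg _

/-- Only evaluations at continuous functions are measurable by definition. The indicator of `K` is
the limit of thickened indicators, and these share the support `cthickening 1 K`, on which the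
counting measure is finite, so the limit passes through the integral. -/
theorem measurable_counting_compact {K : Set (E d)} (hK : IsCompact K) :
    Measurable fun S : PointSet d => S.counting K := by
  have hpos : ∀ n : ℕ, (0 : ℝ) < 1 / (n + 1) := fun n => by positivity
  have hlim : Tendsto (fun n : ℕ => (1 : ℝ) / (n + 1)) atTop (𝓝 0) :=
    tendsto_one_div_add_atTop_nhds_zero_nat
  have hsupp : ∀ n : ℕ, ∀ x, x ∉ cthickening 1 K → thickenedIndicator (hpos n) K x = 0 := by
    intro n x hx
    refine thickenedIndicator_zero (hpos n) K fun h => hx ?_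
    refine thickening_subset_cthickening_of_le ?_ K h
    rw [div_le_one (by positivity)]; simp
  have hcomp : IsCompact (cthickening 1 K) := hK.cthickening
  have hcs : ∀ n : ℕ, HasCompactSupport (thickenedIndicator (hpos n) K) := fun n =>
    HasCompactSupport.intro hcomp fun x hx => hsupp n x hx
  refine measurable_of_tendsto_metrizable
    (f := fun (n : ℕ) (S : PointSet d) => ∫⁻ x, thickenedIndicator (hpos n) K x ∂S.counting)
    (fun n => ?_) ?_
  · have : (fun S : PointSet d => ∫⁻ x, thickenedIndicator (hpos n) K x ∂S.counting) =
        fun S => ENNReal.ofReal (eval (fun x => (thickenedIndicator (hpos n) K x : ℝ)) S) := by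
      funext S
      exact S.lintegral_counting_eq_eval (thickenedIndicator (hpos n) K).continuous (hcs n)
    rw [this]
    exact (measurable_eval (NNReal.continuous_coe.comp (thickenedIndicator (hpos n) K).continuous)
      ((hcs n).comp_left (g := fun r : ℝ≥0 => (r : ℝ)) rfl)).ennreal_ofReal
  · rw [tendsto_pi_nhds]
    intro S
    have hm : MeasurableSet (cthickening 1 K) := hcomp.isClosed.measurableSet
    have : IsFiniteMeasure (S.counting.restrict (cthickening 1 K)) :=
      ⟨by simpa using S.counting_lt_top hm hcomp.isBounded⟩
    have h := tendsto_lintegral_thickenedIndicator_of_isClosed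
      (S.counting.restrict (cthickening 1 K)) hK.isClosed hpos hlim
    rw [Measure.restrict_apply hK.isClosed.measurableSet,
      inter_eq_left.2 (self_subset_cthickening K)] at h
    refine h.congr fun n => ?_
    refine setLIntegral_eq_of_support_subset ?_
    intro x hx
    by_contra hx'
    exact hx (by simp only [hsupp n x hx', ENNReal.coe_zero])

/-- Closed sets form a generating π-system. Intersected with a closed ball they are compact, and the
restricted counting measure is finite, so the π-λ argument applies on each ball. -/
theorem measurable_counting : Measurable (counting : PointSet d → Measure (E d)) := by
  have key : ∀ n : ℕ, Measurable fun S : PointSet d =>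
      S.counting.restrict (closedBall (0 : E d) n) := by
    intro n
    have : ∀ S : PointSet d, IsFiniteMeasure (S.counting.restrict (closedBall (0 : E d) n)) :=
      fun S => ⟨by simpa using S.counting_lt_top measurableSet_closedBall isBounded_closedBall⟩
    refine Measurable.measure_of_isPiSystem
      ((BorelSpace.measurable_eq (α := E d)).trans borel_eq_generateFrom_isClosed)
      isPiSystem_isClosed ?_ ?_
    · intro C hC
      simp only [mem_ofPred_eq] at hC
      simp_rw [Measure.restrict_apply hC.measurableSet]
      exact measurable_counting_compact ((isCompact_closedBall _ _).inter_left hC)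
    · simp_rw [Measure.restrict_apply MeasurableSet.univ, univ_inter]
      exact measurable_counting_compact (isCompact_closedBall _ _)
  refine Measure.measurable_of_measurable_coe _ fun D hD => ?_
  have : (fun S : PointSet d => S.counting D) =
      fun S => ⨆ n : ℕ, S.counting.restrict (closedBall (0 : E d) n) D := by
    funext S
    simp_rw [Measure.restrict_apply hD]
    rw [← Monotone.measure_iUnion, ← inter_iUnion, iUnion_closedBall_nat, inter_univ]
    exact fun m n hmn => inter_subset_inter_right _ (closedBall_subset_closedBall (by simpa using
        hmn))
  rw [this]
  exact Measurable.iSup fun n => (Measure.measurable_coe hD).comp (key n)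

end PointSet

/-- The counting measure of the point set, as a kernel. -/
def countingKernel (d : ℕ) : Kernel (PointSet d) (E d) where
  toFun := PointSet.counting
  measurable' := PointSet.measurable_counting

@[simp]
theorem countingKernel_apply (S : PointSet d) : countingKernel d S = S.counting := rfl

/-- Needed for Tonelli and for measurability of integrals over the points. The number of points in a
ball is finite but not bounded uniformly in the point set, so space is cut into shells and, for each
shell, the point sets are sorted by the number of points in the ball. -/
instance : IsSFiniteKernel (countingKernel d) := by
  have hA : ∀ n : ℕ, MeasurableSet (disjointed (fun n : ℕ => closedBall (0 : E d) n) n) := fun n =>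
    MeasurableSet.disjointed (fun n => measurableSet_closedBall) n
  have hN : ∀ n k : ℕ, MeasurableSet {S : PointSet d | S.counting (closedBall 0 n) = k} :=
    fun n k => (Measure.measurable_coe measurableSet_closedBall).comp PointSet.measurable_counting
      (measurableSet_singleton _)
  classical
  have hsf : ∀ n : ℕ, IsSFiniteKernel ((countingKernel d).restrict (hA n)) := by
    intro n
    have hfin : ∀ S : PointSet d, ∃ k : ℕ, S.counting (closedBall 0 n) = k := by
      intro S
      have h := S.counting_lt_top (D := closedBall (0 : E d) n) measurableSet_closedBall
        isBounded_closedBall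
      rw [S.counting_apply measurableSet_closedBall] at h ⊢
      obtain ⟨k, hk⟩ := ENat.ne_top_iff_exists.1 (show (S.carrier ∩ closedBall 0 n).encard ≠ ⊤ by
        simpa using h.ne)
      exact ⟨k, by rw [← hk]; rfl⟩
    have hsum : (countingKernel d).restrict (hA n) = Kernel.sum fun k : ℕ =>
        Kernel.piecewise (hN n k) ((countingKernel d).restrict (hA n)) 0 := by
      ext S D hD
      rw [Kernel.sum_apply' _ _ hD]
      obtain ⟨k, hk⟩ := hfin S
      rw [tsum_eq_single k]
      · simp [Kernel.piecewise_apply, hk]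
      · intro j hj
        have : ¬ S.counting (closedBall 0 n) = j := by
          rw [hk]; exact_mod_cast hj.symm
        simp [Kernel.piecewise_apply, this]
    rw [hsum]
    have : ∀ k : ℕ, IsFiniteKernel (Kernel.piecewise (hN n k)
        ((countingKernel d).restrict (hA n)) 0) := by
      intro k
      refine ⟨⟨k, by simp, fun S => ?_⟩⟩
      by_cases h : S.counting (closedBall 0 n) = k
      · simp only [Kernel.piecewise_apply, mem_ofPred_eq, h, if_true, Kernel.restrict_apply,
          countingKernel_apply, Measure.restrict_apply MeasurableSet.univ, univ_inter]
        exact (measure_mono (disjointed_subset _ _)).trans h.le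
      · simp [Kernel.piecewise_apply, h]
    infer_instance
  have : countingKernel d = Kernel.sum fun n => (countingKernel d).restrict (hA n) := by
    ext S D hD
    rw [Kernel.sum_apply' _ _ hD]
    simp_rw [Kernel.restrict_apply, Measure.restrict_apply hD]
    rw [← measure_iUnion, ← inter_iUnion, iUnion_disjointed, iUnion_closedBall_nat, inter_univ]
    · intro i j hij
      exact ((disjoint_disjointed _) hij).mono inter_subset_right inter_subset_right
    · exact fun n => hD.inter (hA n)
  rw [this]
  infer_instance

namespace PointSet

theorem counting_vadd (z : E d) (S : PointSet d) :
    (z +ᵥ S).counting = S.counting.map (fun x => z + x) := by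
  ext D hD
  rw [Measure.map_apply (measurable_const_add z) hD, counting_apply _ hD,
    counting_apply _ (measurable_const_add z hD), carrier_vadd,
    ← (add_right_injective z).encard_image (S.carrier ∩ _), image_inter_preimage]

theorem lintegral_counting_vadd (z : E d) (S : PointSet d) {f : E d → ℝ≥0∞} (hf : Measurable f) :
    ∫⁻ x, f x ∂(z +ᵥ S).counting = ∫⁻ x, f (z + x) ∂S.counting := by
  rw [counting_vadd, lintegral_map hf (measurable_const_add z)]

theorem integral_counting_vadd (z : E d) (S : PointSet d) {F : Type*} [NormedAddCommGroup F]
    [NormedSpace ℝ F] (f : E d → F) :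
    ∫ x, f x ∂(z +ᵥ S).counting = ∫ x, f (z + x) ∂S.counting := by
  rw [counting_vadd]
  exact (MeasurableEquiv.addLeft z).measurableEmbedding.integral_map f

/-- A Carathéodory argument: the evaluation at a translated point set is continuous in the
translation, being near `z₀` a finite sum over fixed points, and it is measurable in the point set.
-/
theorem measurable_vadd : Measurable fun p : E d × PointSet d => p.1 +ᵥ p.2 := by
  refine measurable_of_eval fun f hf hc => ?_
  refine measurable_uncurry_of_continuous_of_measurable (u := fun z S => eval f (z +ᵥ S)) ?_ ?_
  · intro S
    refine continuous_iff_continuousAt.2 fun z₀ => ?_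
    obtain ⟨R, hR⟩ := hc.isCompact.isBounded.exists_norm_le
    have hz : ∀ z ∈ ball z₀ 1, eval f (z +ᵥ S) =
        ∑ x ∈ (S.finite_inter (closedBall 0 (R + ‖z₀‖ + 1)) isBounded_closedBall).toFinset,
          f (z + x) := by
      intro z hz
      rw [eval_eq_integral _ hc, integral_counting_vadd]
      refine S.integral_counting _ isBounded_closedBall fun x _ hx => ?_
      by_contra h
      refine hx ?_
      have h1 := hR _ (subset_tsupport f h)
      have h2 : ‖z‖ ≤ ‖z₀‖ + 1 := by
        have := norm_le_norm_add_norm_sub' z z₀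
        rw [mem_ball_iff_norm] at hz
        linarith
      have h3 : ‖x‖ ≤ ‖z + x‖ + ‖z‖ := by
        simpa using norm_sub_le (z + x) z
      rw [mem_closedBall_zero_iff]
      linarith
    have hcont : Continuous fun z => ∑ x ∈ (S.finite_inter (closedBall 0 (R + ‖z₀‖ + 1))
        isBounded_closedBall).toFinset, f (z + x) := by fun_prop
    exact hcont.continuousAt.congr
      (Filter.eventuallyEq_of_mem (ball_mem_nhds z₀ one_pos) fun z hz' => (hz z hz').symm)
  · intro z
    have : (fun S : PointSet d => eval f (z +ᵥ S)) = fun S => eval (fun x => f (z + x)) S := by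
      funext S
      rw [eval_eq_integral _ hc, integral_counting_vadd, eval_eq_integral]
      exact hc.comp_homeomorph (Homeomorph.addLeft z)
    rw [this]
    exact measurable_eval (by fun_prop) (hc.comp_homeomorph (Homeomorph.addLeft z))

end PointSet

end

/-! ### Stationarity, Campbell's formula and the intensity -/

section

instance : MeasurableConstVAdd (E d) (PointSet d) :=
  ⟨fun _ => PointSet.measurable_vadd.comp measurable_prodMk_left⟩

theorem measurable_neg_vadd : Measurable fun p : PointSet d × E d => -p.2 +ᵥ p.1 :=
  PointSet.measurable_vadd.comp (measurable_snd.neg.prodMk measurable_fst)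

instance (S : PointSet d) : SFinite S.counting :=
  inferInstanceAs (SFinite (countingKernel d S))

theorem PointSet.measurable_lintegral_counting {f : PointSet d → E d → ℝ≥0∞}
    (hf : Measurable (Function.uncurry f)) :
    Measurable fun S => ∫⁻ x, f S x ∂S.counting :=
  Measurable.lintegral_kernel_prod_right (κ := countingKernel d) hf

section Stationary

variable {P : Measure (PointSet d)} [VAddInvariantMeasure (E d) (PointSet d) P]

theorem lintegral_vadd (z : E d) (f : PointSet d → ℝ≥0∞) :
    ∫⁻ S, f (z +ᵥ S) ∂P = ∫⁻ S, f S ∂P :=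
  (measurePreserving_vadd z P).lintegral_comp_emb (MeasurableEquiv.vadd z).measurableEmbedding f

theorem lintegral_lintegral_field [SFinite P] {f : PointSet d → ℝ≥0∞} (hf : Measurable f)
    {h : E d → ℝ≥0∞} (hh : Measurable h) :
    ∫⁻ S, (∫⁻ x, h x * f (-x +ᵥ S)) ∂P = (∫⁻ x, h x) * ∫⁻ S, f S ∂P := by
  have hm : Measurable (Function.uncurry fun (S : PointSet d) (x : E d) => h x * f (-x +ᵥ S)) :=
    (hh.comp measurable_snd).mul (hf.comp measurable_neg_vadd)
  rw [lintegral_lintegral_swap hm.aemeasurable]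
  rw [← lintegral_mul_const _ hh]
  refine lintegral_congr fun x => ?_
  rw [lintegral_const_mul (h x) (f := fun S => f (-x +ᵥ S)) (hf.comp (measurable_const_vadd _)),
    lintegral_vadd]

/-- `F` is evaluated as seen from `x`, so translating the point set by `z` only shifts the argument
of `h`. By stationarity the expectation is unchanged; averaging over `z` with weight `k` and
exchanging integrals gives the identity. -/
theorem lintegral_counting_mul_lintegral [SFinite P] {F : PointSet d → ℝ≥0∞} (hF : Measurable F)
    {h k : E d → ℝ≥0∞} (hh : Measurable h) (hk : Measurable k) :
    (∫⁻ z, k z) * ∫⁻ S, ∫⁻ x, F (-x +ᵥ S) * h x ∂S.counting ∂P =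
      ∫⁻ S, ∫⁻ x, F (-x +ᵥ S) * (∫⁻ z, k z * h (z + x)) ∂S.counting ∂P := by
  have hFx : Measurable fun p : PointSet d × E d => F (-p.2 +ᵥ p.1) := hF.comp measurable_neg_vadd
  have h1 : ∀ z : E d, ∫⁻ S, ∫⁻ x, F (-x +ᵥ S) * h x ∂S.counting ∂P =
      ∫⁻ S, ∫⁻ x, F (-x +ᵥ S) * h (z + x) ∂S.counting ∂P := by
    intro z
    rw [← lintegral_vadd z]
    refine lintegral_congr fun S => ?_
    rw [PointSet.lintegral_counting_vadd z S (f := fun x => F (-x +ᵥ (z +ᵥ S)) * h x)]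
    · refine lintegral_congr fun x => ?_
      rw [vadd_vadd]
      congr 3
      abel
    · exact (hFx.comp measurable_prodMk_left).mul hh
  have hm2 : Measurable fun p : E d × (PointSet d × E d) =>
      k p.1 * (F (-p.2.2 +ᵥ p.2.1) * h (p.1 + p.2.2)) :=
    (hk.comp measurable_fst).mul ((hFx.comp measurable_snd).mul
      (hh.comp (measurable_fst.add measurable_snd.snd)))
  rw [← lintegral_mul_const _ hk]
  calc ∫⁻ z, k z * ∫⁻ S, ∫⁻ x, F (-x +ᵥ S) * h x ∂S.counting ∂P
      = ∫⁻ z, ∫⁻ S, ∫⁻ x, k z * (F (-x +ᵥ S) * h (z + x)) ∂S.counting ∂P := by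
        refine lintegral_congr fun z => ?_
        have hmz : Measurable (Function.uncurry fun (S : PointSet d) (x : E d) =>
            F (-x +ᵥ S) * h (z + x)) :=
          hFx.mul (hh.comp (measurable_snd.const_add z))
        rw [h1 z, ← lintegral_const_mul _ (PointSet.measurable_lintegral_counting hmz)]
        refine lintegral_congr fun S => ?_
        exact (lintegral_const_mul (k z) (hmz.comp measurable_prodMk_left)).symm
    _ = ∫⁻ S, (∫⁻ z, ∫⁻ x, k z * (F (-x +ᵥ S) * h (z + x)) ∂S.counting) ∂P := by
        refine lintegral_lintegral_swap (Measurable.aemeasurable ?_)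
        exact Measurable.lintegral_kernel_prod_right
          (κ := (countingKernel d).comap (Prod.snd : E d × PointSet d → PointSet d) measurable_snd)
          (f := fun (p : E d × PointSet d) x => k p.1 * (F (-x +ᵥ p.2) * h (p.1 + x)))
          (hm2.comp ((measurable_fst.fst).prodMk (measurable_fst.snd.prodMk measurable_snd)))
    _ = ∫⁻ S, ∫⁻ x, (∫⁻ z, k z * (F (-x +ᵥ S) * h (z + x))) ∂S.counting ∂P := by
        refine lintegral_congr fun S => ?_
        refine lintegral_lintegral_swap (Measurable.aemeasurable ?_)
        exact hm2.comp (measurable_fst.prodMk (measurable_const.prodMk measurable_snd))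
    _ = _ := by
        refine lintegral_congr fun S => lintegral_congr fun x => ?_
        rw [← lintegral_const_mul _ (f := fun z => k z * h (z + x))
          (hk.mul (hh.comp (measurable_add_const x)))]
        refine lintegral_congr fun z => ?_
        ring

/-- The mean of `F` over the points of the process, per unit volume, where `F` is evaluated at the
point set as seen from the point. -/
def intensity (P : Measure (PointSet d)) (F : PointSet d → ℝ≥0∞) : ℝ≥0∞ :=
  (volume (ball (0 : E d) 1))⁻¹ *
    ∫⁻ S, ∫⁻ x, F (-x +ᵥ S) * (ball (0 : E d) 1).indicator 1 x ∂S.counting ∂P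

/-- Campbell's formula. The averaging identity is applied twice, with the roles of `h` and of the
unit ball exchanged up to a reflection. Both right-hand sides are the same double integral, so the
left-hand sides agree, also when they are infinite. -/
theorem lintegral_counting_eq_intensity_mul [SFinite P] {F : PointSet d → ℝ≥0∞} (hF : Measurable
    F) {h : E d → ℝ≥0∞}
    (hh : Measurable h) :
    ∫⁻ S, ∫⁻ x, F (-x +ᵥ S) * h x ∂S.counting ∂P = intensity P F * ∫⁻ x, h x := by
  have hk : Measurable ((ball (0 : E d) 1).indicator (1 : E d → ℝ≥0∞)) :=
    measurable_one.indicator measurableSet_ball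
  have h1 := lintegral_counting_mul_lintegral (P := P) hF hh hk
  have h2 := lintegral_counting_mul_lintegral (P := P) hF hk (hh.comp measurable_neg)
  have h4 : ∀ x : E d, ∫⁻ z, (h ∘ Neg.neg) z * (ball (0 : E d) 1).indicator 1 (z + x) =
      ∫⁻ z, h z * (ball (0 : E d) 1).indicator 1 (z - x) := by
    intro x
    rw [← lintegral_neg_eq_self]
    refine lintegral_congr fun z => ?_
    have : -z + x ∈ ball (0 : E d) 1 ↔ z - x ∈ ball (0 : E d) 1 := by
      rw [mem_ball_zero_iff, mem_ball_zero_iff, ← norm_neg (-z + x)]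
      simp [sub_eq_add_neg, add_comm]
    by_cases hz : z - x ∈ ball (0 : E d) 1
    · simp [indicator_of_mem hz, indicator_of_mem (this.2 hz)]
    · simp [indicator_of_notMem hz, indicator_of_notMem (fun h' => hz (this.1 h'))]
  have h3 : ∀ x : E d, ∫⁻ z, (ball (0 : E d) 1).indicator 1 z * h (z + x) =
      ∫⁻ z, h z * (ball (0 : E d) 1).indicator 1 (z - x) := by
    intro x
    rw [← lintegral_sub_right_eq_self _ x]
    refine lintegral_congr fun z => ?_
    rw [sub_add_cancel, mul_comm]
  have h5 : ∫⁻ z, (h ∘ Neg.neg) z = ∫⁻ z, h z := lintegral_neg_eq_self h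
  simp_rw [h3] at h1
  simp_rw [h4, h5, ← h1] at h2
  rw [lintegral_indicator_one measurableSet_ball] at h2
  rw [intensity, mul_assoc, mul_comm _ (∫⁻ x, h x), h2, ← mul_assoc, ENNReal.inv_mul_cancel,
      one_mul]
  · exact (measure_ball_pos _ _ one_pos).ne'
  · exact measure_ball_lt_top.ne

end Stationary

variable {P : Measure (PointSet d)}

theorem intensity_mono {F G : PointSet d → ℝ≥0∞} (h : ∀ S, F S ≤ G S) :
    intensity P F ≤ intensity P G := by
  unfold intensity
  gcongr
  exact h _

theorem intensity_const_mul {F : PointSet d → ℝ≥0∞} (hF : Measurable F) (c : ℝ≥0∞) :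
    intensity P (fun S => c * F S) = c * intensity P F := by
  have hm : Measurable (Function.uncurry fun (S : PointSet d) (x : E d) =>
      F (-x +ᵥ S) * (ball (0 : E d) 1).indicator (1 : E d → ℝ≥0∞) x) :=
    (hF.comp measurable_neg_vadd).mul
      ((measurable_one.indicator measurableSet_ball).comp measurable_snd)
  unfold intensity
  simp_rw [mul_assoc]
  rw [← mul_assoc c, mul_comm c, mul_assoc,
    ← lintegral_const_mul _ (PointSet.measurable_lintegral_counting hm)]
  congr 2
  funext S
  exact lintegral_const_mul _ (hm.comp measurable_prodMk_left)

theorem intensity_add {F G : PointSet d → ℝ≥0∞} (hF : Measurable F) :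
    intensity P (fun S => F S + G S) = intensity P F + intensity P G := by
  have hm : Measurable (Function.uncurry fun (S : PointSet d) (x : E d) =>
      F (-x +ᵥ S) * (ball (0 : E d) 1).indicator (1 : E d → ℝ≥0∞) x) :=
    (hF.comp measurable_neg_vadd).mul
      ((measurable_one.indicator measurableSet_ball).comp measurable_snd)
  unfold intensity
  simp_rw [add_mul]
  rw [← mul_add, ← lintegral_add_left (PointSet.measurable_lintegral_counting hm)]
  congr 2
  funext S
  exact lintegral_add_left (hm.comp measurable_prodMk_left) _

end

/-! ### Transfer between random variables and their stationary fields -/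

section

/-- The stationary field generated by a random variable. -/
def field {G : Type*} (F : PointSet d → G) (S : PointSet d) (x : E d) : G := F (-x +ᵥ S)

theorem stationaryField_eq_field (Φ : PointSet d → E d) : stationaryField Φ = field Φ := rfl

theorem field_neg_vadd {G : Type*} (F : PointSet d → G) (S : PointSet d) (x y : E d) :
    field F (-y +ᵥ S) x = field F S (x + y) := by
  simp only [field, vadd_vadd, neg_add]

theorem lintegral_mul_sq_le {X : Type*} [MeasurableSpace X] (μ : Measure X) {f g : X → ℝ≥0∞}
    (hf : AEMeasurable f μ) (hg : AEMeasurable g μ) :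
    (∫⁻ x, f x * g x ∂μ) ^ 2 ≤ (∫⁻ x, f x ^ 2 ∂μ) * ∫⁻ x, g x ^ 2 ∂μ := by
  have h := ENNReal.lintegral_mul_le_Lp_mul_Lq μ Real.HolderConjugate.two_two hf hg
  calc (∫⁻ x, f x * g x ∂μ) ^ 2 ≤ ((∫⁻ x, f x ^ (2 : ℝ) ∂μ) ^ (1 / (2 : ℝ)) *
        (∫⁻ x, g x ^ (2 : ℝ) ∂μ) ^ (1 / (2 : ℝ))) ^ 2 := by gcongr; exact h
    _ = _ := by
      rw [mul_pow, ← ENNReal.rpow_natCast, ← ENNReal.rpow_natCast, ← ENNReal.rpow_mul,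
        ← ENNReal.rpow_mul]
      norm_num

theorem memLp_two_of_lintegral_lt_top {X G : Type*} [MeasurableSpace X] [NormedAddCommGroup G]
    {μ : Measure X} {f : X → G} (hf : AEStronglyMeasurable f μ)
    (h : ∫⁻ x, ‖f x‖ₑ ^ 2 ∂μ < ⊤) : MemLp f 2 μ := by
  refine ⟨hf, (eLpNorm_lt_top_iff_lintegral_rpow_enorm_lt_top two_ne_zero ENNReal.ofNat_ne_top).2
      ?_⟩
  simpa using h

theorem lintegral_lt_top_of_memLp_two {X G : Type*} [MeasurableSpace X] [NormedAddCommGroup G]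
    {μ : Measure X} {f : X → G} (hf : MemLp f 2 μ) : ∫⁻ x, ‖f x‖ₑ ^ 2 ∂μ < ⊤ := by
  have := (eLpNorm_lt_top_iff_lintegral_rpow_enorm_lt_top two_ne_zero ENNReal.ofNat_ne_top).1 hf.2
  simpa using this

section Stationary

variable {P : Measure (PointSet d)} [IsProbabilityMeasure P]
  [VAddInvariantMeasure (E d) (PointSet d) P]

/-- By Tonelli and stationarity, the expected volume of translations that land in a null event is
zero. The measurable hull is used because `p` need not be measurable. -/
theorem ae_field {p : PointSet d → Prop} (h : ∀ᵐ S ∂P, p S) :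
    ∀ᵐ S ∂P, ∀ᵐ x : E d, p (-x +ᵥ S) := by
  set t := toMeasurable P {S | ¬ p S} with ht
  have htm : MeasurableSet t := measurableSet_toMeasurable _ _
  have ht0 : P t = 0 := by rw [ht, measure_toMeasurable]; exact h
  have hf : Measurable (t.indicator (1 : PointSet d → ℝ≥0∞)) := measurable_one.indicator htm
  have h1 := lintegral_lintegral_field (P := P) hf (h := fun _ => 1) measurable_const
  simp only [one_mul] at h1
  rw [lintegral_indicator_one htm, ht0, mul_zero, lintegral_eq_zero_iff] at h1
  · filter_upwards [h1] with S hS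
    rw [Pi.zero_apply, lintegral_eq_zero_iff] at hS
    · filter_upwards [hS] with x hx
      by_contra hp
      have : -x +ᵥ S ∈ t := subset_toMeasurable _ _ hp
      rw [indicator_of_mem this] at hx
      simp at hx
    · exact hf.comp (measurable_neg_vadd.comp measurable_prodMk_left)
  · exact Measurable.lintegral_prod_right (hf.comp measurable_neg_vadd)

theorem ae_of_ae_field {p : PointSet d → Prop} (hp : MeasurableSet {S | p S})
    (h : ∀ᵐ S ∂P, ∀ᵐ x : E d, p (-x +ᵥ S)) : ∀ᵐ S ∂P, p S := by
  have hf : Measurable ({S | p S}ᶜ.indicator (1 : PointSet d → ℝ≥0∞)) :=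
    measurable_one.indicator hp.compl
  have h1 := lintegral_lintegral_field (P := P) hf (h := (ball (0 : E d) 1).indicator 1)
    (measurable_one.indicator measurableSet_ball)
  have h0 : ∫⁻ S, (∫⁻ x, (ball (0 : E d) 1).indicator 1 x *
      {S | p S}ᶜ.indicator (1 : PointSet d → ℝ≥0∞) (-x +ᵥ S)) ∂P = 0 := by
    rw [lintegral_congr_ae (g := 0)]
    · simp
    · filter_upwards [h] with S hS
      rw [Pi.zero_apply, lintegral_congr_ae (g := 0)]
      · simp
      · filter_upwards [hS] with x hx
        have : -x +ᵥ S ∉ {S | p S}ᶜ := fun h' => h' hx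
        rw [indicator_of_notMem this]
        simp
  rw [h0, lintegral_indicator_one hp.compl, lintegral_indicator_one measurableSet_ball, eq_comm,
    mul_eq_zero] at h1
  exact h1.resolve_left (measure_ball_pos _ _ one_pos).ne'

/-- The expected energy of the field in a ball is the volume of the ball times the second moment,
hence the energy is almost surely finite. -/
theorem memL2Loc_field {G : Type*} [NormedAddCommGroup G] {F : PointSet d → G}
    (hF : MemLp F 2 P) : ∀ᵐ S ∂P, MemL2Loc (field F S) := by
  obtain ⟨F', hF', hFF'⟩ := hF.1
  have hL : MemLp F' 2 P := hF.ae_eq hFF'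
  have h1 : ∀ n : ℕ, ∀ᵐ S ∂P, ∫⁻ x in ball (0 : E d) n, ‖F' (-x +ᵥ S)‖ₑ ^ 2 < ⊤ := by
    intro n
    have h2 := lintegral_lintegral_field (P := P) (f := fun S => ‖F' S‖ₑ ^ 2)
      (hF'.enorm.pow_const 2) (h := (ball (0 : E d) n).indicator 1)
      (measurable_one.indicator measurableSet_ball)
    rw [lintegral_indicator_one measurableSet_ball] at h2
    have h3 : ∫⁻ S, (∫⁻ x, (ball (0 : E d) n).indicator 1 x * ‖F' (-x +ᵥ S)‖ₑ ^ 2) ∂P ≠ ⊤ := by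
      rw [h2]
      exact ENNReal.mul_ne_top measure_ball_lt_top.ne (lintegral_lt_top_of_memLp_two hL).ne
    have h4 := ae_lt_top ?_ h3
    · filter_upwards [h4] with S hS
      rw [← lintegral_indicator measurableSet_ball]
      refine lt_of_le_of_lt (lintegral_mono fun x => ?_) hS
      by_cases hx : x ∈ ball (0 : E d) n
      · simp [hx]
      · simp [hx]
    · exact Measurable.lintegral_prod_right
        (((measurable_one.indicator measurableSet_ball).comp measurable_snd).mul
        ((hF'.enorm.pow_const 2).comp measurable_neg_vadd))
  filter_upwards [ae_all_iff.2 h1, ae_field hFF'] with S hS hSF R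
  obtain ⟨n, hn⟩ := exists_nat_ge R
  have h5 : MemLp (field F' S) 2 (volume.restrict (ball 0 n)) := by
    refine memLp_two_of_lintegral_lt_top ?_ (hS n)
    exact (hF'.comp_measurable
      (measurable_neg_vadd.comp measurable_prodMk_left)).aestronglyMeasurable
  have h6 := h5.mono_measure (Measure.restrict_mono (ball_subset_ball hn) le_rfl)
  refine h6.ae_eq (ae_restrict_of_ae ?_)
  filter_upwards [hSF] with x hx
  exact hx.symm

theorem integrable_field_prod {G : Type*} [NormedAddCommGroup G] [NormedSpace ℝ G]
    {f : PointSet d → G} (hf : StronglyMeasurable f)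
    (hi : Integrable f P) {η : E d → ℝ} (hη : Integrable η) (hm : Measurable η) :
    Integrable (fun p : PointSet d × E d => η p.2 • f (-p.2 +ᵥ p.1)) (P.prod volume) := by
  refine ⟨((hm.comp measurable_snd).stronglyMeasurable.smul
    (hf.comp_measurable measurable_neg_vadd)).aestronglyMeasurable, ?_⟩
  have h1 : Measurable fun p : PointSet d × E d => ‖η p.2‖ₑ * ‖f (-p.2 +ᵥ p.1)‖ₑ :=
    (hm.enorm.comp measurable_snd).mul (hf.enorm.comp measurable_neg_vadd)
  rw [hasFiniteIntegral_iff_enorm]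
  simp_rw [enorm_smul]
  rw [lintegral_prod _ h1.aemeasurable, lintegral_lintegral_field hf.enorm hm.enorm]
  exact ENNReal.mul_lt_top hη.2 hi.2

theorem integral_integral_field {G : Type*} [NormedAddCommGroup G] [NormedSpace ℝ G]
    [CompleteSpace G]
    {f : PointSet d → G} (hf : StronglyMeasurable f)
    (hi : Integrable f P) {η : E d → ℝ} (hη : Integrable η) (hm : Measurable η) :
    ∫ S, (∫ x, η x • f (-x +ᵥ S)) ∂P = (∫ x, η x) • ∫ S, f S ∂P := by
  rw [integral_integral_swap (integrable_field_prod hf hi hη hm), ← integral_smul_const]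
  refine integral_congr_ae (ae_of_all _ fun x => ?_)
  simp only
  rw [integral_smul]
  congr 1
  exact (measurePreserving_vadd (-x) P).integral_comp (MeasurableEquiv.vadd
      (-x)).measurableEmbedding f

end Stationary

end

/-! ### Test functions, and mollification of random variables along translations -/

section

/-- The partial derivative in the `i`-th coordinate direction. -/
def pd (i : Fin d) (η : E d → ℝ) (x : E d) : ℝ := fderiv ℝ η x (EuclideanSpace.single i 1)

theorem IsTest.pd {η : E d → ℝ} (h : IsTest η) (i : Fin d) : IsTest (pd i η) :=
  ⟨(h.1.fderiv_right (m := ∞) (by simp)).clm_apply contDiff_const,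
    (h.2.fderiv ℝ).comp_left (g := fun L : E d →L[ℝ] ℝ => L (EuclideanSpace.single i 1)) rfl⟩

theorem IsTest.continuous {η : E d → ℝ} (h : IsTest η) : Continuous η := h.1.continuous

theorem IsTest.differentiable {η : E d → ℝ} (h : IsTest η) : Differentiable ℝ η :=
  h.1.differentiable (by simp)

theorem IsTest.integrable {η : E d → ℝ} (h : IsTest η) : Integrable η :=
  h.continuous.integrable_of_hasCompactSupport h.2

theorem IsTest.comp_neg {η : E d → ℝ} (h : IsTest η) : IsTest fun x => η (-x) :=
  ⟨h.1.comp contDiff_neg, h.2.comp_homeomorph (Homeomorph.neg (E d))⟩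

theorem IsTest.comp_add_right {η : E d → ℝ} (h : IsTest η) (y : E d) : IsTest fun x => η (x + y) :=
  ⟨h.1.comp (contDiff_id.add contDiff_const), h.2.comp_homeomorph (Homeomorph.addRight y)⟩

theorem pd_comp_sub_left {η : E d → ℝ} (hη : Differentiable ℝ η) (i : Fin d) (y : E d) :
    pd i (fun x => η (y - x)) = fun x => -pd i η (y - x) := by
  funext x
  simp only [pd]
  have h : HasFDerivAt (fun x => η (y - x)) ((fderiv ℝ η (y - x)).comp (-ContinuousLinearMap.id ℝ
      (E d))) x :=
    (hη (y - x)).hasFDerivAt.comp x ((hasFDerivAt_id x).const_sub y)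
  rw [h.fderiv]
  simp

theorem pd_comp_neg {η : E d → ℝ} (hη : Differentiable ℝ η) (i : Fin d) :
    pd i (fun x => η (-x)) = fun x => -pd i η (-x) := by
  simpa using pd_comp_sub_left hη i 0

theorem pd_comm {η : E d → ℝ} (hη : IsTest η) (i j : Fin d) : pd i (pd j η) = pd j (pd i η) := by
  funext x
  have hη2 : ContDiff ℝ 2 η := contDiff_infty.1 hη.1 2
  have h2 : ∀ k, fderiv ℝ (pd k η) x =
      (ContinuousLinearMap.apply ℝ ℝ (EuclideanSpace.single k 1)).comp (fderiv ℝ (fderiv ℝ η) x)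
          := by
    intro k
    have hd : DifferentiableAt ℝ (fderiv ℝ η) x :=
      ((hη2.fderiv_right (m := 1) (by norm_num)).differentiable (by simp)) x
    exact ((ContinuousLinearMap.apply ℝ ℝ (EuclideanSpace.single k (1 : ℝ))).hasFDerivAt.comp x
      hd.hasFDerivAt).fderiv
  have hs : IsSymmSndFDerivAt ℝ η x := hη2.contDiffAt.isSymmSndFDerivAt (by simp)
  change fderiv ℝ (pd j η) x _ = fderiv ℝ (pd i η) x _
  rw [h2, h2]
  exact hs.eq _ _

theorem sum_coord_smul_single (v : E d) : v = ∑ i, v i • EuclideanSpace.single i (1 : ℝ) := by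
  ext j
  simp [Pi.single_apply]

theorem fderiv_apply_eq_sum (η : E d → ℝ) (x v : E d) :
    fderiv ℝ η x v = ∑ i, v i * pd i η x := by
  conv_lhs => rw [sum_coord_smul_single v]
  simp [pd, map_sum]

theorem integral_pd {η : E d → ℝ} (hη : IsTest η) (i : Fin d) : ∫ x, pd i η x = 0 := by
  have h := integral_mul_fderiv_eq_neg_fderiv_mul_of_integrable (μ := volume) (𝕜 := ℝ)
    (f := fun _ : E d => (1 : ℝ)) (g := η) (v := EuclideanSpace.single i 1) ?_ ?_ ?_ ?_ ?_
  · simpa [pd] using h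
  · simp
  · simpa [pd, Function.comp_def] using (show Integrable (fun x => pd i η x) from (hη.pd
      i).integrable)
  · simpa using hη.integrable
  · exact fun x _ => differentiableAt_const _
  · exact fun x _ => hη.differentiable x

theorem MemL2Loc.locallyIntegrable {G : Type*} [NormedAddCommGroup G] {u : E d → G}
    (h : MemL2Loc u) : LocallyIntegrable u := by
  intro x
  refine ⟨ball 0 (‖x‖ + 1), isOpen_ball.mem_nhds (by simp), ?_⟩
  have : IsFiniteMeasure (volume.restrict (ball (0 : E d) (‖x‖ + 1))) :=
    ⟨by simpa using measure_ball_lt_top⟩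
  exact (h (‖x‖ + 1)).integrable (by norm_num)

/-- Average of the translates of a random variable against a weight. -/
def smear (η : E d → ℝ) (F : PointSet d → ℝ) (S : PointSet d) : ℝ := ∫ x, η x * F (x +ᵥ S)

theorem smear_eq (η : E d → ℝ) (F : PointSet d → ℝ) (S : PointSet d) :
    smear η F S = ∫ x, η (-x) * F (-x +ᵥ S) := by
  rw [smear, ← integral_neg_eq_self]

theorem smear_comp_neg (η : E d → ℝ) (F : PointSet d → ℝ) (S : PointSet d) :
    smear (fun x => η (-x)) F S = ∫ x, η x * F (-x +ᵥ S) := by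
  simp [smear_eq]

/-- Averaging a random variable over translations mollifies its realizations by convolution. This
provides smooth random variables whose derivatives fall on the weight. -/
theorem field_smear (η : E d → ℝ) (F : PointSet d → ℝ) (S : PointSet d) (y : E d) :
    field (smear η F) S y = (field F S ⋆[ContinuousLinearMap.mul ℝ ℝ] η) y := by
  rw [field, smear, convolution_def, ← integral_sub_left_eq_self _ volume y]
  refine integral_congr_ae (ae_of_all _ fun x => ?_)
  simp only [field, vadd_vadd, ContinuousLinearMap.mul_apply']
  rw [mul_comm]
  congr 3
  abel

theorem measurable_smear {η : E d → ℝ} (hη : Measurable η) {F : PointSet d → ℝ}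
    (hF : Measurable F) : Measurable (smear η F) := by
  have : StronglyMeasurable fun p : PointSet d × E d => η p.2 * F (p.2 +ᵥ p.1) :=
    ((hη.comp measurable_snd).mul
      (hF.comp (PointSet.measurable_vadd.comp measurable_swap))).stronglyMeasurable
  exact this.integral_prod_right'.measurable

theorem hasFDerivAt_field_smear {η : E d → ℝ} (hη : IsTest η) {F : PointSet d → ℝ}
    {S : PointSet d} (hS : MemL2Loc (field F S)) (y : E d) :
    HasFDerivAt (field (smear η F) S)
      (innerSL ℝ (WithLp.toLp 2 fun i => field (smear (pd i η) F) S y : E d)) y := by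
  have h := hη.2.hasFDerivAt_convolution_right (ContinuousLinearMap.mul ℝ ℝ)
    hS.locallyIntegrable (hη.1.of_le (by simp)) y
  have h1 : field (smear η F) S = (field F S ⋆[ContinuousLinearMap.mul ℝ ℝ] η) :=
    funext fun y => field_smear η F S y
  rw [h1]
  refine h.congr_fderiv (ContinuousLinearMap.ext fun v => Eq.symm ?_)
  rw [convolution_precompR_apply _ hS.locallyIntegrable (hη.2.fderiv ℝ)
    (hη.1.continuous_fderiv (by simp))]
  rw [convolution_def]
  simp_rw [fderiv_apply_eq_sum, map_sum]
  rw [integral_finsetSum]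
  · simp only [innerSL_apply_apply, PiLp.inner_apply, field_smear, convolution_def]
    refine Finset.sum_congr rfl fun i _ => ?_
    simp only [ContinuousLinearMap.mul_apply', RCLike.inner_apply, conj_trivial]
    rw [← integral_const_mul]
    refine integral_congr_ae (ae_of_all _ fun x => ?_)
    simp only; ring
  · intro i _
    have := ((hη.pd i).2.convolutionExists_right (ContinuousLinearMap.mul ℝ ℝ)
      hS.locallyIntegrable (hη.pd i).continuous y).integrable
    simp only [ContinuousLinearMap.mul_apply'] at this ⊢
    refine (this.const_mul (v i)).congr (ae_of_all _ fun x => ?_)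
    simp only; ring

theorem continuous_field_smear {η : E d → ℝ} (hη : IsTest η) {F : PointSet d → ℝ}
    {S : PointSet d} (hS : MemL2Loc (field F S)) : Continuous (field (smear η F) S) :=
  continuous_iff_continuousAt.2 fun y => (hasFDerivAt_field_smear hη hS y).continuousAt

section Stationary

variable {P : Measure (PointSet d)} [IsProbabilityMeasure P]
  [VAddInvariantMeasure (E d) (PointSet d) P]

theorem memLp_smear {η : E d → ℝ} (hη : Continuous η) (hc : HasCompactSupport η)
    {F : PointSet d → ℝ} (hF : Measurable F) (hL : MemLp F 2 P) : MemLp (smear η F) 2 P := by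
  refine memLp_two_of_lintegral_lt_top (measurable_smear hη.measurable hF).aestronglyMeasurable ?_
  set η' : E d → ℝ := fun x => η (-x) 
  have hc' : HasCompactSupport η' := hc.comp_homeomorph (Homeomorph.neg (E d))
  have hηc : Continuous η' := by fun_prop
  have hm : MeasurableSet (tsupport η') := (isClosed_tsupport η').measurableSet
  have hFS : ∀ S : PointSet d, Measurable fun x : E d => F (-x +ᵥ S) := fun S =>
    hF.comp (measurable_neg_vadd.comp measurable_prodMk_left)
  have h1 : ∀ S, ‖smear η F S‖ₑ ^ 2 ≤ (∫⁻ x, ‖η' x‖ₑ ^ 2) *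
      ∫⁻ x, (tsupport η').indicator 1 x * ‖F (-x +ᵥ S)‖ₑ ^ 2 := by
    intro S
    rw [smear_eq]
    calc _ ≤ (∫⁻ x, ‖η' x‖ₑ * ((tsupport η').indicator 1 x * ‖F (-x +ᵥ S)‖ₑ)) ^ 2 := by
          gcongr
          refine (enorm_integral_le_lintegral_enorm _).trans (lintegral_mono fun x => ?_)
          rw [enorm_mul]
          by_cases hx : x ∈ tsupport η'
          · simp [hx, η']
          · simp [show η (-x) = 0 from image_eq_zero_of_notMem_tsupport (f := η') hx]
      _ ≤ (∫⁻ x, ‖η' x‖ₑ ^ 2) *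
          ∫⁻ x, ((tsupport η').indicator 1 x * ‖F (-x +ᵥ S)‖ₑ) ^ 2 := by
          refine lintegral_mul_sq_le _ hηc.measurable.enorm.aemeasurable ?_
          exact ((measurable_one.indicator hm).mul (hFS S).enorm).aemeasurable
      _ = _ := by
          congr 1
          refine lintegral_congr fun x => ?_
          by_cases hx : x ∈ tsupport η'
          · simp [hx]
          · simp [hx]
  refine (lintegral_mono h1).trans_lt ?_
  have hfin : ∫⁻ x, ‖η' x‖ₑ ^ 2 < ⊤ :=
    lintegral_lt_top_of_memLp_two (hηc.memLp_of_hasCompactSupport (μ := volume) hc')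
  rw [lintegral_const_mul' _ _ hfin.ne, lintegral_lintegral_field (f := fun S => ‖F S‖ₑ ^ 2)
    (hF.enorm.pow_const 2) (measurable_one.indicator hm), lintegral_indicator_one hm]
  exact ENNReal.mul_lt_top hfin (ENNReal.mul_lt_top hc'.isCompact.measure_lt_top
    (lintegral_lt_top_of_memLp_two hL))

/-- Testing the stationary field of `G` against `η` is the adjoint of smearing: the translation is
moved from `F` to `G` by stationarity. Fubini is justified by `2ab ≤ a² + b²`, both squares being
integrable against `|η|`. -/
theorem integral_smear_mul {η : E d → ℝ} (hη : Continuous η) (hc : HasCompactSupport η)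
    {F G : PointSet d → ℝ} (hF : Measurable F) (hFL : MemLp F 2 P)
    (hG : Measurable G) (hGL : MemLp G 2 P) :
    ∫ S, smear η F S * G S ∂P = ∫ S, F S * (∫ x, η x * G (-x +ᵥ S)) ∂P := by
  have hi : Integrable η := hη.integrable_of_hasCompactSupport hc
  have hFm : Measurable fun p : PointSet d × E d => F (p.2 +ᵥ p.1) :=
    hF.comp (PointSet.measurable_vadd.comp measurable_swap)
  have hint1 : Integrable (fun p : PointSet d × E d => η p.2 * F (p.2 +ᵥ p.1) * G p.1)
      (P.prod volume) := by
    have hneg : MeasurePreserving (Prod.map id Neg.neg : PointSet d × E d → PointSet d × E d)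
        (P.prod volume) (P.prod volume) :=
      (MeasurePreserving.id P).prod (Measure.measurePreserving_neg volume)
    have h1 := hneg.integrable_comp_of_integrable (integrable_field_prod (P := P)
      (f := fun S => F S ^ 2) (hF.pow_const 2).stronglyMeasurable hFL.integrable_sq
      (η := fun x => |η (-x)|) (hi.comp_neg.abs) (by fun_prop))
    have h2 : Integrable (fun p : PointSet d × E d => G p.1 ^ 2 * |η p.2|) (P.prod volume) :=
      hGL.integrable_sq.mul_prod hi.abs
    refine (h1.add h2).mono' ?_ (ae_of_all _ fun p => ?_)
    · exact (((hη.measurable.comp measurable_snd).mul hFm).mul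
        (hG.comp measurable_fst)).aestronglyMeasurable
    · simp only [Pi.add_apply, Function.comp, Prod.map_fst, Prod.map_snd, neg_neg, id, smul_eq_mul,
        norm_mul, Real.norm_eq_abs]
      have := two_mul_le_add_sq |F (p.2 +ᵥ p.1)| |G p.1|
      rw [sq_abs, sq_abs] at this
      nlinarith [abs_nonneg (η p.2), sq_nonneg (F (p.2 +ᵥ p.1)), sq_nonneg (G p.1),
        mul_nonneg (abs_nonneg (F (p.2 +ᵥ p.1))) (abs_nonneg (G p.1)),
        mul_le_mul_of_nonneg_left this (abs_nonneg (η p.2))]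
  have hint2 : Integrable (fun p : PointSet d × E d => F p.1 * (η p.2 * G (-p.2 +ᵥ p.1)))
      (P.prod volume) := by
    have h1 := integrable_field_prod (P := P)
      (f := fun S => G S ^ 2) (hG.pow_const 2).stronglyMeasurable hGL.integrable_sq
      (η := fun x => |η x|) hi.abs (by fun_prop)
    have h2 : Integrable (fun p : PointSet d × E d => F p.1 ^ 2 * |η p.2|) (P.prod volume) :=
      hFL.integrable_sq.mul_prod hi.abs
    refine (h1.add h2).mono' ?_ (ae_of_all _ fun p => ?_)
    · exact ((hF.comp measurable_fst).mul ((hη.measurable.comp measurable_snd).mul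
        (hG.comp measurable_neg_vadd))).aestronglyMeasurable
    · simp only [Pi.add_apply, smul_eq_mul, norm_mul, Real.norm_eq_abs]
      have := two_mul_le_add_sq |F p.1| |G (-p.2 +ᵥ p.1)|
      rw [sq_abs, sq_abs] at this
      nlinarith [abs_nonneg (η p.2), sq_nonneg (F p.1), sq_nonneg (G (-p.2 +ᵥ p.1)),
        mul_nonneg (abs_nonneg (F p.1)) (abs_nonneg (G (-p.2 +ᵥ p.1))),
        mul_le_mul_of_nonneg_left this (abs_nonneg (η p.2))]
  simp_rw [smear, ← integral_mul_const, ← integral_const_mul]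
  rw [integral_integral_swap hint1,
    integral_integral_swap (f := fun S x => F S * (η x * G (-x +ᵥ S))) hint2]
  refine integral_congr_ae (ae_of_all _ fun x => ?_)
  simp only
  rw [← (measurePreserving_vadd x P).integral_comp (MeasurableEquiv.vadd x).measurableEmbedding
    (fun S => F S * (η x * G (-x +ᵥ S)))]
  refine integral_congr_ae (ae_of_all _ fun S => ?_)
  simp only [neg_vadd_vadd]
  ring

end Stationary

end

/-! ### Integration by parts on the probability space -/

section

/-- `χ` is a square integrable random variable whose stationary extension is almost surely
continuously differentiable, with square integrable gradient `X`. -/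
structure IsCore (P : Measure (PointSet d)) (χ : PointSet d → ℝ) (X : PointSet d → E d) : Prop where
  measurable : Measurable χ
  memLp : MemLp χ 2 P
  measurable_grad : Measurable X
  memLp_grad : MemLp X 2 P
  hasFDerivAt : ∀ᵐ S ∂P, ∀ y, HasFDerivAt (field χ S) (innerSL ℝ (field X S y)) y
  continuous_grad : ∀ᵐ S ∂P, Continuous (field X S)

/-- The gradient of `smear η F`. -/
def gradSmear (η : E d → ℝ) (F : PointSet d → ℝ) (S : PointSet d) : E d :=
  WithLp.toLp 2 fun i => smear (pd i η) F S

theorem memLp_toLp {X : Type*} [MeasurableSpace X] {μ : Measure X} {f : Fin d → X → ℝ}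
    (h : ∀ i, MemLp (f i) 2 μ) : MemLp (fun x => (WithLp.toLp 2 fun i => f i x : E d)) 2 μ := by
  have h1 : (fun x => (WithLp.toLp 2 fun i => f i x : E d)) =
      fun x => ∑ i, f i x • EuclideanSpace.single i (1 : ℝ) := by
    funext x
    rw [sum_coord_smul_single (WithLp.toLp 2 fun i => f i x : E d)]
  rw [h1]
  exact memLp_finsetSum _ fun i _ =>
    ((ContinuousLinearMap.id ℝ ℝ).smulRight (EuclideanSpace.single i (1 : ℝ))).comp_memLp' (h i)

theorem memLp_coord {X : Type*} [MeasurableSpace X] {μ : Measure X} {f : X → E d}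
    (h : MemLp f 2 μ) (i : Fin d) : MemLp (fun x => f x i) 2 μ :=
  (EuclideanSpace.proj (ι := Fin d) (𝕜 := ℝ) i).comp_memLp' h

theorem integrable_mul_of_memLp {X : Type*} [MeasurableSpace X] {μ : Measure X} {f g : X → ℝ}
    (hf : MemLp f 2 μ) (hg : MemLp g 2 μ) : Integrable (fun x => f x * g x) μ :=
  hf.integrable_mul hg

theorem integrable_inner_of_memLp {X : Type*} [MeasurableSpace X] {μ : Measure X} {f g : X → E d}
    (hf : MemLp f 2 μ) (hg : MemLp g 2 μ) : Integrable (fun x => inner ℝ (f x) (g x)) μ :=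
  (integrable_mul_of_memLp hf.norm hg.norm).mono' (hf.1.inner hg.1)
    (ae_of_all _ fun _ => norm_inner_le_norm _ _)

theorem measurable_coord {X : Type*} [MeasurableSpace X] {f : X → E d} (h : Measurable f)
    (i : Fin d) : Measurable fun x => f x i :=
  (EuclideanSpace.proj (ι := Fin d) (𝕜 := ℝ) i).continuous.measurable.comp h

theorem measurable_toLp {X : Type*} [MeasurableSpace X] {f : Fin d → X → ℝ}
    (h : ∀ i, Measurable (f i)) : Measurable fun x => (WithLp.toLp 2 fun i => f i x : E d) :=
  (WithLp.measurable_toLp 2 _).comp (measurable_pi_lambda _ h)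

theorem integral_vadd_eq {G : Type*} [NormedAddCommGroup G] [NormedSpace ℝ G]
    {P : Measure (PointSet d)}
    [VAddInvariantMeasure (E d) (PointSet d) P] (z : E d) (f : PointSet d → G) : ∫ S, f (z +ᵥ S)
        ∂P = ∫ S, f S ∂P :=
  (measurePreserving_vadd z P).integral_comp (MeasurableEquiv.vadd z).measurableEmbedding f

theorem integrable_vadd {G : Type*} [NormedAddCommGroup G]
    {P : Measure (PointSet d)}
    [VAddInvariantMeasure (E d) (PointSet d) P] (z : E d) {f : PointSet d → G} (hf : Integrable f
        P) : Integrable (fun S => f (z +ᵥ S)) P :=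
  (measurePreserving_vadd z P).integrable_comp_of_integrable hf

section Stationary

variable {P : Measure (PointSet d)} [IsProbabilityMeasure P]
  [VAddInvariantMeasure (E d) (PointSet d) P]

theorem isCore_smear {η : E d → ℝ} (hη : IsTest η) {F : PointSet d → ℝ} (hF : Measurable F)
    (hL : MemLp F 2 P) : IsCore P (smear η F) (gradSmear η F) where
  measurable := measurable_smear hη.continuous.measurable hF
  memLp := memLp_smear hη.continuous hη.2 hF hL
  measurable_grad := measurable_toLp fun i => measurable_smear (hη.pd i).continuous.measurable hF
  memLp_grad := memLp_toLp fun i => memLp_smear (hη.pd i).continuous (hη.pd i).2 hF hL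
  hasFDerivAt := by
    filter_upwards [memL2Loc_field hL] with S hS y
    exact hasFDerivAt_field_smear hη hS y
  continuous_grad := by
    filter_upwards [memL2Loc_field hL] with S hS
    exact (PiLp.continuous_toLp 2 _).comp
      (continuous_pi fun i => continuous_field_smear (hη.pd i) hS)

/-- The integral of the derivative over a unit segment is the difference of `Z` at its two ends,
whose expectation vanishes by stationarity. The expectation of the integral over the segment is that
of `Y`, again by stationarity. -/
theorem integral_eq_zero_of_hasDerivAt {Z Y : PointSet d → ℝ} (hZ : Integrable Z P)
    (hY : Measurable Y) (hYi : Integrable Y P) (v : E d)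
    (hd : ∀ᵐ S ∂P, ∀ t : ℝ, HasDerivAt (fun t : ℝ => field Z S (t • v)) (field Y S (t • v)) t)
    (hc : ∀ᵐ S ∂P, Continuous fun t : ℝ => field Y S (t • v)) :
    ∫ S, Y S ∂P = 0 := by
  have hm : Measurable fun p : PointSet d × ℝ => Y (-(p.2 • v) +ᵥ p.1) :=
    hY.comp (measurable_neg_vadd.comp
      (measurable_fst.prodMk (measurable_snd.smul_const v)))
  have h1 : ∀ᵐ S ∂P, ∫ t in Ioc (0 : ℝ) 1, Y (-(t • v) +ᵥ S) = Z (-v +ᵥ S) - Z S := by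
    filter_upwards [hd, hc] with S hS hcS
    have := intervalIntegral.integral_eq_sub_of_hasDerivAt (a := 0) (b := 1)
      (fun t _ => hS t) (hcS.intervalIntegrable 0 1)
    rw [intervalIntegral.integral_of_le zero_le_one] at this
    simpa [field] using this
  have hinteg : Integrable (fun p : PointSet d × ℝ => Y (-(p.2 • v) +ᵥ p.1))
      (P.prod (volume.restrict (Ioc (0 : ℝ) 1))) := by
    refine ⟨hm.aestronglyMeasurable, ?_⟩
    rw [hasFiniteIntegral_iff_enorm, lintegral_prod_symm _ hm.enorm.aemeasurable]
    have : ∀ t : ℝ, ∫⁻ S, ‖Y (-(t • v) +ᵥ S)‖ₑ ∂P = ∫⁻ S, ‖Y S‖ₑ ∂P := fun t =>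
      lintegral_vadd (-(t • v)) fun S => ‖Y S‖ₑ
    simp_rw [this]
    simpa using (hasFiniteIntegral_iff_enorm.1 hYi.2)
  have h2 : ∫ S, (∫ t in Ioc (0 : ℝ) 1, Y (-(t • v) +ᵥ S)) ∂P = ∫ S, Y S ∂P := by
    rw [integral_integral_swap (f := fun S (t : ℝ) => Y (-(t • v) +ᵥ S)) hinteg]
    have : ∀ t : ℝ, ∫ S, Y (-(t • v) +ᵥ S) ∂P = ∫ S, Y S ∂P := fun t => integral_vadd_eq _ Y
    simp_rw [this]
    simp
  rw [← h2, integral_congr_ae h1, integral_sub (integrable_vadd _ hZ) hZ, integral_vadd_eq,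
      sub_self]

theorem IsCore.integral_inner {χ : PointSet d → ℝ} {X : PointSet d → E d} (h : IsCore P χ X)
    (v : E d) : ∫ S, inner ℝ (X S) v ∂P = 0 := by
  refine integral_eq_zero_of_hasDerivAt (h.memLp.integrable (by norm_num))
    (h.measurable_grad.inner_const) ((h.memLp_grad.integrable (by norm_num)).inner_const v) v ?_ ?_
  · filter_upwards [h.hasFDerivAt] with S hS t
    have := (hS (t • v)).comp_hasDerivAt t ((hasDerivAt_id t).smul_const v)
    simpa [field, Function.comp_def] using this
  · filter_upwards [h.continuous_grad] with S hS
    exact (hS.comp (by fun_prop : Continuous fun t : ℝ => t • v)).inner continuous_const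

/-- The product `χ ψ` has a derivative in direction `v` given by the product rule, and derivatives
have zero expectation. There is no boundary term. -/
theorem IsCore.integral_mul {χ ψ : PointSet d → ℝ} {X Y : PointSet d → E d} (h : IsCore P χ X)
    (h' : IsCore P ψ Y) (v : E d) :
    ∫ S, inner ℝ (X S) v * ψ S ∂P = -∫ S, χ S * inner ℝ (Y S) v ∂P := by
  have hXL : MemLp (fun S => inner ℝ (X S) v) 2 P := h.memLp_grad.inner_const v
  have hYL : MemLp (fun S => inner ℝ (Y S) v) 2 P := h'.memLp_grad.inner_const v
  have i1 : Integrable (fun S => inner ℝ (X S) v * ψ S) P := hXL.integrable_mul h'.memLp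
  have i2 : Integrable (fun S => χ S * inner ℝ (Y S) v) P := h.memLp.integrable_mul hYL
  have key := integral_eq_zero_of_hasDerivAt (P := P) (Z := fun S => χ S * ψ S)
    (Y := fun S => inner ℝ (X S) v * ψ S + χ S * inner ℝ (Y S) v)
    (h.memLp.integrable_mul h'.memLp)
    ((h.measurable_grad.inner_const.mul h'.measurable).add
      (h.measurable.mul h'.measurable_grad.inner_const)) (i1.add i2) v ?_ ?_
  · rw [integral_add i1 i2] at key
    linarith
  · filter_upwards [h.hasFDerivAt, h'.hasFDerivAt] with S hS hS' t
    have e1 := (hS (t • v)).comp_hasDerivAt t ((hasDerivAt_id t).smul_const v)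
    have e2 := (hS' (t • v)).comp_hasDerivAt t ((hasDerivAt_id t).smul_const v)
    simpa [field, Function.comp_def] using e1.fun_mul e2
  · filter_upwards [h.hasFDerivAt, h'.hasFDerivAt, h.continuous_grad, h'.continuous_grad]
      with S hS hS' hc hc'
    have cχ : Continuous (field χ S) := continuous_iff_continuousAt.2 fun y => (hS y).continuousAt
    have cψ : Continuous (field ψ S) := continuous_iff_continuousAt.2 fun y => (hS' y).continuousAt
    have ct : Continuous fun t : ℝ => t • v := by fun_prop
    exact (((hc.comp ct).inner continuous_const).mul (cψ.comp ct)).add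
      ((cχ.comp ct).mul ((hc'.comp ct).inner continuous_const))

end Stationary

end

/-! ### The Liouville theorem for stationary curl-free and divergence-free fields -/

section

/-- The stationary field generated by `X` is almost surely curl-free. -/
def CurlFree (P : Measure (PointSet d)) (X : PointSet d → E d) : Prop :=
  ∀ η : E d → ℝ, IsTest η → ∀ i j : Fin d, ∀ᵐ S ∂P,
    ∫ x, pd i η x * field X S x j = ∫ x, pd j η x * field X S x i

/-- The stationary field generated by `X` is almost surely divergence-free. -/
def DivFree (P : Measure (PointSet d)) (X : PointSet d → E d) : Prop :=
  ∀ η : E d → ℝ, IsTest η → ∀ᵐ S ∂P, ∑ i, ∫ x, pd i η x * field X S x i = 0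

theorem IsTest.integrable_mul {η : E d → ℝ} (hη : IsTest η) {u : E d → ℝ}
    (hu : LocallyIntegrable u) : Integrable fun x => η x * u x := by
  have := hu.integrable_smul_left_of_hasCompactSupport hη.continuous hη.2
  simpa using this

theorem MemL2Loc.coord {u : E d → E d} (h : MemL2Loc u) (i : Fin d) :
    MemL2Loc fun x => u x i := fun R => memLp_coord (h R) i

/-- A mollifying sequence. -/
def mollifier (d : ℕ) (n : ℕ) : ContDiffBump (0 : E d) where
  rIn := 1 / (n + 1)
  rOut := 2 / (n + 1)
  rIn_pos := by positivity
  rIn_lt_rOut := by gcongr; norm_num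

theorem isTest_mollifier (n : ℕ) : IsTest ((mollifier d n).normed volume) :=
  ⟨(mollifier d n).contDiff_normed, (mollifier d n).hasCompactSupport_normed⟩

theorem tendsto_mollifier_rOut : Tendsto (fun n => (mollifier d n).rOut) atTop (𝓝 0) := by
  have := (tendsto_one_div_add_atTop_nhds_zero_nat (𝕜 := ℝ)).const_mul 2
  simpa [mollifier, div_eq_mul_inv] using this

theorem ae_tendsto_convolution_mollifier {u : E d → ℝ} (hu : LocallyIntegrable u) :
    ∀ᵐ x, Tendsto (fun n => (u ⋆[ContinuousLinearMap.mul ℝ ℝ] (mollifier d n).normed volume) x)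
      atTop (𝓝 (u x)) := by
  have h := ContDiffBump.ae_convolution_tendsto_right_of_locallyIntegrable (μ := volume)
    (K := 2) (tendsto_mollifier_rOut (d := d)) (Eventually.of_forall fun n => ?_) hu
  · filter_upwards [h] with x hx
    refine hx.congr fun n => ?_
    rw [convolution_eq_swap, convolution_def]
    refine integral_congr_ae (ae_of_all _ fun t => ?_)
    simp [mul_comm]
  · simp only [mollifier]
    apply le_of_eq
    ring

section Stationary

variable {P : Measure (PointSet d)}

theorem integrable_test_mul_field [IsProbabilityMeasure P] [VAddInvariantMeasure (E d) (PointSet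
    d) P]
    {X : PointSet d → E d} (hX : MemLp X 2 P) :
    ∀ᵐ S ∂P, ∀ η : E d → ℝ, IsTest η → ∀ i, Integrable fun x => η x * field X S x i := by
  filter_upwards [memL2Loc_field hX] with S hS η hη i
  exact hη.integrable_mul (hS.coord i).locallyIntegrable

theorem CurlFree.smear_comm {X : PointSet d → E d} (h : CurlFree P X) {η : E d → ℝ}
    (hη : IsTest η) (i j : Fin d) :
    ∀ᵐ S ∂P, smear (pd i η) (fun S => X S j) S = smear (pd j η) (fun S => X S i) S := by
  filter_upwards [h _ hη.comp_neg i j] with S hS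
  rw [pd_comp_neg hη.differentiable, pd_comp_neg hη.differentiable] at hS
  simp only [neg_mul, integral_neg, neg_inj] at hS
  simpa [smear_eq, field] using hS

theorem DivFree.sum_smear {X : PointSet d → E d} (h : DivFree P X) {η : E d → ℝ}
    (hη : IsTest η) : ∀ᵐ S ∂P, ∑ i, smear (pd i η) (fun S => X S i) S = 0 := by
  filter_upwards [h _ hη.comp_neg] with S hS
  simp only [pd_comp_neg hη.differentiable, neg_mul, integral_neg, Finset.sum_neg_distrib,
    neg_eq_zero] at hS
  simpa [smear_eq, field] using hS

variable [IsProbabilityMeasure P]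

/-- The field is harmonic, and its Dirichlet energy per unit volume vanishes. One factor of the
squared derivative is rewritten with the curl condition and integrated by parts; after summation
over `k`, the divergence of the field appears and is zero. -/
theorem smear_pd_eq_zero [VAddInvariantMeasure (E d) (PointSet d) P] {X : PointSet d → E d}
    (hX : Measurable X) (hL : MemLp X 2 P)
    (hc : CurlFree P X) (hd : DivFree P X) {η : E d → ℝ} (hη : IsTest η) (i k : Fin d) :
    ∀ᵐ S ∂P, smear (pd k η) (fun S => X S i) S = 0 := by
  have hXm : ∀ j, Measurable fun S => X S j := measurable_coord hX
  have hXL : ∀ j, MemLp (fun S => X S j) 2 P := memLp_coord hL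
  have hsL : ∀ (ζ : E d → ℝ), IsTest ζ → ∀ j, MemLp (smear ζ fun S => X S j) 2 P := fun ζ hζ j =>
    memLp_smear hζ.continuous hζ.2 (hXm j) (hXL j)
  have h1 : ∀ k, ∫ S, (smear (pd k η) (fun S => X S i) S) ^ 2 ∂P =
      -∫ S, smear η (fun S => X S i) S * smear (pd k (pd i η)) (fun S => X S k) S ∂P := by
    intro k
    have hi := (isCore_smear (P := P) hη (hXm i) (hXL i)).integral_mul
      (isCore_smear (P := P) (hη.pd i) (hXm k) (hXL k)) (EuclideanSpace.single k 1)
    simp only [gradSmear, EuclideanSpace.inner_single_right, one_mul, conj_trivial] at hi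
    rw [← hi]
    refine integral_congr_ae ?_
    filter_upwards [hc.smear_comm hη k i] with S hS
    rw [← hS, sq]
  have h2 : ∑ k, ∫ S, (smear (pd k η) (fun S => X S i) S) ^ 2 ∂P = 0 := by
    simp_rw [h1]
    rw [Finset.sum_neg_distrib, ← integral_finsetSum, neg_eq_zero]
    · rw [integral_congr_ae (g := 0)]
      · simp
      · filter_upwards [hd.sum_smear (hη.pd i)] with S hS
        rw [← Finset.mul_sum, hS, mul_zero, Pi.zero_apply]
    · intro k _
      exact (hsL η hη i).integrable_mul (hsL _ ((hη.pd i).pd k) k)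
  have h3 := (Finset.sum_eq_zero_iff_of_nonneg fun k _ =>
    integral_nonneg fun S => sq_nonneg _).1 h2 k (Finset.mem_univ k)
  rw [integral_eq_zero_iff_of_nonneg (fun S => sq_nonneg _)
    (hsL _ (hη.pd k) i).integrable_sq] at h3
  filter_upwards [h3] with S hS
  simpa using hS

/-- The event that the realization is positive almost everywhere is translation invariant, so it has
probability zero or one. Hence `F` has a fixed sign almost surely, and its mean vanishes. -/
theorem ae_eq_zero_of_field_const [ErgodicVAdd (E d) (PointSet d) P] {F : PointSet d → ℝ}
    (hF : Measurable F) (hi : Integrable F P) (h0 : ∫ S, F S ∂P = 0)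
    (hc : ∀ᵐ S ∂P, ∃ c : ℝ, ∀ᵐ y, field F S y = c) : ∀ᵐ S ∂P, F S = 0 := by
  set s : Set (PointSet d) := {S | volume {y : E d | ¬ 0 < field F S y} = 0} with hs
  have hm : Measurable fun p : PointSet d × E d => field F p.1 p.2 := hF.comp measurable_neg_vadd
  have hsm : MeasurableSet s :=
    (measurable_measure_prodMk_left (ν := (volume : Measure (E d)))
      (s := {p : PointSet d × E d | ¬ 0 < field F p.1 p.2})
      (measurableSet_lt measurable_const hm).compl) (measurableSet_singleton 0)
  have hinv : ∀ z : E d, (z +ᵥ ·) ⁻¹' s = s := by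
    intro z
    ext S
    simp only [hs, mem_preimage, mem_ofPred_eq]
    have : {y : E d | ¬ 0 < field F (z +ᵥ S) y} =
        (fun y => y + -z) ⁻¹' {y : E d | ¬ 0 < field F S y} := by
      ext y
      have := field_neg_vadd F S y (-z)
      rw [neg_neg] at this
      simp [this]
    rw [this, measure_preimage_add_right]
  have hconst : EventuallyConst s (ae P) :=
    aeconst_of_forall_preimage_vadd_ae_eq (E d) hsm.nullMeasurableSet fun z => by
      rw [hinv z]
      exact EventuallyEq.rfl
  rcases eventuallyConst_set.1 hconst with h | h
  · have hpos : ∀ᵐ S ∂P, 0 < F S :=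
      ae_of_ae_field (measurableSet_lt measurable_const hF) (by
        filter_upwards [h] with S hS
        exact ae_iff.2 hS)
    have := (integral_eq_zero_iff_of_nonneg_ae (hpos.mono fun S hS => hS.le) hi).1 h0
    exact this
  · have hneg : ∀ᵐ S ∂P, F S ≤ 0 :=
      ae_of_ae_field (measurableSet_le hF measurable_const) (by
        filter_upwards [h, hc] with S hS ⟨c, hcS⟩
        have hc0 : c ≤ 0 := by
          by_contra hpos
          refine hS ((ae_iff (p := fun y => 0 < field F S y)).1 ?_)
          filter_upwards [hcS] with y hy
          rw [hy]; exact not_le.1 hpos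
        filter_upwards [hcS] with y hy
        exact hy.le.trans hc0)
    have := (integral_eq_zero_iff_of_nonneg_ae (f := fun S => -F S)
      (hneg.mono fun S hS => by simpa using hS) hi.neg).1 (by rw [integral_neg, h0, neg_zero])
    filter_upwards [this] with S hS
    simpa using hS

/-- Every mollification of a realization has zero gradient and is constant. Letting the mollifier
shrink at Lebesgue points, the realization itself is constant almost everywhere, and ergodicity with
zero mean makes it vanish. -/
theorem ae_eq_zero_of_curlFree_of_divFree [ErgodicVAdd (E d) (PointSet d) P]
    {X : PointSet d → E d} (hX : Measurable X) (hL : MemLp X 2 P)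
    (hc : CurlFree P X) (hd : DivFree P X) (h0 : ∫ S, X S ∂P = 0) : ∀ᵐ S ∂P, X S = 0 := by
  have key : ∀ i, ∀ᵐ S ∂P, X S i = 0 := by
    intro i
    refine ae_eq_zero_of_field_const (measurable_coord hX i)
      ((memLp_coord hL i).integrable (by norm_num)) ?_ ?_
    · have := (EuclideanSpace.proj (ι := Fin d) (𝕜 := ℝ) i).integral_comp_comm
        (hL.integrable (by norm_num))
      simpa [h0] using this
    have h1 : ∀ᵐ S ∂P, ∀ (n : ℕ) (k : Fin d), ∀ᵐ y : E d,
        smear (pd k ((mollifier d n).normed volume)) (fun S => X S i) (-y +ᵥ S) = 0 :=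
      ae_all_iff.2 fun n => ae_all_iff.2 fun k => ae_field
        (smear_pd_eq_zero hX hL hc hd (isTest_mollifier n) i k)
    filter_upwards [h1, memL2Loc_field hL] with S hS hloc
    have hloc' : MemL2Loc (field (fun S => X S i) S) := hloc.coord i
    have h2 : ∀ n : ℕ, ∀ y, field (smear ((mollifier d n).normed volume) fun S => X S i) S y =
        field (smear ((mollifier d n).normed volume) fun S => X S i) S 0 := by
      intro n y
      have hz : ∀ k, field (smear (pd k ((mollifier d n).normed volume)) fun S => X S i) S = 0 := by
        intro k
        refine (Continuous.ae_eq_iff_eq volume (continuous_field_smear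
          ((isTest_mollifier n).pd k) hloc') continuous_const).1 ?_
        exact hS n k
      have hdz : ∀ y, HasFDerivAt (field (smear ((mollifier d n).normed volume)
          fun S => X S i) S) (0 : E d →L[ℝ] ℝ) y := by
        intro y
        refine (hasFDerivAt_field_smear (isTest_mollifier n) hloc' y).congr_fderiv ?_
        have : (WithLp.toLp 2 fun k => field (smear (pd k ((mollifier d n).normed volume))
            fun S => X S i) S y : E d) = 0 := by
          ext k; simp [hz k]
        rw [this, map_zero]
      exact is_const_of_fderiv_eq_zero (fun y => (hdz y).differentiableAt)
        (fun y => (hdz y).fderiv) y 0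
    have h3 := ae_tendsto_convolution_mollifier hloc'.locallyIntegrable
    simp_rw [← field_smear, h2] at h3
    obtain ⟨y₀, hy₀⟩ := h3.exists
    refine ⟨field (fun S => X S i) S y₀, ?_⟩
    filter_upwards [h3] with y hy
    exact tendsto_nhds_unique hy hy₀
  filter_upwards [ae_all_iff.2 key] with S hS
  ext i
  simpa using hS i

end Stationary

end

/-! ### The Weyl decomposition and the div-curl identity -/

section

section Stationary

variable {P : Measure (PointSet d)}

theorem IsCore.zero : IsCore P 0 0 where
  measurable := measurable_zero
  memLp := MemLp.zero
  measurable_grad := measurable_zero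
  memLp_grad := MemLp.zero
  hasFDerivAt := ae_of_all _ fun S y => by
    have : field (0 : PointSet d → ℝ) S = fun _ => 0 := rfl
    rw [this, show field (0 : PointSet d → E d) S y = 0 from rfl, map_zero]
    exact hasFDerivAt_const _ _
  continuous_grad := ae_of_all _ fun S => continuous_const

theorem IsCore.add {χ ψ : PointSet d → ℝ} {X Y : PointSet d → E d} (h : IsCore P χ X)
    (h' : IsCore P ψ Y) : IsCore P (χ + ψ) (X + Y) where
  measurable := h.measurable.add h'.measurable
  memLp := h.memLp.add h'.memLp
  measurable_grad := h.measurable_grad.add h'.measurable_grad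
  memLp_grad := h.memLp_grad.add h'.memLp_grad
  hasFDerivAt := by
    filter_upwards [h.hasFDerivAt, h'.hasFDerivAt] with S hS hS' y
    have := (hS y).add (hS' y)
    rw [← map_add] at this
    exact this
  continuous_grad := by
    filter_upwards [h.continuous_grad, h'.continuous_grad] with S hS hS'
    exact hS.add hS'

theorem IsCore.smul {χ : PointSet d → ℝ} {X : PointSet d → E d} (h : IsCore P χ X) (c : ℝ) :
    IsCore P (c • χ) (c • X) where
  measurable := h.measurable.const_smul c
  memLp := h.memLp.const_smul c
  measurable_grad := h.measurable_grad.const_smul c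
  memLp_grad := h.memLp_grad.const_smul c
  hasFDerivAt := by
    filter_upwards [h.hasFDerivAt] with S hS y
    have := (hS y).const_smul c
    rw [← map_smul] at this
    exact this
  continuous_grad := by
    filter_upwards [h.continuous_grad] with S hS
    exact hS.const_smul c

variable (P) in
/-- The span of the gradients of smeared random variables. -/
def smoothPotentials : Submodule ℝ (Lp (E d) 2 P) :=
  Submodule.span ℝ {f | ∃ (η : E d → ℝ) (F : PointSet d → ℝ), IsTest η ∧ Measurable F ∧
    MemLp F 2 P ∧ f =ᵐ[P] gradSmear η F}

variable (P) in
/-- The closed space of square integrable stationary gradient fields. -/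
def potentials : Submodule ℝ (Lp (E d) 2 P) := (smoothPotentials P).topologicalClosure

instance : CompleteSpace (potentials P) :=
  (Submodule.isClosed_topologicalClosure _).completeSpace_coe

theorem mem_orthogonal_potentials {g : Lp (E d) 2 P}
    (h : ∀ (η : E d → ℝ) (F : PointSet d → ℝ), IsTest η → Measurable F → MemLp F 2 P →
      ∫ S, inner ℝ (gradSmear η F S) (g S) ∂P = 0) : g ∈ (potentials P)ᗮ := by
  rw [potentials, Submodule.orthogonal_closure, smoothPotentials]
  rw [Submodule.mem_orthogonal]
  intro f hf
  induction hf using Submodule.span_induction with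
  | mem f hf =>
    obtain ⟨η, F, hη, hF, hL, hfF⟩ := hf
    rw [L2.inner_def, ← h η F hη hF hL]
    refine integral_congr_ae ?_
    filter_upwards [hfF] with S hS
    rw [hS]
  | zero => simp
  | add f f' _ _ hf hf' => rw [inner_add_left, hf, hf', add_zero]
  | smul c f _ hf => rw [inner_smul_left, hf, mul_zero]

theorem curlFree_const (e : E d) : CurlFree P fun _ => e := by
  intro η hη i j
  refine ae_of_all _ fun S => ?_
  simp [field, integral_mul_const, integral_pd hη]

theorem ae_eq_zero_of_forall_integral_mul {G : PointSet d → ℝ} (hG : Measurable G)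
    (hL : MemLp G 2 P)
    (h : ∀ F : PointSet d → ℝ, Measurable F → MemLp F 2 P → ∫ S, F S * G S ∂P = 0) :
    ∀ᵐ S ∂P, G S = 0 := by
  have h1 := h G hG hL
  simp_rw [← sq] at h1
  have := (integral_eq_zero_iff_of_nonneg (fun S => sq_nonneg (G S)) hL.integrable_sq).1 h1
  filter_upwards [this] with S hS
  simpa using hS

theorem measurable_test_integral {η : E d → ℝ} (hη : Measurable η) {F : PointSet d → ℝ}
    (hF : Measurable F) : Measurable fun S => ∫ x, η x * F (-x +ᵥ S) := by
  simp_rw [← smear_comp_neg]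
  exact measurable_smear (hη.comp measurable_neg) hF

variable [IsProbabilityMeasure P] [VAddInvariantMeasure (E d) (PointSet d) P]

theorem exists_isCore_of_mem_smoothPotentials {f : Lp (E d) 2 P} (hf : f ∈ smoothPotentials P) :
    ∃ χ X, IsCore P χ X ∧ f =ᵐ[P] X := by
  induction hf using Submodule.span_induction with
  | mem f hf =>
    obtain ⟨η, F, hη, hF, hL, hfF⟩ := hf
    exact ⟨_, _, isCore_smear hη hF hL, hfF⟩
  | zero => exact ⟨0, 0, IsCore.zero, Lp.coeFn_zero _ _ _⟩
  | add f g _ _ hf hg =>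
    obtain ⟨χ, X, h, hX⟩ := hf
    obtain ⟨ψ, Y, h', hY⟩ := hg
    exact ⟨_, _, h.add h', (Lp.coeFn_add f g).trans (hX.add hY)⟩
  | smul c f _ hf =>
    obtain ⟨χ, X, h, hX⟩ := hf
    exact ⟨_, _, h.smul c, (Lp.coeFn_smul c f).trans (hX.const_smul c)⟩

theorem inner_gradSmear_eq_zero {g : Lp (E d) 2 P} (hg : g ∈ (potentials P)ᗮ) {η : E d → ℝ}
    {F : PointSet d → ℝ} (hη : IsTest η) (hF : Measurable F) (hL : MemLp F 2 P) :
    ∫ S, inner ℝ (gradSmear η F S) (g S) ∂P = 0 := by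
  have hc := isCore_smear (P := P) hη hF hL
  have hmem : hc.memLp_grad.toLp _ ∈ potentials P :=
    Submodule.le_topologicalClosure _ (Submodule.subset_span ⟨η, F, hη, hF, hL,
      hc.memLp_grad.coeFn_toLp⟩)
  have := (Submodule.mem_orthogonal _ _).1 hg _ hmem
  rw [L2.inner_def] at this
  rw [← this]
  refine integral_congr_ae ?_
  filter_upwards [hc.memLp_grad.coeFn_toLp] with S hS
  rw [hS]

theorem CurlFree.congr {X Y : PointSet d → E d} (h : CurlFree P X) (hXY : X =ᵐ[P] Y) :
    CurlFree P Y := by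
  intro η hη i j
  filter_upwards [h η hη i j, ae_field hXY] with S hS hf
  have : ∀ i j, ∫ x, pd i η x * field Y S x j = ∫ x, pd i η x * field X S x j := by
    intro i j
    refine integral_congr_ae ?_
    filter_upwards [hf] with x hx
    simp only [field, hx]
  rw [this, this, hS]

theorem DivFree.congr {X Y : PointSet d → E d} (h : DivFree P X) (hXY : X =ᵐ[P] Y) :
    DivFree P Y := by
  intro η hη
  filter_upwards [h η hη, ae_field hXY] with S hS hf
  have : ∀ i, ∫ x, pd i η x * field Y S x i = ∫ x, pd i η x * field X S x i := by
    intro i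
    refine integral_congr_ae ?_
    filter_upwards [hf] with x hx
    simp only [field, hx]
  simp_rw [this, hS]

theorem CurlFree.sub {X Y : PointSet d → E d} (h : CurlFree P X) (h' : CurlFree P Y)
    (hX : MemLp X 2 P) (hY : MemLp Y 2 P) : CurlFree P (X - Y) := by
  intro η hη i j
  filter_upwards [h η hη i j, h' η hη i j, integrable_test_mul_field hX,
    integrable_test_mul_field hY] with S h1 h2 h3 h4
  have : ∀ i j, ∫ x, pd i η x * field (X - Y) S x j =
      (∫ x, pd i η x * field X S x j) - ∫ x, pd i η x * field Y S x j := by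
    intro i j
    rw [← integral_sub (h3 _ (hη.pd i) j) (h4 _ (hη.pd i) j)]
    refine integral_congr_ae (ae_of_all _ fun x => ?_)
    simp [field, mul_sub]
  rw [this, this, h1, h2]

theorem DivFree.sub {X Y : PointSet d → E d} (h : DivFree P X) (h' : DivFree P Y)
    (hX : MemLp X 2 P) (hY : MemLp Y 2 P) : DivFree P (X - Y) := by
  intro η hη
  filter_upwards [h η hη, h' η hη, integrable_test_mul_field hX,
    integrable_test_mul_field hY] with S h1 h2 h3 h4
  have : ∀ i, ∫ x, pd i η x * field (X - Y) S x i =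
      (∫ x, pd i η x * field X S x i) - ∫ x, pd i η x * field Y S x i := by
    intro i
    rw [← integral_sub (h3 _ (hη.pd i) i) (h4 _ (hη.pd i) i)]
    refine integral_congr_ae (ae_of_all _ fun x => ?_)
    simp [field, mul_sub]
  simp_rw [this, Finset.sum_sub_distrib, h1, h2, sub_zero]

theorem memLp_test_integral {η : E d → ℝ} (hη : IsTest η) {F : PointSet d → ℝ}
    (hF : Measurable F) (hL : MemLp F 2 P) : MemLp (fun S => ∫ x, η x * F (-x +ᵥ S)) 2 P := by
  simp_rw [← smear_comp_neg]
  exact memLp_smear hη.comp_neg.continuous hη.comp_neg.2 hF hL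

/-- Identifies the orthogonal complement of `potentials` with the divergence-free fields: since `F`
is arbitrary, orthogonality to all `gradSmear η F` is the vanishing of the divergence tested against
`η`. -/
theorem integral_inner_gradSmear {η : E d → ℝ} (hη : IsTest η) {F : PointSet d → ℝ}
    (hF : Measurable F) (hL : MemLp F 2 P) {X : PointSet d → E d} (hX : Measurable X)
    (hXL : MemLp X 2 P) :
    ∫ S, inner ℝ (gradSmear η F S) (X S) ∂P =
      ∫ S, F S * (∑ i, ∫ x, pd i η x * field X S x i) ∂P := by
  have h1 : ∀ i, ∫ S, smear (pd i η) F S * X S i ∂P =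
      ∫ S, F S * (∫ x, pd i η x * field X S x i) ∂P := fun i =>
    integral_smear_mul (hη.pd i).continuous (hη.pd i).2 hF hL (measurable_coord hX i)
      (memLp_coord hXL i)
  simp_rw [Finset.mul_sum]
  rw [integral_finsetSum]
  · simp_rw [← h1]
    rw [← integral_finsetSum]
    · refine integral_congr_ae (ae_of_all _ fun S => ?_)
      simp only [gradSmear, PiLp.inner_apply, RCLike.inner_apply, conj_trivial]
      exact Finset.sum_congr rfl fun i _ => mul_comm _ _
    · intro i _
      exact (memLp_smear (hη.pd i).continuous (hη.pd i).2 hF hL).integrable_mul (memLp_coord hXL i)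
  · intro i _
    exact hL.integrable_mul (memLp_test_integral (hη.pd i) (measurable_coord hX i)
      (memLp_coord hXL i))

theorem divFree_of_mem_orthogonal {g : Lp (E d) 2 P} (hg : g ∈ (potentials P)ᗮ)
    {X : PointSet d → E d} (hX : Measurable X) (hgX : g =ᵐ[P] X) : DivFree P X := by
  have hXL : MemLp X 2 P := (Lp.memLp g).ae_eq hgX
  intro η hη
  refine ae_eq_zero_of_forall_integral_mul ?_ ?_ fun F hF hL => ?_
  · exact Finset.measurable_fun_sum _ fun i _ =>
      measurable_test_integral (hη.pd i).continuous.measurable (measurable_coord hX i)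
  · exact memLp_finsetSum _ fun i _ =>
      memLp_test_integral (hη.pd i) (measurable_coord hX i) (memLp_coord hXL i)
  · rw [← integral_inner_gradSmear hη hF hL hX hXL, ← inner_gradSmear_eq_zero hg hη hF hL]
    refine integral_congr_ae ?_
    filter_upwards [hgX] with S hS
    rw [hS]

theorem DivFree.toLp_mem_orthogonal {X : PointSet d → E d} (hL : MemLp X 2 P)
    (h : DivFree P X) : hL.toLp X ∈ (potentials P)ᗮ := by
  refine mem_orthogonal_potentials fun η F hη hF hFL => ?_
  set g := hL.toLp X
  have hgm : Measurable g := (Lp.stronglyMeasurable g).measurable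
  rw [integral_inner_gradSmear hη hF hFL hgm (Lp.memLp g)]
  rw [integral_congr_ae (g := 0)]
  · simp
  · filter_upwards [h.congr hL.coeFn_toLp.symm η hη] with S hS
    rw [hS, mul_zero, Pi.zero_apply]

theorem integral_inner_curl_eq_zero {η η' : E d → ℝ} (hη : IsTest η) (hη' : IsTest η')
    {F F' : PointSet d → ℝ} (hF : Measurable F) (hL : MemLp F 2 P) (hF' : Measurable F')
    (hL' : MemLp F' 2 P) (i j : Fin d) :
    ∫ S, smear (pd j η') F' S * smear (pd i η) F S ∂P =
      ∫ S, smear (pd i η') F' S * smear (pd j η) F S ∂P := by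
  have h : ∀ i j, ∫ S, smear (pd j η') F' S * smear (pd i η) F S ∂P =
      -∫ S, smear η' F' S * smear (pd j (pd i η)) F S ∂P := by
    intro i j
    have hi := (isCore_smear (P := P) hη' hF' hL').integral_mul
      (isCore_smear (P := P) (hη.pd i) hF hL) (EuclideanSpace.single j 1)
    simpa only [gradSmear, EuclideanSpace.inner_single_right, one_mul, conj_trivial] using hi
  rw [h, h, pd_comm hη]

/-- Argued by duality, so that the closure needs no separate limit. The rotated gradient `U` is
orthogonal to every smeared gradient because derivatives commute under the expectation, hence to all
of `potentials`; pairing `f` with `U` is testing the curl of `f` against `η` with weight `F`. -/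
theorem curlFree_of_mem_potentials {f : Lp (E d) 2 P} (hf : f ∈ potentials P) : CurlFree P f := by
  have hX : Measurable f := (Lp.stronglyMeasurable f).measurable
  have hXL : MemLp f 2 P := Lp.memLp f
  intro η hη i j
  have hmI : ∀ i j, MemLp (fun S => ∫ x, pd i η x * field f S x j) 2 P := fun i j =>
    memLp_test_integral (hη.pd i) (measurable_coord hX j) (memLp_coord hXL j)
  have hmm : ∀ i j, Measurable (fun S => ∫ x, pd i η x * field f S x j) := fun i j =>
    measurable_test_integral (hη.pd i).continuous.measurable (measurable_coord hX j)
  have key := ae_eq_zero_of_forall_integral_mul (P := P)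
    (G := fun S => (∫ x, pd i η x * field f S x j) - ∫ x, pd j η x * field f S x i)
    ((hmm i j).sub (hmm j i)) ((hmI i j).sub (hmI j i)) ?_
  · filter_upwards [key] with S hS
    exact sub_eq_zero.1 hS
  intro F hF hL
  have hsm : ∀ i, MemLp (smear (pd i η) F) 2 P := fun i =>
    memLp_smear (hη.pd i).continuous (hη.pd i).2 hF hL
  set U : PointSet d → E d := fun S => smear (pd i η) F S • EuclideanSpace.single j (1 : ℝ) -
    smear (pd j η) F S • EuclideanSpace.single i (1 : ℝ) with hU
  have hUL : MemLp U 2 P :=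
    (((ContinuousLinearMap.id ℝ ℝ).smulRight (EuclideanSpace.single j (1 : ℝ))).comp_memLp'
      (hsm i)).sub
    (((ContinuousLinearMap.id ℝ ℝ).smulRight (EuclideanSpace.single i (1 : ℝ))).comp_memLp' (hsm j))
  have hinner : ∀ (S : PointSet d) (v : E d), inner ℝ v (U S) =
      v j * smear (pd i η) F S - v i * smear (pd j η) F S := by
    intro S v
    simp only [hU, inner_sub_right, inner_smul_right, EuclideanSpace.inner_single_right, one_mul,
      conj_trivial]
    ring
  have hUo : hUL.toLp U ∈ (potentials P)ᗮ := by
    refine mem_orthogonal_potentials fun η' F' hη' hF' hL' => ?_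
    have hsm' : ∀ i, MemLp (smear (pd i η') F') 2 P := fun i =>
      memLp_smear (hη'.pd i).continuous (hη'.pd i).2 hF' hL'
    rw [integral_congr_ae (g := fun S => smear (pd j η') F' S * smear (pd i η) F S -
      smear (pd i η') F' S * smear (pd j η) F S)]
    · rw [integral_sub (integrable_mul_of_memLp (hsm' j) (hsm i))
        (integrable_mul_of_memLp (hsm' i) (hsm j)),
        integral_inner_curl_eq_zero hη hη' hF hL hF' hL', sub_self]
    · filter_upwards [hUL.coeFn_toLp] with S hS
      rw [hS, hinner]
      rfl
  have h0 := (Submodule.mem_orthogonal _ _).1 hUo f hf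
  rw [L2.inner_def, integral_congr_ae (g := fun S => smear (pd i η) F S * f S j -
      smear (pd j η) F S * f S i)] at h0
  · rw [integral_sub (integrable_mul_of_memLp (hsm i) (memLp_coord hXL j))
      (integrable_mul_of_memLp (hsm j) (memLp_coord hXL i)),
      integral_smear_mul (hη.pd i).continuous (hη.pd i).2 hF hL (measurable_coord hX j)
        (memLp_coord hXL j),
      integral_smear_mul (hη.pd j).continuous (hη.pd j).2 hF hL (measurable_coord hX i)
        (memLp_coord hXL i), ← integral_sub] at h0
    · rw [← h0]
      refine integral_congr_ae (ae_of_all _ fun S => ?_)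
      simp only [mul_sub, field]
    · exact hL.integrable_mul (hmI i j)
    · exact hL.integrable_mul (hmI j i)
  · filter_upwards [hUL.coeFn_toLp] with S hS
    rw [hS, hinner]
    ring

theorem integral_eq_zero_of_mem_potentials {f : Lp (E d) 2 P} (hf : f ∈ potentials P) :
    ∫ S, f S ∂P = 0 := by
  have hi : Integrable f P := (Lp.memLp f).integrable (by norm_num)
  refine ext_inner_left ℝ fun e => ?_
  rw [← integral_inner hi, inner_zero_right]
  have hc : MemLp (fun _ : PointSet d => e) 2 P := memLp_const e
  have ho : hc.toLp _ ∈ (potentials P)ᗮ := by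
    refine mem_orthogonal_potentials fun η F hη hF hL => ?_
    rw [← (isCore_smear (P := P) hη hF hL).integral_inner e]
    refine integral_congr_ae ?_
    filter_upwards [hc.coeFn_toLp] with S hS
    rw [hS]
  have h0 := (Submodule.mem_orthogonal _ _).1 ho f hf
  rw [L2.inner_def] at h0
  rw [← h0]
  refine integral_congr_ae ?_
  filter_upwards [hc.coeFn_toLp] with S hS
  rw [hS, real_inner_comm]

end Stationary

section Ergodic

variable {P : Measure (PointSet d)} [IsProbabilityMeasure P] [ErgodicVAdd (E d) (PointSet d) P]

/-- The component orthogonal to `potentials` is divergence-free, and it inherits zero curl and zero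
mean from the other two fields. The Liouville theorem kills it; this is where ergodicity is used. -/
theorem CurlFree.toLp_mem_potentials {X : PointSet d → E d} (hL : MemLp X 2 P)
    (h : CurlFree P X) (h0 : ∫ S, X S ∂P = 0) : hL.toLp X ∈ potentials P := by
  obtain ⟨v, hv, θ, hθ, hsum⟩ := (potentials P).exists_add_mem_mem_orthogonal (hL.toLp X)
  have hae : ⇑θ =ᵐ[P] X - v := by
    have h1 : θ = hL.toLp X - v := by rw [hsum]; abel
    rw [h1]
    filter_upwards [Lp.coeFn_sub (hL.toLp X) v, hL.coeFn_toLp] with S h2 h3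
    rw [h2, Pi.sub_apply, h3, Pi.sub_apply]
  have hθm : Measurable θ := (Lp.stronglyMeasurable θ).measurable
  have hcurl : CurlFree P θ :=
    (h.sub (curlFree_of_mem_potentials hv) hL (Lp.memLp v)).congr hae.symm
  have hdiv : DivFree P θ := divFree_of_mem_orthogonal hθ hθm (EventuallyEq.refl _ _)
  have hmean : ∫ S, θ S ∂P = 0 := by
    rw [integral_congr_ae hae]
    simp only [Pi.sub_apply]
    rw [integral_sub (hL.integrable (by norm_num)) ((Lp.memLp v).integrable (by norm_num)), h0,
      integral_eq_zero_of_mem_potentials hv, sub_zero]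
  have hθ0 := ae_eq_zero_of_curlFree_of_divFree hθm (Lp.memLp θ) hcurl hdiv hmean
  have : θ = 0 := (Lp.eq_zero_iff_ae_eq_zero).2 hθ0
  rw [hsum, this, add_zero]
  exact hv

/-- The stationary div-curl identity. -/
theorem integral_inner_of_curlFree_of_divFree {X Y : PointSet d → E d} (hX : MemLp X 2 P)
    (hc : CurlFree P X) (hY : MemLp Y 2 P) (hd : DivFree P Y) :
    ∫ S, inner ℝ (X S) (Y S) ∂P = inner ℝ (∫ S, X S ∂P) (∫ S, Y S ∂P) := by
  set e := ∫ S, X S ∂P with he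
  have hXi : Integrable X P := hX.integrable (by norm_num)
  have hYi : Integrable Y P := hY.integrable (by norm_num)
  have hcL : MemLp (fun _ : PointSet d => e) 2 P := memLp_const e
  have hX0 : MemLp (X - fun _ => e) 2 P := hX.sub hcL
  -- Without its mean `X` is a potential, hence orthogonal to the divergence-free `Y`; only the
  -- product of the means survives.
  have hmem := CurlFree.toLp_mem_potentials hX0 (hc.sub (curlFree_const e) hX hcL) (by
    simp only [Pi.sub_apply]
    rw [integral_sub hXi (integrable_const e)]
    simp [he])
  have h0 := (Submodule.mem_orthogonal _ _).1 (hd.toLp_mem_orthogonal hY) _ hmem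
  rw [L2.inner_def, integral_congr_ae (g := fun S => inner ℝ (X S) (Y S) - inner ℝ e (Y S))] at h0
  · rw [integral_sub (integrable_inner_of_memLp hX hY) (hYi.const_inner e), integral_inner hYi]
      at h0
    linarith
  · filter_upwards [hX0.coeFn_toLp, hY.coeFn_toLp] with S h1 h2
    rw [h1, h2, Pi.sub_apply, inner_sub_left]

end Ergodic

end

/-! ### Local potentials as limits of smooth gradients -/

section

theorem eLpNorm_two_sq {X G : Type*} [MeasurableSpace X] [NormedAddCommGroup G] (μ : Measure X)
    (f : X → G) : eLpNorm f 2 μ ^ 2 = ∫⁻ x, ‖f x‖ₑ ^ 2 ∂μ := by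
  rw [eLpNorm_eq_lintegral_rpow_enorm_toReal two_ne_zero ENNReal.ofNat_ne_top,
    ← ENNReal.rpow_natCast, ← ENNReal.rpow_mul]
  simp

theorem eLpNorm_two_eq_rpow {X G : Type*} [MeasurableSpace X] [NormedAddCommGroup G]
    (μ : Measure X) (f : X → G) : eLpNorm f 2 μ = (∫⁻ x, ‖f x‖ₑ ^ 2 ∂μ) ^ (1 / (2 : ℝ)) := by
  rw [eLpNorm_eq_lintegral_rpow_enorm_toReal two_ne_zero ENNReal.ofNat_ne_top]
  simp

/-- The weights of the balls in `localMeasure`. -/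
def localWeight (d k : ℕ) : ℝ≥0∞ :=
  2⁻¹ ^ (k + 1) * (((k : ℝ≥0∞) ^ 2 + 1) * (volume (ball (0 : E d) k) + 1))⁻¹

/-- A finite measure with finite second moment which controls the volume on balls. -/
def localMeasure (d : ℕ) : Measure (E d) :=
  Measure.sum fun k : ℕ => localWeight d k • volume.restrict (ball (0 : E d) k)

/-- The quadratic growth matches the increments of a potential, whose second moments are of order
`‖x‖²`. The weights let the ball of radius `k` contribute at most `2^{-(k+1)}`. -/
theorem lintegral_localMeasure_le {f : E d → ℝ≥0∞} (h : ∀ x, f x ≤ ‖x‖ₑ ^ 2 + 1) :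
    ∫⁻ x, f x ∂localMeasure d ≤ 1 := by
  have hk : ∀ k : ℕ, ∫⁻ x, f x ∂(localWeight d k • volume.restrict (ball (0 : E d) k)) ≤
      2⁻¹ ^ (k + 1) := by
    intro k
    rw [lintegral_smul_measure, smul_eq_mul]
    have h1 : ∫⁻ x in ball (0 : E d) k, f x ≤
        ((k : ℝ≥0∞) ^ 2 + 1) * (volume (ball (0 : E d) k) + 1) := by
      calc ∫⁻ x in ball (0 : E d) k, f x ≤ ∫⁻ x in ball (0 : E d) k, ((k : ℝ≥0∞) ^ 2 + 1) := by
            refine setLIntegral_mono measurable_const fun x hx => (h x).trans ?_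
            gcongr
            rw [mem_ball_zero_iff] at hx
            rw [← ofReal_norm, ← ENNReal.ofReal_natCast]
            exact ENNReal.ofReal_le_ofReal hx.le
        _ ≤ _ := by
            rw [setLIntegral_const]
            gcongr
            exact le_self_add
    calc localWeight d k * ∫⁻ x in ball (0 : E d) k, f x
        ≤ localWeight d k * (((k : ℝ≥0∞) ^ 2 + 1) * (volume (ball (0 : E d) k) + 1)) := by gcongr
      _ ≤ 2⁻¹ ^ (k + 1) := by
        rw [localWeight, mul_assoc]
        exact mul_le_of_le_one_right zero_le (ENNReal.inv_mul_le_one _)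
  rw [localMeasure, lintegral_sum_measure]
  calc _ ≤ ∑' k : ℕ, (2⁻¹ : ℝ≥0∞) ^ (k + 1) := ENNReal.tsum_le_tsum hk
    _ = 1 := ENNReal.tsum_geometric_add_one _ |>.trans (by
      rw [ENNReal.one_sub_inv_two, inv_inv, ENNReal.inv_mul_cancel] <;> simp)

theorem localWeight_ne_zero (k : ℕ) : localWeight d k ≠ 0 := by
  refine mul_ne_zero (by simp) (ENNReal.inv_ne_zero.2 (ENNReal.mul_ne_top ?_ ?_))
  · exact ENNReal.add_ne_top.2 ⟨by simp, by simp⟩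
  · exact ENNReal.add_ne_top.2 ⟨measure_ball_lt_top.ne, by simp⟩

instance : IsFiniteMeasure (localMeasure d) := by
  refine ⟨?_⟩
  have := lintegral_localMeasure_le (d := d) (f := fun _ => 1) (fun x => le_add_self)
  simp only [lintegral_const, one_mul] at this
  exact this.trans_lt ENNReal.one_lt_top

theorem restrict_ball_le_localMeasure (k : ℕ) :
    volume.restrict (ball (0 : E d) k) ≤ (localWeight d k)⁻¹ • localMeasure d := by
  have h := Measure.le_sum (fun k : ℕ => localWeight d k • volume.restrict (ball (0 : E d) k)) k
  have hw : localWeight d k ≠ ⊤ := by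
    refine ENNReal.mul_ne_top (by simp) (ENNReal.inv_ne_top.2 (mul_ne_zero (by simp) (by simp)))
  calc volume.restrict (ball (0 : E d) k)
      = (localWeight d k)⁻¹ • (localWeight d k • volume.restrict (ball (0 : E d) k)) := by
        rw [smul_smul, ENNReal.inv_mul_cancel (localWeight_ne_zero k) hw, one_smul]
    _ ≤ _ := by
        refine Measure.le_iff.2 fun s _ => ?_
        simp only [Measure.smul_apply (localWeight d k)⁻¹]
        exact mul_le_mul_right (h s) _

theorem memL2Loc_of_localMeasure {G : Type*} [NormedAddCommGroup G] {u : E d → G}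
    (h : MemLp u 2 (localMeasure d)) : MemL2Loc u := by
  intro R
  obtain ⟨k, hk⟩ := exists_nat_ge R
  exact (h.of_measure_le_smul (ENNReal.inv_ne_top.2 (localWeight_ne_zero k))
    (restrict_ball_le_localMeasure k)).mono_measure
      (Measure.restrict_mono (ball_subset_ball hk) le_rfl)

theorem tendsto_integral_test_mul {u : ℕ → E d → ℝ} {u' : E d → ℝ}
    (hu : ∀ n, MemLp (u n) 2 (localMeasure d)) (hu' : MemLp u' 2 (localMeasure d))
    (h : Tendsto (fun n => eLpNorm (u n - u') 2 (localMeasure d)) atTop (𝓝 0))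
    {η : E d → ℝ} (hη : IsTest η) :
    Tendsto (fun n => ∫ x, η x * u n x) atTop (𝓝 (∫ x, η x * u' x)) := by
  obtain ⟨R, hR⟩ := hη.2.isCompact.isBounded.exists_norm_le
  obtain ⟨k, hk⟩ := exists_nat_gt R
  have hc : (localWeight d k)⁻¹ ≠ ⊤ := ENNReal.inv_ne_top.2 (localWeight_ne_zero k)
  have hsupp : ∀ w : E d → ℝ, ∫ x in ball (0 : E d) k, η x * w x = ∫ x, η x * w x := by
    intro w
    refine setIntegral_eq_integral_of_forall_compl_eq_zero fun x hx => ?_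
    rw [image_eq_zero_of_notMem_tsupport (f := η), zero_mul]
    exact fun hx' => hx (by rw [mem_ball_zero_iff]; exact (hR x hx').trans_lt hk)
  simp_rw [← hsupp]
  set μ := volume.restrict (ball (0 : E d) k)
  have hm : ∀ {w : E d → ℝ}, MemLp w 2 (localMeasure d) → MemLp w 2 μ := fun hw =>
    hw.of_measure_le_smul hc (restrict_ball_le_localMeasure k)
  have hηL : MemLp η 2 μ := (hη.continuous.memLp_of_hasCompactSupport (μ := volume) hη.2).restrict _
  refine tendsto_integral_of_L1' _ (hηL.1.mul (hm hu').1)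
    (Eventually.of_forall fun n => integrable_mul_of_memLp hηL (hm (hu n))) ?_
  have hlim : Tendsto (fun n => eLpNorm η 2 μ * ((localWeight d k)⁻¹ ^ (1 / (2 : ℝ≥0∞)).toReal *
      eLpNorm (u n - u') 2 (localMeasure d))) atTop (𝓝 0) := by
    have h1 := ENNReal.Tendsto.const_mul (a := (localWeight d k)⁻¹ ^ (1 / (2 : ℝ≥0∞)).toReal) h
      (Or.inr (ENNReal.rpow_ne_top_of_nonneg (by positivity) hc))
    have h2 := ENNReal.Tendsto.const_mul (a := eLpNorm η 2 μ) h1 (Or.inr hηL.2.ne)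
    simpa using h2
  refine tendsto_of_tendsto_of_tendsto_of_le_of_le tendsto_const_nhds hlim
    (fun n => zero_le) fun n => ?_
  have e1 : (fun x => η x * u n x) - (fun x => η x * u' x) = η • (u n - u') := by
    funext x; simp [mul_sub]
  change eLpNorm ((fun x => η x * u n x) - (fun x => η x * u' x)) 1 μ ≤ _
  rw [e1]
  refine (eLpNorm_smul_le_mul_eLpNorm ((hm (hu n)).1.sub (hm hu').1) hηL.1
    (p := 2) (q := 2) (r := 1)).trans ?_
  gcongr
  refine (eLpNorm_mono_measure _ (restrict_ball_le_localMeasure k)).trans ?_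
  rw [eLpNorm_smul_measure_of_ne_top ENNReal.ofNat_ne_top, smul_eq_mul]

theorem IsTest.fderiv_apply {η : E d → ℝ} (h : IsTest η) (v : E d) :
    IsTest fun x => fderiv ℝ η x v :=
  ⟨(h.1.fderiv_right (m := ∞) (by simp)).clm_apply contDiff_const,
    (h.2.fderiv ℝ).comp_left (g := fun L : E d →L[ℝ] ℝ => L v) rfl⟩

theorem isWeakGradient_of_hasFDerivAt {u : E d → ℝ} {G : E d → E d}
    (h : ∀ y, HasFDerivAt u (innerSL ℝ (G y)) y) (hG : Continuous G) : IsWeakGradient u G := by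
  intro η hη v
  have hu : Continuous u := continuous_iff_continuousAt.2 fun y => (h y).continuousAt
  have hfd : ∀ x, fderiv ℝ u x v = inner ℝ (G x) v := fun x => by
    rw [(h x).fderiv, innerSL_apply_apply]
  have hinteg : ∀ {w ζ : E d → ℝ}, Continuous w → IsTest ζ → Integrable fun x => w x * ζ x :=
    fun hw hζ => (hw.mul hζ.continuous).integrable_of_hasCompactSupport hζ.2.mul_left
  have key := integral_mul_fderiv_eq_neg_fderiv_mul_of_integrable (μ := volume) (f := u) (g := η)
    (v := v) ?_ ?_ ?_ (fun x _ => (h x).differentiableAt) fun x _ => hη.differentiable x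
  · rw [key]
    simp_rw [hfd]
  · simp_rw [hfd]
    exact hinteg (hG.inner continuous_const) hη
  · exact hinteg hu (hη.fderiv_apply v)
  · exact hinteg hu hη

theorem integral_fderiv_apply {η : E d → ℝ} (hη : IsTest η) (v : E d) :
    ∫ x, fderiv ℝ η x v = 0 := by
  simp_rw [fderiv_apply_eq_sum]
  rw [integral_finsetSum _ fun i _ => (hη.pd i).integrable.const_mul (v i)]
  simp_rw [integral_const_mul, integral_pd hη, mul_zero, Finset.sum_const_zero]

/-- The smooth potentials are Cauchy in the weighted space by summability of their differences. The
weak gradient passes to the limit, and subtracting the mean over the unit ball restores the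
anchoring. -/
theorem exists_weakGradient_of_tendsto {v : ℕ → E d → ℝ} {H : ℕ → E d → E d} {G : E d → E d}
    (hv : ∀ n y, HasFDerivAt (v n) (innerSL ℝ (H n y)) y) (hH : ∀ n, Continuous (H n))
    (hvL : ∀ n, MemLp (v n) 2 (localMeasure d)) (hHL : ∀ n, MemLp (H n) 2 (localMeasure d))
    (hG : MemLp G 2 (localMeasure d))
    (hsum : ∑' n, eLpNorm (v n - v (n + 1)) 2 (localMeasure d) ≠ ⊤)
    (hlim : Tendsto (fun n => eLpNorm (H n - G) 2 (localMeasure d)) atTop (𝓝 0)) :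
    ∃ u : E d → ℝ, MemL2Loc u ∧ IsWeakGradient u G ∧ ⨍ x in ball (0 : E d) 1, u x = 0 := by
  have hcau : CauchySeq fun n => (hvL n).toLp (v n) :=
    cauchySeq_of_edist_le_of_tsum_ne_top _ (fun n => (Lp.edist_toLp_toLp _ _ _ _).le) hsum
  obtain ⟨w, hw⟩ := cauchySeq_tendsto_of_complete hcau
  have hwlim : Tendsto (fun n => eLpNorm (v n - ⇑w) 2 (localMeasure d)) atTop (𝓝 0) := by
    rw [tendsto_iff_edist_tendsto_0] at hw
    refine hw.congr fun n => ?_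
    conv_lhs => rw [← Lp.toLp_coeFn w (Lp.memLp w)]
    rw [Lp.edist_toLp_toLp]
  have hwg : IsWeakGradient w G := by
    intro η hη e
    have h1 : ∀ n, ∫ x, fderiv ℝ η x e * v n x = -∫ x, η x * inner ℝ (H n x) e := by
      intro n
      simp_rw [mul_comm _ (v n _), mul_comm (η _)]
      exact isWeakGradient_of_hasFDerivAt (hv n) (hH n) η hη e
    have t1 := tendsto_integral_test_mul hvL (Lp.memLp w) hwlim (hη.fderiv_apply e)
    have t2 := tendsto_integral_test_mul (u := fun n x => inner ℝ (H n x) e)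
      (u' := fun x => inner ℝ (G x) e) (fun n => (hHL n).inner_const e) (hG.inner_const e) ?_ hη
    · simp_rw [h1] at t1
      have := tendsto_nhds_unique t1 t2.neg
      simp_rw [mul_comm (w _), mul_comm _ (η _)]
      exact this
    · have hz : Tendsto (fun n => ENNReal.ofReal ‖e‖ * eLpNorm (H n - G) 2 (localMeasure d)) atTop
          (𝓝 0) := by
        simpa using ENNReal.Tendsto.const_mul (a := ENNReal.ofReal ‖e‖) hlim (Or.inr (by simp))
      refine tendsto_of_tendsto_of_tendsto_of_le_of_le tendsto_const_nhds hz
        (fun n => zero_le) fun n => ?_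
      refine eLpNorm_le_mul_eLpNorm_of_ae_le_mul (ae_of_all _ fun x => ?_) 2
      simp only [Pi.sub_apply]
      rw [← inner_sub_left, mul_comm]
      exact norm_inner_le_norm _ _
  have hwL : MemL2Loc w := memL2Loc_of_localMeasure (Lp.memLp w)
  have hfin : IsFiniteMeasure (volume.restrict (ball (0 : E d) 1)) :=
    ⟨by simpa using measure_ball_lt_top⟩
  refine ⟨fun x => w x - ⨍ x in ball (0 : E d) 1, w x, fun R => ?_, fun η hη e => ?_, ?_⟩
  · have : IsFiniteMeasure (volume.restrict (ball (0 : E d) R)) :=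
      ⟨by simpa using measure_ball_lt_top⟩
    exact (hwL R).sub (memLp_const _)
  · rw [← hwg η hη e]
    simp_rw [sub_mul]
    rw [integral_sub, integral_const_mul, integral_fderiv_apply hη, mul_zero, sub_zero]
    · simp_rw [mul_comm (w _)]
      exact (hη.fderiv_apply e).integrable_mul hwL.locallyIntegrable
    · exact (hη.fderiv_apply e).integrable.const_mul _
  · have hi : Integrable w (volume.restrict (ball (0 : E d) 1)) := (hwL 1).integrable (by norm_num)
    have hne : volume.real (ball (0 : E d) 1) ≠ 0 :=
      (ENNReal.toReal_pos (measure_ball_pos _ _ one_pos).ne' measure_ball_lt_top.ne).ne'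
    rw [setAverage_eq, integral_sub hi (integrable_const _), setAverage_eq]
    simp [hne]

theorem measurable_eLpNorm {G : Type*} [NormedAddCommGroup G] {H : PointSet d → E d → G}
    (hH : StronglyMeasurable (Function.uncurry H)) :
    Measurable fun S => eLpNorm (H S) 2 (localMeasure d) := by
  have hm : Measurable (Function.uncurry fun S x => ‖H S x‖ₑ ^ 2) := hH.enorm.pow_const 2
  simp_rw [eLpNorm_two_eq_rpow]
  exact hm.lintegral_prod_right'.pow_const _

section Stationary

variable {P : Measure (PointSet d)} [IsProbabilityMeasure P]

theorem lintegral_eLpNorm_le {G : Type*} [NormedAddCommGroup G] {H : PointSet d → E d → G}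
    (hH : StronglyMeasurable (Function.uncurry H)) {c : ℝ≥0∞}
    (h : ∀ x, ∫⁻ S, ‖H S x‖ₑ ^ 2 ∂P ≤ (‖x‖ₑ ^ 2 + 1) * c ^ 2) :
    ∫⁻ S, eLpNorm (H S) 2 (localMeasure d) ∂P ≤ c := by
  have hm : Measurable (Function.uncurry fun S x => ‖H S x‖ₑ ^ 2) := hH.enorm.pow_const 2
  have hm3 := measurable_eLpNorm hH
  have h1 : (∫⁻ S, eLpNorm (H S) 2 (localMeasure d) ∂P) ^ 2 ≤ c ^ 2 := by
    calc (∫⁻ S, eLpNorm (H S) 2 (localMeasure d) ∂P) ^ 2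
        ≤ (∫⁻ S, eLpNorm (H S) 2 (localMeasure d) ^ 2 ∂P) * ∫⁻ _, 1 ^ 2 ∂P := by
          have := lintegral_mul_sq_le P (g := fun _ => 1) hm3.aemeasurable aemeasurable_const
          simpa only [mul_one] using this
      _ = ∫⁻ S, (∫⁻ x, ‖H S x‖ₑ ^ 2 ∂localMeasure d) ∂P := by
          simp [eLpNorm_two_sq]
      _ = ∫⁻ x, (∫⁻ S, ‖H S x‖ₑ ^ 2 ∂P) ∂localMeasure d := lintegral_lintegral_swap hm.aemeasurable
      _ ≤ ∫⁻ x, (‖x‖ₑ ^ 2 + 1) * c ^ 2 ∂localMeasure d := lintegral_mono h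
      _ = (∫⁻ x, (‖x‖ₑ ^ 2 + 1) ∂localMeasure d) * c ^ 2 := by
          rw [lintegral_mul_const]
          exact (measurable_enorm.pow_const 2).add_const 1
      _ ≤ c ^ 2 := mul_le_of_le_one_left zero_le
          (lintegral_localMeasure_le fun x => le_rfl)
  exact (ENNReal.pow_le_pow_left_iff two_ne_zero).1 h1

variable [VAddInvariantMeasure (E d) (PointSet d) P]

/-- The increment is the integral of the gradient along the segment, to which Cauchy–Schwarz and
stationarity apply. Unlike `χ` itself, increments are controlled by the gradient alone. -/
theorem IsCore.lintegral_increment_le {χ : PointSet d → ℝ} {X : PointSet d → E d}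
    (h : IsCore P χ X) (x : E d) :
    ∫⁻ S, ‖χ (-x +ᵥ S) - χ S‖ₑ ^ 2 ∂P ≤ ‖x‖ₑ ^ 2 * ∫⁻ S, ‖X S‖ₑ ^ 2 ∂P := by
  have hm : Measurable fun p : PointSet d × ℝ => X (-(p.2 • x) +ᵥ p.1) :=
    h.measurable_grad.comp (measurable_neg_vadd.comp
      (measurable_fst.prodMk (measurable_snd.smul_const x)))
  have h1 : ∀ᵐ S ∂P, ‖χ (-x +ᵥ S) - χ S‖ₑ ^ 2 ≤
      ‖x‖ₑ ^ 2 * ∫⁻ t in Ioc (0 : ℝ) 1, ‖X (-(t • x) +ᵥ S)‖ₑ ^ 2 := by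
    filter_upwards [h.hasFDerivAt, h.continuous_grad] with S hS hcS
    have hftc := intervalIntegral.integral_eq_sub_of_hasDerivAt (a := 0) (b := 1)
      (f := fun t : ℝ => field χ S (t • x)) (f' := fun t => inner ℝ (field X S (t • x)) x)
      (fun t _ => by
        have := (hS (t • x)).comp_hasDerivAt t ((hasDerivAt_id t).smul_const x)
        simpa [Function.comp_def] using this)
      (((hcS.comp (by fun_prop : Continuous fun t : ℝ => t • x)).inner
        continuous_const).intervalIntegrable 0 1)
    rw [intervalIntegral.integral_of_le zero_le_one] at hftc
    simp only [field, one_smul, zero_smul, neg_zero, zero_vadd] at hftc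
    rw [← hftc]
    calc ‖∫ t in Ioc (0 : ℝ) 1, inner ℝ (X (-(t • x) +ᵥ S)) x‖ₑ ^ 2
        ≤ (∫⁻ t in Ioc (0 : ℝ) 1, ‖x‖ₑ * ‖X (-(t • x) +ᵥ S)‖ₑ) ^ 2 := by
          gcongr
          refine (enorm_integral_le_lintegral_enorm _).trans (lintegral_mono fun t => ?_)
          simp only [← ofReal_norm]
          rw [← ENNReal.ofReal_mul (norm_nonneg _), mul_comm]
          exact ENNReal.ofReal_le_ofReal (norm_inner_le_norm _ _)
      _ ≤ (∫⁻ t in Ioc (0 : ℝ) 1, ‖x‖ₑ ^ 2) * ∫⁻ t in Ioc (0 : ℝ) 1, ‖X (-(t • x) +ᵥ S)‖ₑ ^ 2 :=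
          lintegral_mul_sq_le _ aemeasurable_const
            (hm.comp measurable_prodMk_left).enorm.aemeasurable
      _ = _ := by simp
  refine (lintegral_mono_ae h1).trans ?_
  rw [lintegral_const_mul' _ _ (by simp)]
  refine mul_le_mul' le_rfl ?_
  rw [lintegral_lintegral_swap
    (f := fun S (t : ℝ) => ‖X (-(t • x) +ᵥ S)‖ₑ ^ 2) (hm.enorm.pow_const 2).aemeasurable]
  have : ∀ t : ℝ, ∫⁻ S, ‖X (-(t • x) +ᵥ S)‖ₑ ^ 2 ∂P = ∫⁻ S, ‖X S‖ₑ ^ 2 ∂P := fun t =>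
    lintegral_vadd (-(t • x)) fun S => ‖X S‖ₑ ^ 2
  simp_rw [this]
  simp

theorem IsCore.lintegral_eLpNorm_increment_le {χ : PointSet d → ℝ} {X : PointSet d → E d}
    (h : IsCore P χ X) :
    ∫⁻ S, eLpNorm (fun x : E d => χ (-x +ᵥ S) - χ S) 2 (localMeasure d) ∂P ≤ eLpNorm X 2 P := by
  refine lintegral_eLpNorm_le (H := fun S (x : E d) => χ (-x +ᵥ S) - χ S) ?_ fun x => ?_
  · exact ((h.measurable.comp measurable_neg_vadd).sub
      (h.measurable.comp measurable_fst)).stronglyMeasurable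
  · rw [eLpNorm_two_sq]
    refine (h.lintegral_increment_le x).trans ?_
    gcongr
    exact le_self_add

theorem lintegral_eLpNorm_field_le {X : PointSet d → E d} (hX : Measurable X) :
    ∫⁻ S, eLpNorm (field X S) 2 (localMeasure d) ∂P ≤ eLpNorm X 2 P := by
  refine lintegral_eLpNorm_le (H := field X) (hX.comp measurable_neg_vadd).stronglyMeasurable fun
      x => ?_
  rw [eLpNorm_two_sq]
  have : ∫⁻ S, ‖field X S x‖ₑ ^ 2 ∂P = ∫⁻ S, ‖X S‖ₑ ^ 2 ∂P :=
    lintegral_vadd (-x) fun S => ‖X S‖ₑ ^ 2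
  rw [this]
  exact le_mul_of_one_le_left zero_le le_add_self

end Stationary

end

/-! ### Almost sure potentials, and equations tested by all functions at once -/

section

theorem ae_tsum_lt_top_of_lintegral_le {P : Measure (PointSet d)} {g : ℕ → PointSet d → ℝ≥0∞} (hg
    : ∀ n, Measurable (g n))
    {c : ℕ → ℝ≥0∞} (h : ∀ n, ∫⁻ S, g n S ∂P ≤ c n) (hc : ∑' n, c n ≠ ⊤) :
    ∀ᵐ S ∂P, ∑' n, g n S < ⊤ := by
  refine ae_lt_top (Measurable.tsum hg) (ne_top_of_le_ne_top hc ?_)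
  rw [lintegral_tsum fun n => (hg n).aemeasurable]
  exact ENNReal.tsum_le_tsum h

theorem tsum_ofReal_geometric_ne_top (a : ℝ) :
    ∑' n : ℕ, ENNReal.ofReal (a * (1 / 2 : ℝ) ^ n) ≠ ⊤ := by
  refine Summable.tsum_ofReal_ne_top ?_
  exact summable_geometric_two.mul_left a

section Stationary

variable {P : Measure (PointSet d)} [IsProbabilityMeasure P]
  [VAddInvariantMeasure (E d) (PointSet d) P]

/-- Approximating smooth potentials converge in expectation, with their increments and gradients
measured in `localMeasure`. A summable rate upgrades this to almost every realization. -/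
theorem exists_weakGradient_of_mem_potentials {f : Lp (E d) 2 P} (hf : f ∈ potentials P) :
    ∀ᵐ S ∂P, ∃ u : E d → ℝ, MemL2Loc u ∧ IsWeakGradient u (field f S) ∧
      ⨍ x in ball (0 : E d) 1, u x = 0 := by
  have hfm : Measurable f := (Lp.stronglyMeasurable f).measurable
  have hpos : ∀ n : ℕ, (0 : ℝ) < (1 / 2) ^ n := fun n => by positivity
  -- The rate `2^{-n}` makes the expected distances summable, so no subsequence has to be extracted.
  choose g hg hgd using fun n : ℕ => Metric.mem_closure_iff.1
    (show f ∈ closure (smoothPotentials P : Set (Lp (E d) 2 P)) from hf) _ (hpos n)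
  choose χ X hcore hgX using fun n => exists_isCore_of_mem_smoothPotentials (hg n)
  have hXf : ∀ n, eLpNorm (X n - ⇑f) 2 P ≤ ENNReal.ofReal (1 * (1 / 2) ^ n) := by
    intro n
    have h1 : eLpNorm (X n - ⇑f) 2 P = eLpNorm (⇑f - ⇑(g n)) 2 P := by
      rw [← eLpNorm_neg, neg_sub]
      refine eLpNorm_congr_ae ?_
      filter_upwards [hgX n] with S hS
      simp [hS]
    rw [h1, ← Lp.edist_def, edist_dist, one_mul]
    exact ENNReal.ofReal_le_ofReal (hgd n).le
  have hcore' : ∀ n, IsCore P (χ n + (-1 : ℝ) • χ (n + 1)) (X n + (-1 : ℝ) • X (n + 1)) := fun n =>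
    (hcore n).add ((hcore (n + 1)).smul (-1))
  have hXX : ∀ n, eLpNorm (X n + (-1 : ℝ) • X (n + 1)) 2 P ≤ ENNReal.ofReal (2 * (1 / 2) ^ n) := by
    intro n
    have h1 : X n + (-1 : ℝ) • X (n + 1) = (X n - ⇑f) - (X (n + 1) - ⇑f) := by
      rw [neg_one_smul]; abel
    rw [h1]
    refine (eLpNorm_sub_le ((hcore n).memLp_grad.sub (Lp.memLp f)).1
      ((hcore (n + 1)).memLp_grad.sub (Lp.memLp f)).1 (by norm_num)).trans ?_
    refine (add_le_add (hXf n) (hXf (n + 1))).trans ?_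
    rw [← ENNReal.ofReal_add (by positivity) (by positivity)]
    refine ENNReal.ofReal_le_ofReal ?_
    rw [pow_succ]
    linarith [hpos n]
  have hinc : ∀ {χ : PointSet d → ℝ} {X : PointSet d → E d}, IsCore P χ X →
      Measurable fun S => eLpNorm (fun x : E d => χ (-x +ᵥ S) - χ S) 2 (localMeasure d) :=
    fun h => measurable_eLpNorm (H := fun S (x : E d) => _ - _)
      ((h.measurable.comp measurable_neg_vadd).sub
        (h.measurable.comp measurable_fst)).stronglyMeasurable
  have hfld : ∀ {X : PointSet d → E d}, Measurable X →
      Measurable fun S => eLpNorm (field X S) 2 (localMeasure d) := fun h =>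
    measurable_eLpNorm (h.comp measurable_neg_vadd).stronglyMeasurable
  have hXfm : ∀ n, Measurable (X n - ⇑f) := fun n => (hcore n).measurable_grad.sub hfm
  have s1 := ae_tsum_lt_top_of_lintegral_le (P := P) (fun n => hinc (hcore' n))
    (fun n => (hcore' n).lintegral_eLpNorm_increment_le.trans (hXX n))
    (tsum_ofReal_geometric_ne_top 2)
  have s2 := ae_tsum_lt_top_of_lintegral_le (P := P) (fun n => hfld (hXfm n))
    (fun n => (lintegral_eLpNorm_field_le (hXfm n)).trans (hXf n))
    (tsum_ofReal_geometric_ne_top 1)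
  have s3 : ∀ᵐ S ∂P, ∀ n, eLpNorm (fun x : E d => χ n (-x +ᵥ S) - χ n S) 2 (localMeasure d) < ⊤ :=
    ae_all_iff.2 fun n => ae_lt_top (hinc (hcore n)) (ne_top_of_le_ne_top
      (hcore n).memLp_grad.2.ne (hcore n).lintegral_eLpNorm_increment_le)
  have s4 : ∀ᵐ S ∂P, eLpNorm (field f S) 2 (localMeasure d) < ⊤ :=
    ae_lt_top (hfld hfm) (ne_top_of_le_ne_top (Lp.memLp f).2.ne (lintegral_eLpNorm_field_le hfm))
  have s5 : ∀ᵐ S ∂P, ∀ n, eLpNorm (field (X n) S) 2 (localMeasure d) < ⊤ :=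
    ae_all_iff.2 fun n => ae_lt_top (hfld (hcore n).measurable_grad) (ne_top_of_le_ne_top
      (hcore n).memLp_grad.2.ne (lintegral_eLpNorm_field_le (hcore n).measurable_grad))
  have hms : ∀ S : PointSet d, Measurable fun x : E d => -x +ᵥ S := fun S =>
    measurable_neg_vadd.comp measurable_prodMk_left
  filter_upwards [s1, s2, s3, s4, s5, ae_all_iff.2 fun n => (hcore n).hasFDerivAt,
    ae_all_iff.2 fun n => (hcore n).continuous_grad] with S h1 h2 h3 h4 h5 h6 h7
  -- Each potential is normalized by its value at the origin, since only increments are controlled.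
  refine exists_weakGradient_of_tendsto (v := fun n x => χ n (-x +ᵥ S) - χ n S)
    (H := fun n => field (X n) S) (fun n y => (h6 n y).sub_const _) h7 (fun n => ⟨?_, h3 n⟩)
    (fun n => ⟨?_, h5 n⟩) ⟨?_, h4⟩ ?_ ?_
  · exact (((hcore n).measurable.comp (hms S)).sub_const _).aestronglyMeasurable
  · exact ((hcore n).measurable_grad.comp (hms S)).aestronglyMeasurable
  · exact (hfm.comp (hms S)).aestronglyMeasurable
  · refine ne_of_eq_of_ne (tsum_congr fun n => ?_) h1.ne
    congr 1
    funext x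
    simp
    ring
  · exact ENNReal.tendsto_atTop_zero_of_tsum_ne_top h2.ne

end Stationary

/-- Test functions with support in a given ball. -/
def BallTest (d : ℕ) (R : ℝ) : Type :=
  {η : E d → ℝ // IsTest η ∧ tsupport η ⊆ closedBall 0 R}

/-- The derivative of a test function, as a continuous function on the ball. -/
def BallTest.deriv {R : ℝ} (η : BallTest d R) : C(closedBall (0 : E d) R, E d →L[ℝ] ℝ) :=
  ⟨fun x => fderiv ℝ η.1 x, (η.2.1.1.continuous_fderiv (by simp)).comp continuous_subtype_val⟩

/-- Divergence-freeness holds almost surely for each test function, whereas the corrector equation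
holds almost surely for all of them. The pairing depends on the test function only through its
derivative, and continuously in the supremum norm, so a countable dense family suffices. -/
theorem exists_countable_forall_test (d : ℕ) (R : ℝ) :
    ∃ T : Set (E d → ℝ), T.Countable ∧ (∀ η ∈ T, IsTest η) ∧
      ∀ G : E d → E d, LocallyIntegrable G → (∀ η ∈ T, ∫ x, fderiv ℝ η x (G x) = 0) →
        ∀ η, IsTest η → tsupport η ⊆ closedBall 0 R → ∫ x, fderiv ℝ η x (G x) = 0 := by
  have : CompactSpace (closedBall (0 : E d) R) := isCompact_iff_compactSpace.1
      (isCompact_closedBall _ _)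
  -- With the topology induced by the derivative, second countability is inherited from continuous
  -- functions on a compact ball.
  let _ : TopologicalSpace (BallTest d R) := TopologicalSpace.induced BallTest.deriv inferInstance
  have hsc : SecondCountableTopology (BallTest d R) :=
    TopologicalSpace.secondCountableTopology_induced _ _ _
  obtain ⟨s, hs, hsd⟩ := TopologicalSpace.exists_countable_dense (BallTest d R)
  refine ⟨Subtype.val '' s, hs.image _, ?_, ?_⟩
  · rintro _ ⟨η, _, rfl⟩
    exact η.2.1
  intro G hG hT η hη hsupp
  have hGi : IntegrableOn G (closedBall (0 : E d) R) :=
    hG.integrableOn_isCompact (isCompact_closedBall _ _)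
  have hms : MeasurableSet (closedBall (0 : E d) R) := measurableSet_closedBall
  set μ : Measure (closedBall (0 : E d) R) := Measure.comap Subtype.val volume with hμ
  have hGi' : Integrable (fun x : closedBall (0 : E d) R => G x) μ := by
    rw [IntegrableOn, ← map_comap_subtype_coe hms volume] at hGi
    exact (MeasurableEmbedding.subtype_coe hms).integrable_map_iff.1 hGi
  have hinteg : ∀ g : C(closedBall (0 : E d) R, E d →L[ℝ] ℝ), Integrable (fun x => g x (G x)) μ := by
    intro g
    refine (hGi'.norm.const_mul ‖g‖).mono' ?_ (ae_of_all _ fun x => ?_)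
    · exact (ContinuousLinearMap.id ℝ (E d →L[ℝ] ℝ)).aestronglyMeasurable_comp₂
        g.continuous.aestronglyMeasurable hGi'.1
    · exact (g x).le_of_opNorm_le (g.norm_coe_le_norm x) _
  let Λ : C(closedBall (0 : E d) R, E d →L[ℝ] ℝ) →ₗ[ℝ] ℝ :=
    { toFun := fun g => ∫ x, g x (G x) ∂μ
      map_add' := fun g h => by
        simp only [ContinuousMap.add_apply, add_apply]
        exact integral_add (hinteg g) (hinteg h)
      map_smul' := fun c g => by
        simp only [ContinuousMap.smul_apply, smul_apply, RingHom.id_apply]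
        exact integral_smul c _ }
  have hΛ : Continuous Λ := by
    refine AddMonoidHomClass.continuous_of_bound Λ (∫ x, ‖G x‖ ∂μ) fun g => ?_
    change ‖∫ x, g x (G x) ∂μ‖ ≤ _
    rw [mul_comm, ← integral_const_mul]
    refine norm_integral_le_of_norm_le (hGi'.norm.const_mul ‖g‖) (ae_of_all _ fun x => ?_)
    exact (g x).le_of_opNorm_le (g.norm_coe_le_norm x) _
  have hval : ∀ η : BallTest d R, Λ η.deriv = ∫ x, fderiv ℝ η.1 x (G x) := by
    intro η
    change ∫ x : closedBall (0 : E d) R, fderiv ℝ η.1 x (G x) ∂μ = _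
    rw [hμ, integral_subtype_comap hms fun x => fderiv ℝ η.1 x (G x)]
    refine setIntegral_eq_integral_of_forall_compl_eq_zero fun x hx => ?_
    have : x ∉ tsupport (fderiv ℝ η.1) := fun h => hx (η.2.2 (tsupport_fderiv_subset ℝ h))
    rw [image_eq_zero_of_notMem_tsupport this]
    rfl
  have hcont : Continuous fun η : BallTest d R => Λ η.deriv := hΛ.comp continuous_induced_dom
  have hzero : (fun η : BallTest d R => Λ η.deriv) = fun _ => 0 := by
    refine hcont.ext_on hsd continuous_const fun η hη => ?_
    refine (hval η).trans ?_
    exact hT _ ⟨η, hη, rfl⟩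
  rw [← hval ⟨η, hη, hsupp⟩]
  exact congrFun hzero _

theorem DivFree.ae_forall {P : Measure (PointSet d)} [IsProbabilityMeasure P]
    [VAddInvariantMeasure (E d) (PointSet d) P] {X : PointSet d → E d} (hX : MemLp X 2 P)
    (h : DivFree P X) :
    ∀ᵐ S ∂P, ∀ η, IsTest η → ∫ x, fderiv ℝ η x (field X S x) = 0 := by
  choose T hTc hT hTall using fun n : ℕ => exists_countable_forall_test d n
  have h1 : ∀ᵐ S ∂P, ∀ n : ℕ, ∀ η ∈ T n, ∫ x, fderiv ℝ η x (field X S x) = 0 := by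
    refine ae_all_iff.2 fun n => (ae_ball_iff (hTc n)).2 fun η hη => ?_
    filter_upwards [h η (hT n η hη), integrable_test_mul_field hX] with S hS hi
    simp_rw [fderiv_apply_eq_sum]
    rw [integral_finsetSum, ← hS]
    · simp_rw [mul_comm]
    · intro i _
      simpa only [mul_comm] using hi _ ((hT n η hη).pd i) i
  filter_upwards [h1, memL2Loc_field hX] with S hS hloc η hη
  obtain ⟨R, hR⟩ := hη.2.isCompact.isBounded.exists_norm_le
  obtain ⟨n, hn⟩ := exists_nat_ge R
  exact hTall n _ hloc.locallyIntegrable (hS n) η hη fun x hx =>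
    mem_closedBall_zero_iff.2 ((hR x hx).trans hn)

end

/-! ### Existence and uniqueness of correctors, and the effective conductivity -/

section

theorem PointSet.mem_inclusions_iff {S : PointSet d} {y : E d} :
    y ∈ S.inclusions ↔ ∃ x ∈ S.carrier, ‖y - x‖ < 1 := by
  simp [PointSet.inclusions, dist_eq_norm]

theorem PointSet.mem_inclusions_iff_zero_mem {S : PointSet d} {y : E d} :
    y ∈ S.inclusions ↔ (0 : E d) ∈ (-y +ᵥ S).inclusions := by
  simp only [PointSet.mem_inclusions_iff, PointSet.carrier_vadd, exists_mem_image]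
  simp [sub_eq_add_neg, add_comm]

theorem measurableSet_zero_mem_inclusions :
    MeasurableSet {S : PointSet d | (0 : E d) ∈ S.inclusions} := by
  have : {S : PointSet d | (0 : E d) ∈ S.inclusions} = {S | S.counting (ball 0 1) = 0}ᶜ := by
    ext S
    rw [mem_compl_iff, mem_ofPred_eq, mem_ofPred_eq, S.counting_apply measurableSet_ball,
      PointSet.mem_inclusions_iff]
    simp only [zero_sub, norm_neg]
    rw [show ((S.carrier ∩ ball (0 : E d) 1).encard : ℝ≥0∞) = 0 ↔ S.carrier ∩ ball 0 1 = ∅ by simp,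
      ← ne_eq, ← nonempty_iff_ne_empty]
    simp [Set.Nonempty]
  rw [this]
  exact (((Measure.measurable_coe measurableSet_ball).comp PointSet.measurable_counting)
    (measurableSet_singleton 0)).compl

open Classical in
/-- The conductivity at the origin. -/
def conductivity (α β : ℝ) (S : PointSet d) : ℝ := if (0 : E d) ∈ S.inclusions then β else α

theorem measurable_conductivity (α β : ℝ) : Measurable (conductivity α β : PointSet d → ℝ) :=
  Measurable.ite measurableSet_zero_mem_inclusions measurable_const measurable_const

theorem coeff_apply (α β : ℝ) (S : PointSet d) (x v : E d) :
    coeff (α • ContinuousLinearMap.id ℝ (E d)) (β • ContinuousLinearMap.id ℝ (E d)) S x v =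
      field (conductivity α β) S x • v := by
  have h := PointSet.mem_inclusions_iff_zero_mem (S := S) (y := x)
  by_cases hx : x ∈ S.inclusions
  · simp [coeff, field, conductivity, hx, h.1 hx]
  · have hn : (0 : E d) ∉ (-x +ᵥ S).inclusions := fun h' => hx (h.2 h')
    simp [coeff, field, conductivity, hx, hn]

theorem conductivity_mem {α β : ℝ} (S : PointSet d) :
    conductivity α β S = α ∨ conductivity α β S = β := by
  simp only [conductivity]
  split_ifs <;> simp

theorem min_le_conductivity (α β : ℝ) (S : PointSet d) : min α β ≤ conductivity α β S := by
  rcases conductivity_mem (α := α) (β := β) S with h | h <;> simp [h]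

theorem abs_conductivity_le (α β : ℝ) (S : PointSet d) :
    |conductivity α β S| ≤ max |α| |β| := by
  rcases conductivity_mem (α := α) (β := β) S with h | h <;> simp [h]

section Stationary

variable {P : Measure (PointSet d)}

theorem memLp_bdd_smul {a : PointSet d → ℝ} (ha : Measurable a) {M : ℝ} (hM : ∀ S, |a S| ≤ M)
    {X : PointSet d → E d} (hX : MemLp X 2 P) : MemLp (fun S => a S • X S) 2 P := by
  refine MemLp.of_le_mul (c := M) hX (ha.aestronglyMeasurable.smul hX.1) (ae_of_all _ fun S => ?_)
  rw [norm_smul]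
  gcongr
  exact hM S

/-- Multiplication by a bounded random variable on square integrable random vectors. -/
def mulCLM (P : Measure (PointSet d)) {a : PointSet d → ℝ} (ha : Measurable a) {M : ℝ}
    (hM : ∀ S, |a S| ≤ M) : Lp (E d) 2 P →L[ℝ] Lp (E d) 2 P :=
  LinearMap.mkContinuous
    { toFun := fun f => (memLp_bdd_smul ha hM (Lp.memLp f)).toLp _
      map_add' := fun f g => by
        rw [← MemLp.toLp_add]
        refine (MemLp.toLp_eq_toLp_iff _ _).2 ?_
        filter_upwards [Lp.coeFn_add f g] with S hS
        rw [hS, Pi.add_apply, Pi.add_apply, smul_add]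
      map_smul' := fun c f => by
        rw [RingHom.id_apply, ← MemLp.toLp_const_smul]
        refine (MemLp.toLp_eq_toLp_iff _ _).2 ?_
        filter_upwards [Lp.coeFn_smul c f] with S hS
        rw [hS, Pi.smul_apply, Pi.smul_apply, smul_comm] } M fun f => by
    refine Lp.norm_le_mul_norm_of_ae_le_mul ?_
    filter_upwards [(memLp_bdd_smul ha hM (Lp.memLp f)).coeFn_toLp] with S hS
    change ‖((memLp_bdd_smul ha hM (Lp.memLp f)).toLp _ : PointSet d → E d) S‖ ≤ _
    rw [hS, norm_smul]
    gcongr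
    exact hM S

theorem coeFn_mulCLM {a : PointSet d → ℝ} (ha : Measurable a) {M : ℝ}
    (hM : ∀ S, |a S| ≤ M) (f : Lp (E d) 2 P) : mulCLM P ha hM f =ᵐ[P] fun S => a S • f S :=
  (memLp_bdd_smul ha hM (Lp.memLp f)).coeFn_toLp

/-- Lax–Milgram on `potentials`: multiplication by `a ≥ m`, projected back, is coercive. The
solution is produced as an operator in `e`, so that the effective conductivity is linear by
construction. -/
theorem exists_solution_operator [IsProbabilityMeasure P] {a : PointSet d → ℝ}
    (ha : Measurable a) {M : ℝ} (hM : ∀ S, |a S| ≤ M) {m : ℝ} (hm : 0 < m) (hma : ∀ S, m ≤ a S) :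
    ∃ T : E d →L[ℝ] Lp (E d) 2 P, ∀ e, T e ∈ potentials P ∧
      mulCLM P ha hM (T e + Lp.constL 2 P ℝ e) ∈ (potentials P)ᗮ := by
  set V := potentials P
  set A := mulCLM P ha hM
  set Q := V.orthogonalProjectionOnto
  set B : V →L[ℝ] V →L[ℝ] ℝ := (innerSL ℝ).comp (Q.comp (A.comp V.subtypeL)) with hB
  have hBv : ∀ u v : V, B u v = inner ℝ (A u) (v : Lp (E d) 2 P) := by
    intro u v
    simp only [hB, ContinuousLinearMap.comp_apply, innerSL_apply_apply]
    exact Submodule.inner_orthogonalProjectionOnto_eq_of_mem_right v _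
  have hcoer : IsCoercive B := by
    refine ⟨m, hm, fun u => ?_⟩
    rw [hBv, L2.inner_def, mul_assoc, ← real_inner_self_eq_norm_mul_norm, Submodule.coe_inner,
      L2.inner_def, ← integral_const_mul]
    refine integral_mono_ae ?_ ?_ ?_
    · exact (integrable_inner_of_memLp (Lp.memLp _) (Lp.memLp _)).const_mul m
    · exact integrable_inner_of_memLp (Lp.memLp _) (Lp.memLp _)
    · filter_upwards [coeFn_mulCLM ha hM (u : Lp (E d) 2 P)] with S hS
      simp only [A, hS, inner_smul_left, conj_trivial]
      exact mul_le_mul_of_nonneg_right (hma S) real_inner_self_nonneg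
  set Z := hcoer.continuousLinearEquivOfBilin
  refine ⟨-(V.subtypeL.comp ((Z.symm : V →L[ℝ] V).comp (Q.comp (A.comp (Lp.constL 2 P ℝ))))),
    fun e => ⟨?_, ?_⟩⟩
  · exact V.neg_mem (Subtype.mem _)
  · rw [Submodule.mem_orthogonal']
    intro v hv
    set u : V := Z.symm (Q (A (Lp.constL 2 P ℝ e))) with hu
    have h1 : B u ⟨v, hv⟩ = inner ℝ (A (Lp.constL 2 P ℝ e)) v := by
      rw [← hcoer.continuousLinearEquivOfBilin_apply u ⟨v, hv⟩]
      have : hcoer.continuousLinearEquivOfBilin u = Q (A (Lp.constL 2 P ℝ e)) :=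
        Z.apply_symm_apply _
      rw [this]
      exact Submodule.inner_orthogonalProjectionOnto_eq_of_mem_right ⟨v, hv⟩ _
    rw [hBv] at h1
    simp only [neg_apply, ContinuousLinearMap.comp_apply, map_add, map_neg,
      inner_add_left, inner_neg_left, ← h1]
    exact neg_add_cancel _

/-- A weak gradient is curl-free because the second derivatives of test functions commute. -/
theorem IsCorrector.curlFree [IsProbabilityMeasure P] {A₁ A₂ : E d →L[ℝ] E d} {e : E d}
    {φ : PointSet d → E d → ℝ} {Φ : PointSet d → E d} (h : IsCorrector P A₁ A₂ e φ Φ) :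
    CurlFree P Φ := by
  intro η hη i j
  filter_upwards [h.h1loc] with S hS
  have h1 : ∀ i j, ∫ x, φ S x * pd j (pd i η) x = -∫ x, pd i η x * field Φ S x j := by
    intro i j
    have := hS.2.2 (pd i η) (hη.pd i) (EuclideanSpace.single j 1)
    rw [stationaryField_eq_field] at this
    simp only [EuclideanSpace.inner_single_right, one_mul, conj_trivial] at this
    simp only [mul_comm (pd i η _)]
    exact this
  have h2 := h1 i j
  rw [pd_comm hη, h1 j i] at h2
  exact (neg_inj.1 h2).symm

theorem memLp_flux [IsProbabilityMeasure P] (α β : ℝ) {Φ : PointSet d → E d} (hΦ : MemLp Φ 2 P)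
    (e : E d) : MemLp (fun S => conductivity α β S • (Φ S + e)) 2 P :=
  memLp_bdd_smul (measurable_conductivity α β) (abs_conductivity_le α β) (hΦ.add (memLp_const e))

variable [IsProbabilityMeasure P] [VAddInvariantMeasure (E d) (PointSet d) P]

theorem integral_fderiv_eq_sum {X : PointSet d → E d} (hX : MemLp X 2 P) :
    ∀ᵐ S ∂P, ∀ η, IsTest η →
      ∫ x, fderiv ℝ η x (field X S x) = ∑ i, ∫ x, pd i η x * field X S x i := by
  filter_upwards [integrable_test_mul_field hX] with S hi η hη
  simp_rw [fderiv_apply_eq_sum]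
  rw [integral_finsetSum]
  · simp_rw [mul_comm]
  · intro i _
    simpa only [mul_comm] using hi _ (hη.pd i) i

theorem IsCorrector.divFree {α β : ℝ} {e : E d} {φ : PointSet d → E d → ℝ} {Φ : PointSet d → E d}
    (h : IsCorrector P (α • ContinuousLinearMap.id ℝ (E d)) (β • ContinuousLinearMap.id ℝ (E d))
      e φ Φ) : DivFree P fun S => conductivity α β S • (Φ S + e) := by
  intro η hη
  filter_upwards [h.equation, integral_fderiv_eq_sum (memLp_flux α β h.memLp e)] with S hS hS'
  rw [← hS' η hη, ← hS η hη]
  refine integral_congr_ae (ae_of_all _ fun x => ?_)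
  simp only [coeff_apply]
  rfl

theorem exists_isCorrector {α β : ℝ} {e : E d} {f : Lp (E d) 2 P} (hf : f ∈ potentials P)
    (hd : DivFree P fun S => conductivity α β S • (f S + e)) :
    ∃ φ, IsCorrector P (α • ContinuousLinearMap.id ℝ (E d)) (β • ContinuousLinearMap.id ℝ (E d))
      e φ f := by
  classical
  have hex := exists_weakGradient_of_mem_potentials hf
  -- The potential is chosen separately for each realization; a corrector requires no measurability
  -- of `φ` in `S`.
  set φ : PointSet d → E d → ℝ := fun S =>
    if h : ∃ u : E d → ℝ, MemL2Loc u ∧ IsWeakGradient u (field f S) ∧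
      ⨍ x in ball (0 : E d) 1, u x = 0 then h.choose else 0 with hφ
  have hspec : ∀ᵐ S ∂P, MemL2Loc (φ S) ∧ IsWeakGradient (φ S) (field f S) ∧
      ⨍ x in ball (0 : E d) 1, φ S x = 0 := by
    filter_upwards [hex] with S hS
    simp only [hφ, dif_pos hS]
    exact hS.choose_spec
  refine ⟨φ, ⟨Lp.memLp f, integral_eq_zero_of_mem_potentials hf, ?_, ?_, ?_⟩⟩
  · filter_upwards [hspec, memL2Loc_field (Lp.memLp f)] with S hS hS'
    exact ⟨hS.1, hS', hS.2.1⟩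
  · filter_upwards [hspec] with S hS using hS.2.2
  · filter_upwards [hd.ae_forall (memLp_flux α β (Lp.memLp f) e)] with S hS η hη
    rw [← hS η hη]
    refine integral_congr_ae (ae_of_all _ fun x => ?_)
    simp only [coeff_apply]
    rfl

end Stationary

section Ergodic

variable {P : Measure (PointSet d)} [IsProbabilityMeasure P] [ErgodicVAdd (E d) (PointSet d) P]

/-- The difference of the gradients is curl-free with mean zero and the difference of the fluxes is
divergence-free, so their pairing has zero expectation. It is the weighted square of the difference.
-/
theorem IsCorrector.ae_eq {α β : ℝ} (hα : 0 < α) (hβ : 0 < β) {e : E d}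
    {φ₁ φ₂ : PointSet d → E d → ℝ} {Φ₁ Φ₂ : PointSet d → E d}
    (h₁ : IsCorrector P (α • ContinuousLinearMap.id ℝ (E d)) (β • ContinuousLinearMap.id ℝ (E d))
      e φ₁ Φ₁)
    (h₂ : IsCorrector P (α • ContinuousLinearMap.id ℝ (E d)) (β • ContinuousLinearMap.id ℝ (E d))
      e φ₂ Φ₂) : Φ₁ =ᵐ[P] Φ₂ := by
  have hX : MemLp (Φ₁ - Φ₂) 2 P := h₁.memLp.sub h₂.memLp
  have hY := (memLp_flux α β h₁.memLp e).sub (memLp_flux α β h₂.memLp e)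
  have key := integral_inner_of_curlFree_of_divFree hX (h₁.curlFree.sub h₂.curlFree h₁.memLp
      h₂.memLp)
    hY (h₁.divFree.sub h₂.divFree (memLp_flux α β h₁.memLp e) (memLp_flux α β h₂.memLp e))
  have hmean : ∫ S, (Φ₁ - Φ₂) S ∂P = 0 := by
    simp only [Pi.sub_apply]
    rw [integral_sub (h₁.memLp.integrable (by norm_num)) (h₂.memLp.integrable (by norm_num)),
      h₁.mean_zero, h₂.mean_zero, sub_zero]
  rw [hmean, inner_zero_left] at key
  have hform : ∀ S, inner ℝ ((Φ₁ - Φ₂) S) (((fun S => conductivity α β S • (Φ₁ S + e)) -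
      fun S => conductivity α β S • (Φ₂ S + e)) S) = conductivity α β S * ‖Φ₁ S - Φ₂ S‖ ^ 2 := by
    intro S
    simp only [Pi.sub_apply]
    rw [← smul_sub, add_sub_add_right_eq_sub, inner_smul_right, real_inner_self_eq_norm_sq]
  have hpos : ∀ S : PointSet d, 0 < conductivity α β S := fun S =>
    (lt_min hα hβ).trans_le (min_le_conductivity α β S)
  rw [integral_eq_zero_iff_of_nonneg (fun S => by
    rw [hform]; exact mul_nonneg (hpos S).le (sq_nonneg _))
    (integrable_inner_of_memLp hX hY)] at key
  filter_upwards [key] with S hS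
  rw [hform] at hS
  have := (mul_eq_zero.1 hS).resolve_left (hpos S).ne'
  simpa [sub_eq_zero] using this

theorem exists_isEffectiveConductivity {α β : ℝ} (hα : 0 < α) (hβ : 0 < β) :
    ∃ Abar : E d →L[ℝ] E d, IsEffectiveConductivity P (α • ContinuousLinearMap.id ℝ (E d))
      (β • ContinuousLinearMap.id ℝ (E d)) Abar := by
  have hm := measurable_conductivity (d := d) α β
  have hM := abs_conductivity_le (d := d) α β
  obtain ⟨T, hT⟩ := exists_solution_operator (P := P) hm hM (lt_min hα hβ)
    (min_le_conductivity α β)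
  have hconst : ∀ e : E d, Lp.constL 2 P ℝ e =ᵐ[P] fun _ => e := fun e => Lp.coeFn_const _ _ _
  have hflux : ∀ e, mulCLM P hm hM (T e + Lp.constL 2 P ℝ e) =ᵐ[P]
      fun S => conductivity α β S • (T e S + e) := by
    intro e
    filter_upwards [coeFn_mulCLM hm hM (T e + Lp.constL 2 P ℝ e), Lp.coeFn_add (T e)
      (Lp.constL 2 P ℝ e), hconst e] with S h1 h2 h3
    rw [h1, h2, Pi.add_apply, h3]
  -- The adjoint of the embedding of constants is the expectation, so this operator sends `e` to the
  -- mean flux.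
  refine ⟨(ContinuousLinearMap.adjoint (Lp.constL 2 P ℝ)).comp
    ((mulCLM P hm hM).comp (T + Lp.constL 2 P ℝ)), fun e => ?_⟩
  have hcor : ∃ φ, IsCorrector P (α • ContinuousLinearMap.id ℝ (E d))
      (β • ContinuousLinearMap.id ℝ (E d)) e φ (T e) := by
    refine exists_isCorrector (hT e).1 ?_
    exact (divFree_of_mem_orthogonal (hT e).2 (Lp.stronglyMeasurable _).measurable
      (EventuallyEq.refl _ _)).congr (hflux e)
  obtain ⟨φ₀, h₀⟩ := hcor
  refine ⟨⟨φ₀, _, h₀⟩, fun φ Φ h => ?_⟩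
  refine ext_inner_left ℝ fun v => ?_
  simp only [ContinuousLinearMap.comp_apply, add_apply]
  rw [ContinuousLinearMap.adjoint_inner_right, L2.inner_def,
    ← integral_inner ?_ v]
  · refine integral_congr_ae ?_
    filter_upwards [hconst v, hflux e, h.ae_eq hα hβ h₀] with S h1 h2 h3
    rw [h1, h2, coeff_apply, h3]
    simp [field]
  · simp_rw [coeff_apply]
    have := (memLp_flux α β h.memLp e).integrable (by norm_num)
    simpa [field] using this

end Ergodic

end

section

/-! ### The profile of a single inclusion -/

/-- The dipole profile `max(|y|, 1)^{-d} - R^{-d}`, cut off at radius `R`. -/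
def profile (R : ℝ) (y : E d) : ℝ :=
  ((max 1 (min ‖y‖ (max R 1))) ^ d)⁻¹ - ((max R 1) ^ d)⁻¹

open Classical in
/-- The radial derivative of `profile`, divided by `-|y|`. -/
def slope (R : ℝ) (y : E d) : ℝ :=
  if 1 ≤ ‖y‖ ∧ ‖y‖ < R then d * (‖y‖ ^ (d + 2))⁻¹ else 0

/-- The matrix entries `∂_j (profile y_k)`. -/
def dipole (j k : Fin d) (R : ℝ) (y : E d) : ℝ :=
  (if j = k then profile R y else 0) - slope R y * (y j * y k)

/-- The components of the vector potential `profile y`. -/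
def dipolePotential (k : Fin d) (R : ℝ) (y : E d) : ℝ := profile R y * y k

theorem lipschitzOnWith_inv_pow (n : ℕ) :
    LipschitzOnWith n (fun t : ℝ => (t ^ n)⁻¹) (Ici 1) := by
  have hder : ∀ t ∈ Ici (1 : ℝ), HasDerivAt (fun t : ℝ => (t ^ n)⁻¹)
      (-(n * t ^ (n - 1)) / (t ^ n) ^ 2) t := by
    intro t ht
    have h0 : t ^ n ≠ 0 := pow_ne_zero _ (by linarith [mem_Ici.1 ht])
    exact (hasDerivAt_pow n t).inv h0
  refine (convex_Ici (1 : ℝ)).lipschitzOnWith_of_nnnorm_hasDerivWithin_le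
    (fun t ht => (hder t ht).hasDerivWithinAt) fun t ht => ?_
  have h1 : (1 : ℝ) ≤ t := ht
  rw [← NNReal.coe_le_coe, coe_nnnorm, Real.norm_eq_abs, abs_div, abs_neg,
    abs_of_nonneg (by positivity), abs_of_nonneg (by positivity), NNReal.coe_natCast,
    div_le_iff₀ (by positivity)]
  have h2 : t ^ (n - 1) ≤ t ^ n := pow_le_pow_right₀ h1 (Nat.sub_le _ _)
  have h3 : (1 : ℝ) ≤ t ^ n := one_le_pow₀ h1
  gcongr
  nlinarith

/-- The profile is continuous across its kinks at `‖y‖ = 1` and `‖y‖ = R`; the Lipschitz bound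
allows integration by parts with no surface terms there. For `R ≤ 1` the truncations by `max R 1`
make the profile vanish. -/
theorem lipschitzWith_profile (R : ℝ) : LipschitzWith d (profile R : E d → ℝ) := by
  have h1 : LipschitzWith 1 fun y : E d => max 1 (min ‖y‖ (max R 1)) :=
    (lipschitzWith_one_norm.min_const _).const_max _
  have h2 := (lipschitzOnWith_inv_pow d).comp (h1.lipschitzOnWith (s := univ))
    fun y _ => mem_Ici.2 (le_max_left _ _)
  rw [lipschitzOnWith_univ, mul_one] at h2
  refine LipschitzWith.of_dist_le_mul fun x y => ?_
  simpa [profile, Real.dist_eq] using h2.dist_le_mul x y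

theorem profile_of_norm_ge {R : ℝ} {y : E d} (h : R ≤ ‖y‖) : profile R y = 0 := by
  have : max 1 (min ‖y‖ (max R 1)) = max R 1 := by
    rcases le_total R 1 with h1 | h1
    · rw [max_eq_right h1]; simp
    · rw [max_eq_left h1, min_eq_right h, max_eq_right h1]
  simp [profile, this]

theorem profile_of_norm_le_one {R : ℝ} {y : E d} (h : ‖y‖ ≤ 1) :
    profile R y = 1 - ((max R 1) ^ d)⁻¹ := by
  have : max 1 (min ‖y‖ (max R 1)) = 1 := max_eq_left ((min_le_left _ _).trans h)
  simp [profile, this]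

theorem profile_of_mem {R : ℝ} {y : E d} (h : 1 ≤ ‖y‖) (hR : ‖y‖ < R) :
    profile R y = (‖y‖ ^ d)⁻¹ - (R ^ d)⁻¹ := by
  rw [profile, max_eq_left (h.trans hR.le), min_eq_left hR.le, max_eq_right h]

theorem profile_nonneg (R : ℝ) (y : E d) : 0 ≤ profile R y := by
  rw [profile, sub_nonneg]
  have : max 1 (min ‖y‖ (max R 1)) ≤ max R 1 := max_le (le_max_right _ _) (min_le_right _ _)
  gcongr

theorem profile_le_one (R : ℝ) (y : E d) : profile R y ≤ 1 := by
  have h1 : ((max 1 (min ‖y‖ (max R 1))) ^ d)⁻¹ ≤ 1 :=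
    inv_le_one_of_one_le₀ (one_le_pow₀ (le_max_left _ _))
  have h2 : 0 ≤ ((max R 1) ^ d)⁻¹ := by positivity
  rw [profile]
  linarith

theorem slope_of_norm_ge {R : ℝ} {y : E d} (h : R ≤ ‖y‖) : slope R y = 0 := by
  simp [slope, h]

theorem slope_of_norm_lt_one {R : ℝ} {y : E d} (h : ‖y‖ < 1) : slope R y = 0 := by
  simp [slope, h.not_ge]

theorem slope_nonneg (R : ℝ) (y : E d) : 0 ≤ slope R y := by
  unfold slope
  split_ifs <;> positivity

theorem slope_mul_sq {R : ℝ} {y : E d} (h : 1 ≤ ‖y‖) (hR : ‖y‖ < R) :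
    slope R y * ‖y‖ ^ 2 = d * (‖y‖ ^ d)⁻¹ := by
  have h0 : ‖y‖ ≠ 0 := by linarith
  rw [slope, if_pos ⟨h, hR⟩, pow_add]
  field_simp

theorem abs_coord_le_norm (y : E d) (i : Fin d) : |y i| ≤ ‖y‖ := PiLp.norm_apply_le y i

theorem slope_mul_sq_le (R : ℝ) (y : E d) : slope R y * ‖y‖ ^ 2 ≤ d := by
  by_cases h : 1 ≤ ‖y‖ ∧ ‖y‖ < R
  · rw [slope_mul_sq h.1 h.2]
    exact mul_le_of_le_one_right (Nat.cast_nonneg d) (inv_le_one_of_one_le₀ (one_le_pow₀ h.1))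
  · simp [slope, h]

theorem hasLineDerivAt_profile {R : ℝ} {y : E d} (h1 : ‖y‖ ≠ 1) (h2 : ‖y‖ ≠ max R 1) (v : E d) :
    HasLineDerivAt ℝ (profile R) (-(slope R y * inner ℝ y v)) y v := by
  unfold HasLineDerivAt
  have hcont : Tendsto (fun t : ℝ => ‖y + t • v‖) (𝓝 0) (𝓝 ‖y‖) := by
    have : Continuous fun t : ℝ => ‖y + t • v‖ := by fun_prop
    simpa using this.tendsto 0
  have hconst : ∀ c : ℝ, (∀ᶠ t in 𝓝 (0 : ℝ), profile R (y + t • v) = c) → slope R y = 0 →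
      HasDerivAt (fun t : ℝ => profile R (y + t • v)) (-(slope R y * inner ℝ y v)) 0 := by
    intro c hc h0
    rw [h0, zero_mul, neg_zero]
    exact (hasDerivAt_const (0 : ℝ) c).congr_of_eventuallyEq hc
  rcases lt_or_gt_of_ne h1 with h | h
  · refine hconst (1 - ((max R 1) ^ d)⁻¹) ?_ (slope_of_norm_lt_one h)
    filter_upwards [hcont.eventually_lt_const h] with t ht
    exact profile_of_norm_le_one ht.le
  rcases lt_or_gt_of_ne h2 with h' | h'
  swap
  · have hR := le_max_left R 1
    refine hconst 0 ?_ (slope_of_norm_ge (by linarith))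
    filter_upwards [hcont.eventually_const_lt h'] with t ht
    exact profile_of_norm_ge (by linarith)
  have hR : ‖y‖ < R := (lt_max_iff.1 h').resolve_right (by linarith)
  have hy : ‖y‖ ≠ 0 := by linarith
  have hlin : HasDerivAt (fun t : ℝ => y + t • v) v 0 := by
    simpa using ((hasDerivAt_id (0 : ℝ)).smul_const v).const_add y
  have hsq : HasDerivAt (fun t : ℝ => ‖y + t • v‖ ^ 2) (2 * inner ℝ y v) 0 := by
    simpa using hlin.norm_sq
  have hn : HasDerivAt (fun t : ℝ => ‖y + t • v‖) (inner ℝ y v / ‖y‖) 0 := by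
    have := hsq.sqrt (by simpa using hy)
    simp only [Real.sqrt_sq (norm_nonneg _)] at this
    convert this using 1
    simp
    field_simp
  have hp := ((hn.fun_pow d).fun_inv (by simpa using pow_ne_zero d hy)).sub_const ((R ^ d)⁻¹)
  have hval : -(slope R y * inner ℝ y v) =
      -(d * ‖y + (0 : ℝ) • v‖ ^ (d - 1) * (inner ℝ y v / ‖y‖)) / (‖y + (0 : ℝ) • v‖ ^ d) ^ 2 := by
    rw [slope, if_pos ⟨h.le, hR⟩, zero_smul, add_zero]
    rcases d with _ | n
    · simp
    · simp only [Nat.add_sub_cancel]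
      field_simp
      ring
  rw [hval]
  refine hp.congr_of_eventuallyEq ?_
  filter_upwards [hcont.eventually_lt_const hR, hcont.eventually_const_lt h] with t ht ht'
  exact profile_of_mem ht'.le ht

/-- A Lipschitz function has its almost everywhere derivative as weak derivative. -/
theorem integral_profile_mul_pd (R : ℝ) {η : E d → ℝ} (hη : IsTest η) (j : Fin d) :
    ∫ y, profile R y * pd j η y = ∫ y : E d, slope R y * y j * η y := by
  obtain ⟨D, hD⟩ := ContDiff.lipschitzWith_of_hasCompactSupport hη.2 hη.1 (by simp)
  have h := LipschitzWith.integral_lineDeriv_mul_eq (μ := volume) (lipschitzWith_profile R) hD hη.2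
    (EuclideanSpace.single j (1 : ℝ))
  have h1 : ∀ x, lineDeriv ℝ η x (-EuclideanSpace.single j (1 : ℝ)) = -pd j η x := by
    intro x
    rw [(hη.differentiable x).lineDeriv_eq_fderiv, map_neg, pd]
  simp only [h1, neg_mul, integral_neg] at h
  have h2 : ∫ x, lineDeriv ℝ (profile R) x (EuclideanSpace.single j (1 : ℝ)) * η x =
      -∫ y : E d, slope R y * y j * η y := by
    rw [← integral_neg]
    refine integral_congr_ae ?_
    -- The spheres carrying the kinks are null sets.
    have hs : ∀ r : ℝ, r ≠ 0 → ∀ᵐ y : E d, ‖y‖ ≠ r := by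
      intro r hr
      have := Measure.addHaar_sphere_of_ne_zero (volume : Measure (E d)) 0 hr
      filter_upwards [measure_eq_zero_iff_ae_notMem.1 this] with y hy
      simpa using hy
    filter_upwards [hs 1 one_ne_zero, hs (max R 1) (by positivity)] with y hy1 hy2
    rw [(hasLineDerivAt_profile hy1 hy2 _).lineDeriv]
    simp [EuclideanSpace.inner_single_right]
  rw [h2, neg_inj] at h
  rw [h]
  exact integral_congr_ae (ae_of_all _ fun y => mul_comm _ _)

theorem measurable_profile : Measurable (Function.uncurry (profile : ℝ → E d → ℝ)) := by
  unfold Function.uncurry profile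
  fun_prop

theorem measurable_slope : Measurable (Function.uncurry (slope : ℝ → E d → ℝ)) := by
  unfold Function.uncurry slope
  refine Measurable.ite ?_ (by fun_prop) measurable_const
  exact (measurableSet_le measurable_const measurable_snd.norm).inter
    (measurableSet_lt measurable_snd.norm measurable_fst)

theorem measurable_dipole (j k : Fin d) : Measurable (Function.uncurry (dipole j k)) := by
  unfold dipole
  refine Measurable.sub ?_ (measurable_slope.mul ?_)
  · by_cases h : j = k
    · simp only [h, if_true]; exact measurable_profile
    · simp [h]
  · exact (measurable_coord measurable_snd j).mul (measurable_coord measurable_snd k)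

theorem measurable_dipolePotential (k : Fin d) :
    Measurable (Function.uncurry (dipolePotential k)) :=
  measurable_profile.mul (measurable_coord measurable_snd k)

theorem dipole_comm (j k : Fin d) : dipole j k = dipole k j := by
  funext R y
  simp only [dipole, eq_comm (a := j), mul_comm (y j)]

theorem dipole_of_norm_ge (j k : Fin d) {R : ℝ} {y : E d} (h : R ≤ ‖y‖) : dipole j k R y = 0 := by
  simp [dipole, profile_of_norm_ge h, slope_of_norm_ge h]

theorem dipolePotential_of_norm_ge (k : Fin d) {R : ℝ} {y : E d} (h : R ≤ ‖y‖) :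
    dipolePotential k R y = 0 := by
  simp [dipolePotential, profile_of_norm_ge h]

theorem abs_slope_mul_le (j k : Fin d) (R : ℝ) (y : E d) : |slope R y * (y j * y k)| ≤ d := by
  rw [abs_mul, abs_of_nonneg (slope_nonneg R y), abs_mul]
  refine le_trans ?_ (slope_mul_sq_le R y)
  rw [sq]
  have := slope_nonneg R y
  gcongr <;> exact abs_coord_le_norm y _

theorem abs_dipole_le (j k : Fin d) (R : ℝ) (y : E d) : |dipole j k R y| ≤ 1 + d := by
  have h1 : |if j = k then profile R y else 0| ≤ 1 := by
    split_ifs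
    · rw [abs_of_nonneg (profile_nonneg R y)]; exact profile_le_one R y
    · simp
  exact (abs_sub _ _).trans (add_le_add h1 (abs_slope_mul_le j k R y))

theorem abs_dipolePotential_le (k : Fin d) {L R : ℝ} (hL : 0 ≤ L) (hR : R ≤ L) (y : E d) :
    |dipolePotential k R y| ≤ L := by
  by_cases h : R ≤ ‖y‖
  · simpa [dipolePotential_of_norm_ge k h] using hL
  · rw [dipolePotential, abs_mul, abs_of_nonneg (profile_nonneg R y)]
    have h1 := profile_le_one R y
    have h2 := abs_coord_le_norm y k
    have h3 := profile_nonneg R y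
    nlinarith [abs_nonneg (y k)]

theorem locallyIntegrable_of_bdd {u : E d → ℝ} (hu : Measurable u) {M : ℝ} (hM : ∀ y, |u y| ≤ M) :
    LocallyIntegrable u := by
  intro x
  refine ⟨ball x 1, ball_mem_nhds _ one_pos, ?_⟩
  exact Measure.integrableOn_of_bounded (M := M) measure_ball_lt_top.ne hu.aestronglyMeasurable
    (ae_of_all _ fun y => hM y)

theorem IsTest.mul_coord {η : E d → ℝ} (hη : IsTest η) (k : Fin d) : IsTest fun y => η y * y k :=
  ⟨hη.1.mul (EuclideanSpace.proj (ι := Fin d) (𝕜 := ℝ) k).contDiff, hη.2.mul_right⟩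

theorem pd_mul_coord {η : E d → ℝ} (hη : Differentiable ℝ η) (j k : Fin d) (y : E d) :
    pd j (fun y => η y * y k) y = pd j η y * y k + if j = k then η y else 0 := by
  have hk := (EuclideanSpace.proj (ι := Fin d) (𝕜 := ℝ) k).hasFDerivAt (x := y)
  have h := (hη y).hasFDerivAt.mul hk
  have h2 : fderiv ℝ (fun y : E d => η y * y k) y = _ := h.fderiv
  simp only [pd]
  rw [h2]
  simp only [add_apply, smul_apply, smul_eq_mul]
  change η y * (EuclideanSpace.single j (1 : ℝ) : E d) k + y k * _ = _
  rw [PiLp.single_apply]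
  simp only [eq_comm (a := j)]
  split_ifs <;> ring

theorem abs_profile_le_one (R : ℝ) (y : E d) : |profile R y| ≤ 1 := by
  rw [abs_of_nonneg (profile_nonneg R y)]
  exact profile_le_one R y

/-- The Leibniz rule in weak form: the derivative of the profile is tested against `η y_k`. -/
theorem integral_mul_dipole (j k : Fin d) (R : ℝ) {η : E d → ℝ} (hη : IsTest η) :
    ∫ y, η y * dipole j k R y = -∫ y, pd j η y * dipolePotential k R y := by
  have hdip : Measurable (dipole j k R) := (measurable_dipole j k).of_uncurry_left
  have hprof : Measurable (profile R : E d → ℝ) := measurable_profile.of_uncurry_left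
  have i2 : Integrable fun y => η y * dipole j k R y :=
    hη.integrable_mul (locallyIntegrable_of_bdd hdip (abs_dipole_le j k R))
  have i1 : Integrable fun y => pd j η y * dipolePotential k R y := by
    have := ((hη.pd j).mul_coord k).integrable_mul (u := profile R)
      (locallyIntegrable_of_bdd hprof (M := 1) (abs_profile_le_one R))
    simpa only [dipolePotential, mul_assoc, mul_comm (profile R _)] using this
  have hpd := pd_mul_coord hη.differentiable j k
  rw [eq_neg_iff_add_eq_zero, ← integral_add i2 i1]
  have h := integral_profile_mul_pd R (hη.mul_coord k) j
  rw [← sub_eq_zero, ← integral_sub] at h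
  · rw [← h]
    congr 1
    funext y
    rw [hpd, dipole, dipolePotential]
    split_ifs <;> ring
  · have := ((hη.mul_coord k).pd j).integrable_mul (u := profile R)
      (locallyIntegrable_of_bdd hprof (M := 1) (abs_profile_le_one R))
    simpa only [mul_comm (profile R _)] using this
  · have : Measurable fun y : E d => slope R y * (y j * y k) := by
      have hsl : Measurable (slope R : E d → ℝ) := measurable_slope.of_uncurry_left
      exact hsl.mul ((measurable_coord measurable_id j).mul (measurable_coord measurable_id k))
    have := hη.integrable_mul (locallyIntegrable_of_bdd this (abs_slope_mul_le j k R))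
    refine this.congr (ae_of_all _ fun y => ?_)
    ring

/-- The weight `min(1, R^{-d})`. -/
def weight (d : ℕ) (R : ℝ) : ℝ := ((max R 1) ^ d)⁻¹

theorem weight_nonneg (R : ℝ) : 0 ≤ weight d R := by unfold weight; positivity

theorem weight_le_one (R : ℝ) : weight d R ≤ 1 :=
  inv_le_one_of_one_le₀ (one_le_pow₀ (le_max_right _ _))

theorem measurable_weight : Measurable (weight d) := by unfold weight; fun_prop

theorem dipole_of_norm_lt_one (j k : Fin d) {R : ℝ} {y : E d} (h : ‖y‖ < 1) :
    dipole j k R y = if j = k then 1 - weight d R else 0 := by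
  rw [dipole, slope_of_norm_lt_one h, profile_of_norm_le_one h.le, zero_mul, sub_zero, weight]

/-- The field `y / |y|^d` is divergence-free away from the origin, so outside the unit ball only the
lowering term `-R^{-d} y` contributes. It acts as a uniform background charge that neutralizes the
inclusion. -/
theorem sum_dipole {R : ℝ} {y : E d} (hy : ‖y‖ < R) (hR : 1 < R) :
    ∑ k, dipole k k R y = d * ((if ‖y‖ < 1 then 1 else 0) - weight d R) := by
  by_cases h : ‖y‖ < 1
  · simp [dipole_of_norm_lt_one _ _ h, h]
    ring
  · have h1 := not_lt.1 h
    have h2 := slope_mul_sq h1 hy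
    simp only [dipole, if_true, Finset.sum_sub_distrib, Finset.sum_const, Finset.card_univ,
      Fintype.card_fin, nsmul_eq_mul, ← Finset.mul_sum, if_neg h, weight, max_eq_left hR.le]
    rw [show ∑ k, y k * y k = ‖y‖ ^ 2 by
      rw [EuclideanSpace.norm_sq_eq]; simp [sq], h2,
      profile_of_mem h1 hy]
    ring

theorem dipole_of_le_one (j k : Fin d) {R : ℝ} (hR : R ≤ 1) (y : E d) : dipole j k R y = 0 := by
  by_cases h : ‖y‖ < 1
  · rw [dipole_of_norm_lt_one _ _ h, weight, max_eq_right hR]; simp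
  · exact dipole_of_norm_ge j k (by linarith [not_lt.1 h])

end

section

/-! ### Superposition of disjoint single-inclusion fields -/

/-- Half the distance from the origin to the other points of `S`, capped at `L`. -/
def isolationRadius (L : ℝ) (S : PointSet d) : ℝ :=
  sInf (insert L ((fun x : E d => ‖x‖ / 2) '' (S.carrier \ {0})))

theorem isolationRadius_bddBelow (L : ℝ) (S : PointSet d) :
    BddBelow (insert L ((fun x : E d => ‖x‖ / 2) '' (S.carrier \ {0}))) :=
  BddBelow.insert _ ⟨0, by rintro _ ⟨x, -, rfl⟩; positivity⟩

theorem isolationRadius_le (L : ℝ) (S : PointSet d) : isolationRadius L S ≤ L :=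
  csInf_le (isolationRadius_bddBelow L S) (mem_insert _ _)

theorem isolationRadius_le_of_mem (L : ℝ) {S : PointSet d} {x : E d} (hx : x ∈ S.carrier)
    (h0 : x ≠ 0) : isolationRadius L S ≤ ‖x‖ / 2 :=
  csInf_le (isolationRadius_bddBelow L S) (mem_insert_of_mem _ ⟨x, ⟨hx, h0⟩, rfl⟩)

theorem isolationRadius_lt_iff {L : ℝ} {S : PointSet d} {t : ℝ} :
    isolationRadius L S < t ↔ L < t ∨ ∃ x ∈ S.carrier, x ≠ 0 ∧ ‖x‖ < 2 * t := by
  rw [isolationRadius, csInf_lt_iff (isolationRadius_bddBelow L S) (insert_nonempty _ _)]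
  constructor
  · rintro ⟨b, rfl | ⟨x, ⟨hx, h0⟩, rfl⟩, hb⟩
    · exact Or.inl hb
    · exact Or.inr ⟨x, hx, h0, by linarith⟩
  · rintro (h | ⟨x, hx, h0, h⟩)
    · exact ⟨L, mem_insert _ _, h⟩
    · exact ⟨‖x‖ / 2, mem_insert_of_mem _ ⟨x, ⟨hx, h0⟩, rfl⟩, by linarith⟩

theorem measurable_isolationRadius (L : ℝ) :
    Measurable (isolationRadius L : PointSet d → ℝ) := by
  refine measurable_of_Iio fun t => ?_
  have hD : MeasurableSet (ball (0 : E d) (2 * t) \ {0}) :=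
    measurableSet_ball.diff (measurableSet_singleton 0)
  have h : isolationRadius L ⁻¹' Iio t =
      {S : PointSet d | L < t} ∪ {S | S.counting (ball 0 (2 * t) \ {0}) = 0}ᶜ := by
    ext S
    simp only [mem_preimage, mem_Iio, isolationRadius_lt_iff, mem_union, mem_ofPred_eq,
      mem_compl_iff, S.counting_apply hD]
    rw [show ((S.carrier ∩ (ball (0 : E d) (2 * t) \ {0})).encard : ℝ≥0∞) = 0 ↔
      S.carrier ∩ (ball 0 (2 * t) \ {0}) = ∅ by simp, ← ne_eq, ← nonempty_iff_ne_empty]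
    simp only [Set.Nonempty, mem_inter_iff, Set.mem_sdiff, mem_ball_zero_iff, mem_singleton_iff]
    refine or_congr_right (exists_congr fun x => ?_)
    tauto
  rw [h]
  exact (MeasurableSet.const _).union (((Measure.measurable_coe hD).comp
    PointSet.measurable_counting) (measurableSet_singleton 0)).compl

theorem PointSet.mem_vadd_iff {S : PointSet d} {z y : E d} :
    y ∈ (z +ᵥ S).carrier ↔ -z + y ∈ S.carrier := by
  rw [PointSet.carrier_vadd]
  constructor
  · rintro ⟨x, hx, rfl⟩
    simpa using hx
  · exact fun h => ⟨_, h, by simp⟩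

theorem isolationRadius_neg_vadd_le (L : ℝ) {S : PointSet d} {x x' : E d} (hx' : x' ∈ S.carrier)
    (h : x ≠ x') : isolationRadius L (-x +ᵥ S) ≤ ‖x' - x‖ / 2 := by
  have := isolationRadius_le_of_mem L (S := -x +ᵥ S) (x := x' - x)
    (by rw [PointSet.mem_vadd_iff]; simpa using hx') (sub_ne_zero.2 h.symm)
  exact this

/-- Each radius is at most half the distance between the two points, so open balls with these radii
cannot meet. -/
theorem isolationRadius_disjoint {L : ℝ} {S : PointSet d} {x x' y : E d} (hx : x ∈ S.carrier)
    (hx' : x' ∈ S.carrier) (h : ‖y - x‖ < isolationRadius L (-x +ᵥ S))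
    (h' : ‖y - x'‖ < isolationRadius L (-x' +ᵥ S)) : x = x' := by
  by_contra hne
  have h1 := isolationRadius_neg_vadd_le L hx' hne
  have h2 := isolationRadius_neg_vadd_le L hx (Ne.symm hne)
  have h3 : ‖x' - x‖ ≤ ‖y - x‖ + ‖y - x'‖ := by
    rw [show x' - x = (y - x) - (y - x') by abel]
    exact norm_sub_le _ _
  rw [norm_sub_rev x x'] at h2
  linarith

/-- The superposition of the profiles `k R_x (· - x)` over the points `x` of `S`, at the origin,
where `R_x` is the isolation radius of `x`. -/
def shot (L : ℝ) (k : ℝ → E d → ℝ) (S : PointSet d) : ℝ :=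
  ∫ x, k (isolationRadius L (-x +ᵥ S)) (-x) ∂S.counting

theorem measurable_shot (L : ℝ) {k : ℝ → E d → ℝ} (hk : Measurable (Function.uncurry k)) :
    Measurable (shot L k) := by
  have h1 : Measurable (Function.uncurry fun (S : PointSet d) (x : E d) =>
      k (isolationRadius L (-x +ᵥ S)) (-x)) :=
    hk.comp (((measurable_isolationRadius L).comp measurable_neg_vadd).prodMk measurable_snd.neg)
  exact (h1.stronglyMeasurable.integral_kernel_prod_right (κ := countingKernel d)).measurable

theorem field_shot (L : ℝ) (k : ℝ → E d → ℝ) (S : PointSet d) (y : E d) :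
    field (shot L k) S y = ∫ x, k (isolationRadius L (-x +ᵥ S)) (y - x) ∂S.counting := by
  rw [field, shot, PointSet.integral_counting_vadd]
  congr 1
  funext x
  rw [vadd_vadd]
  congr 3 <;> abel

variable {L : ℝ} {k : ℝ → E d → ℝ}

/-- The balls are disjoint and the profiles vanish outside them, so at most one point contributes at
the origin. -/
theorem shot_eq_of_mem (hk : ∀ R y, R ≤ ‖y‖ → k R y = 0) {S : PointSet d} {x : E d}
    (hx : x ∈ S.carrier) (h : ‖x‖ < isolationRadius L (-x +ᵥ S)) :
    shot L k S = k (isolationRadius L (-x +ᵥ S)) (-x) := by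
  rw [shot, S.integral_counting _ (D := {x}) Bornology.isBounded_singleton]
  · have : (S.finite_inter {x} Bornology.isBounded_singleton).toFinset = {x} := by
      ext z
      simp only [Finite.mem_toFinset, mem_inter_iff, mem_singleton_iff, Finset.mem_singleton]
      exact ⟨fun h => h.2, fun h => ⟨h ▸ hx, h⟩⟩
    rw [this, Finset.sum_singleton]
  · intro x' hx' hne
    refine hk _ _ (not_lt.1 fun h' => hne ?_)
    have := isolationRadius_disjoint (y := 0) hx hx' (by simpa using h) (by simpa using h')
    simp [this]

theorem shot_eq_zero (hk : ∀ R y, R ≤ ‖y‖ → k R y = 0) {S : PointSet d}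
    (h : ∀ x ∈ S.carrier, isolationRadius L (-x +ᵥ S) ≤ ‖x‖) : shot L k S = 0 := by
  rw [shot, S.integral_counting _ (D := ∅) Bornology.isBounded_empty]
  · simp
  · intro x hx _
    exact hk _ _ (by simpa using h x hx)

theorem abs_shot_le (hk : ∀ R y, R ≤ ‖y‖ → k R y = 0) {M : ℝ} (hM : 0 ≤ M)
    (hb : ∀ R y, R ≤ L → |k R y| ≤ M) (S : PointSet d) : |shot L k S| ≤ M := by
  by_cases h : ∃ x ∈ S.carrier, ‖x‖ < isolationRadius L (-x +ᵥ S)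
  · obtain ⟨x, hx, h⟩ := h
    rw [shot_eq_of_mem hk hx h]
    exact hb _ _ (isolationRadius_le _ _)
  · push Not at h
    rw [shot_eq_zero hk h]
    simpa using hM

/-- The cap `L` bounds the range of every profile, so only finitely many points are felt on the
support of `η`. -/
theorem integral_mul_field_shot (hkm : Measurable (Function.uncurry k))
    (hk : ∀ R y, R ≤ ‖y‖ → k R y = 0) {M : ℝ} (hb : ∀ R y, R ≤ L → |k R y| ≤ M)
    {η : E d → ℝ} (hη : IsTest η) {r : ℝ} (hr : tsupport η ⊆ closedBall 0 r) (S : PointSet d) :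
    ∫ y, η y * field (shot L k) S y =
      ∑ x ∈ (S.finite_inter (closedBall 0 (r + L)) isBounded_closedBall).toFinset,
        ∫ y, η (y + x) * k (isolationRadius L (-x +ᵥ S)) y := by
  set F := (S.finite_inter (closedBall 0 (r + L)) isBounded_closedBall).toFinset
  have h1 : ∀ y, η y * field (shot L k) S y =
      ∑ x ∈ F, η y * k (isolationRadius L (-x +ᵥ S)) (y - x) := by
    intro y
    by_cases hy : η y = 0
    · simp [hy]
    rw [← Finset.mul_sum, field_shot]
    congr 1
    refine S.integral_counting _ isBounded_closedBall fun x _ hx => hk _ _ ?_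
    have h2 : ‖y‖ ≤ r := by simpa using hr (subset_tsupport _ hy)
    have h3 : r + L < ‖x‖ := by simpa using hx
    have h4 := isolationRadius_le L (-x +ᵥ S)
    have h5 : ‖x‖ ≤ ‖y‖ + ‖y - x‖ := by
      have := norm_sub_le y (y - x)
      simpa using this
    linarith
  have h2 : ∀ x, Integrable fun y => η (y + x) * k (isolationRadius L (-x +ᵥ S)) y := fun x =>
    (hη.comp_add_right x).integrable_mul (locallyIntegrable_of_bdd hkm.of_uncurry_left fun y =>
      hb _ y (isolationRadius_le _ _))
  simp only [h1]
  rw [integral_finsetSum]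
  · refine Finset.sum_congr rfl fun x _ => ?_
    rw [← integral_add_right_eq_self _ x]
    simp
  · intro x _
    have := (h2 x).comp_sub_right x
    simpa using this

theorem pd_comp_add_right (η : E d → ℝ) (j : Fin d) (x y : E d) :
    pd j (fun y => η (y + x)) y = pd j η (y + x) := by
  rw [pd, fderiv_comp_add_right, pd]

/-- Integration by parts passes from the profile to the superposition. -/
theorem integral_mul_field_shot_eq {h : ℝ → E d → ℝ} {j : Fin d}
    (hkm : Measurable (Function.uncurry k)) (hk : ∀ R y, R ≤ ‖y‖ → k R y = 0) {M : ℝ}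
    (hb : ∀ R y, R ≤ L → |k R y| ≤ M)
    (hhm : Measurable (Function.uncurry h)) (hh : ∀ R y, R ≤ ‖y‖ → h R y = 0) {M' : ℝ}
    (hb' : ∀ R y, R ≤ L → |h R y| ≤ M')
    (hkh : ∀ R η, IsTest η → ∫ y, η y * k R y = -∫ y, pd j η y * h R y)
    {η : E d → ℝ} (hη : IsTest η) (S : PointSet d) :
    ∫ y, η y * field (shot L k) S y = -∫ y, pd j η y * field (shot L h) S y := by
  obtain ⟨r, hr⟩ := hη.2.isCompact.isBounded.subset_closedBall 0
  have hr' : tsupport (pd j η) ⊆ closedBall 0 r := by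
    refine (closure_minimal ?_ (isClosed_tsupport η)).trans hr
    exact fun y hy => support_fderiv_subset ℝ (f := η) fun h0 => hy (by rw [pd, h0]; rfl)
  rw [integral_mul_field_shot hkm hk hb hη hr, integral_mul_field_shot hhm hh hb' (hη.pd j) hr',
    ← Finset.sum_neg_distrib]
  refine Finset.sum_congr rfl fun x _ => ?_
  rw [hkh _ _ (hη.comp_add_right x)]
  simp only [pd_comp_add_right]

/-- The weak derivative identity is tested against a mollifier of unit integral. By stationarity the
expectation of one side is the wanted mean, and that of the other carries the factor `∫ ∂_j η = 0`.
-/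
theorem integral_shot_eq_zero {P : Measure (PointSet d)} [IsProbabilityMeasure P]
    [VAddInvariantMeasure (E d) (PointSet d) P] {h : ℝ → E d → ℝ} {j : Fin d}
    (hkm : Measurable (Function.uncurry k)) (hk : ∀ R y, R ≤ ‖y‖ → k R y = 0) {M : ℝ}
    (hM : 0 ≤ M) (hb : ∀ R y, R ≤ L → |k R y| ≤ M)
    (hhm : Measurable (Function.uncurry h)) (hh : ∀ R y, R ≤ ‖y‖ → h R y = 0) {M' : ℝ}
    (hM' : 0 ≤ M') (hb' : ∀ R y, R ≤ L → |h R y| ≤ M')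
    (hkh : ∀ R η, IsTest η → ∫ y, η y * k R y = -∫ y, pd j η y * h R y) :
    ∫ S, shot L k S ∂P = 0 := by
  have hη := isTest_mollifier (d := d) 0
  have i1 : Integrable (shot L k) P := Integrable.of_bound
    (measurable_shot L hkm).aestronglyMeasurable M (ae_of_all _ (abs_shot_le hk hM hb))
  have i2 : Integrable (shot L h) P := Integrable.of_bound
    (measurable_shot L hhm).aestronglyMeasurable M' (ae_of_all _ (abs_shot_le hh hM' hb'))
  have e1 := integral_integral_field (P := P) (measurable_shot L hkm).stronglyMeasurable i1
    hη.integrable hη.continuous.measurable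
  have e2 := integral_integral_field (P := P) (measurable_shot L hhm).stronglyMeasurable i2
    (hη.pd j).integrable (hη.pd j).continuous.measurable
  rw [ContDiffBump.integral_normed, one_smul] at e1
  rw [integral_pd hη, zero_smul] at e2
  rw [← e1, ← neg_eq_zero, ← e2, ← integral_neg]
  refine integral_congr_ae (ae_of_all _ fun S => ?_)
  have := integral_mul_field_shot_eq hkm hk hb hhm hh hb' hkh hη S
  simp only [smul_eq_mul]
  exact neg_eq_iff_eq_neg.2 this

end

section

/-! ### The trial field and its flux -/

section Trial

variable (L : ℝ)

theorem locallyIntegrable_field_shot {L : ℝ} {k : ℝ → E d → ℝ}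
    (hkm : Measurable (Function.uncurry k)) (hk : ∀ R y, R ≤ ‖y‖ → k R y = 0) {M : ℝ}
    (hM : 0 ≤ M) (hb : ∀ R y, R ≤ L → |k R y| ≤ M) (S : PointSet d) :
    LocallyIntegrable (field (shot L k) S) := by
  have h1 : Measurable fun y : E d => -y +ᵥ S := measurable_neg_vadd.comp measurable_prodMk_left
  exact locallyIntegrable_of_bdd ((measurable_shot L hkm).comp h1) fun y => abs_shot_le hk hM hb _

theorem measurable_dipoleShot (j k : Fin d) : Measurable (shot L (dipole j k)) :=
  measurable_shot L (measurable_dipole j k)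

theorem abs_dipoleShot_le (j k : Fin d) (S : PointSet d) : |shot L (dipole j k) S| ≤ 1 + d :=
  abs_shot_le (fun _ _ => dipole_of_norm_ge j k) (by positivity)
    (fun R y _ => abs_dipole_le j k R y) S

theorem integrable_mul_field_dipoleShot {η : E d → ℝ} (hη : IsTest η) (j k : Fin d)
    (S : PointSet d) : Integrable fun y => η y * field (shot L (dipole j k)) S y :=
  hη.integrable_mul (locallyIntegrable_field_shot (measurable_dipole j k)
    (fun _ _ => dipole_of_norm_ge j k) (by positivity : (0 : ℝ) ≤ 1 + d)
    (fun R y _ => abs_dipole_le j k R y) S)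

variable {L} in
theorem integral_mul_field_dipoleShot (hL : 0 ≤ L) {η : E d → ℝ} (hη : IsTest η) (j k : Fin d)
    (S : PointSet d) :
    ∫ y, η y * field (shot L (dipole j k)) S y =
      -∫ y, pd j η y * field (shot L (dipolePotential k)) S y :=
  integral_mul_field_shot_eq (measurable_dipole j k) (fun _ _ => dipole_of_norm_ge j k)
    (fun R y _ => abs_dipole_le j k R y) (measurable_dipolePotential k)
    (fun _ _ => dipolePotential_of_norm_ge k) (fun _ y hR => abs_dipolePotential_le k hL hR y)
    (fun R _ hη => integral_mul_dipole j k R hη) hη S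

/-- The dipole profile multiplied by `weight`. -/
def weightedDipole (j k : Fin d) (R : ℝ) (y : E d) : ℝ := weight d R * dipole j k R y

theorem measurable_weightedDipole (j k : Fin d) : Measurable (Function.uncurry (weightedDipole j
    k)) :=
  (measurable_weight.comp measurable_fst).mul (measurable_dipole j k)

theorem weightedDipole_of_norm_ge (j k : Fin d) {R : ℝ} {y : E d} (h : R ≤ ‖y‖) :
    weightedDipole j k R y = 0 := by
  rw [weightedDipole, dipole_of_norm_ge j k h, mul_zero]

theorem abs_weightedDipole_le (j k : Fin d) (R : ℝ) (y : E d) :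
    |weightedDipole j k R y| ≤ 1 + d := by
  rw [weightedDipole, abs_mul, abs_of_nonneg (weight_nonneg R)]
  exact (mul_le_of_le_one_left (abs_nonneg _) (weight_le_one R)).trans (abs_dipole_le j k R y)

theorem measurable_weightedDipoleShot (j k : Fin d) : Measurable (shot L (weightedDipole j k)) :=
  measurable_shot L (measurable_weightedDipole j k)

theorem abs_weightedDipoleShot_le (j k : Fin d) (S : PointSet d) :
    |shot L (weightedDipole j k) S| ≤ 1 + d :=
  abs_shot_le (fun _ _ => weightedDipole_of_norm_ge j k) (by positivity)
    (fun R y _ => abs_weightedDipole_le j k R y) S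

/-- The trial gradient with constant `c₀` in the direction `e`. -/
def trial (c₀ : ℝ) (e : E d) (S : PointSet d) : E d :=
  WithLp.toLp 2 fun i => c₀ * ∑ k, e k * shot L (dipole i k) S

/-- The fluctuation of the trial flux. -/
def trialFlux (c₀ : ℝ) (e : E d) (S : PointSet d) : E d :=
  WithLp.toLp 2 fun i => c₀ * ∑ k, (e k * shot L (dipole k i) S - e i * shot L (dipole k k) S)

theorem memLp_of_coord_bdd {P : Measure (PointSet d)} [IsProbabilityMeasure P]
    {f : Fin d → PointSet d → ℝ} (hf : ∀ i, Measurable (f i)) {M : ℝ}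
    (hM : ∀ i S, |f i S| ≤ M) : MemLp (fun S => (WithLp.toLp 2 fun i => f i S : E d)) 2 P :=
  memLp_toLp fun i => MemLp.of_bound (hf i).aestronglyMeasurable M (ae_of_all _ (hM i))

theorem integral_toLp_eq_zero {P : Measure (PointSet d)} {f : Fin d → PointSet d → ℝ}
    (hi : Integrable (fun S => (WithLp.toLp 2 fun i => f i S : E d)) P)
    (h : ∀ i, ∫ S, f i S ∂P = 0) : ∫ S, (WithLp.toLp 2 fun i => f i S : E d) ∂P = 0 := by
  refine PiLp.ext fun i => ?_
  have := (EuclideanSpace.proj (ι := Fin d) (𝕜 := ℝ) i).integral_comp_comm hi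
  exact this.symm.trans (h i)

theorem abs_coord_mul_le {e : E d} (i : Fin d) {t M : ℝ} (ht : |t| ≤ M) :
    |e i * t| ≤ ‖e‖ * M := by
  rw [abs_mul]
  gcongr
  exact abs_coord_le_norm e i

section

variable {P : Measure (PointSet d)} [IsProbabilityMeasure P]

theorem memLp_trial (c₀ : ℝ) (e : E d) : MemLp (trial L c₀ e) 2 P := by
  refine memLp_of_coord_bdd (M := |c₀| * ∑ k : Fin d, ‖e‖ * (1 + d)) (fun i => ?_) fun i S => ?_
  · exact (Finset.measurable_sum _ fun k _ => (measurable_dipoleShot L i k).const_mul _).const_mul _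
  · rw [abs_mul]
    gcongr
    refine (Finset.abs_sum_le_sum_abs _ _).trans (Finset.sum_le_sum fun k _ => ?_)
    exact abs_coord_mul_le k (abs_dipoleShot_le L i k S)

theorem memLp_trialFlux (c₀ : ℝ) (e : E d) : MemLp (trialFlux L c₀ e) 2 P := by
  refine memLp_of_coord_bdd (M := |c₀| * ∑ k : Fin d, (‖e‖ * (1 + d) + ‖e‖ * (1 + d)))
    (fun i => ?_) fun i S => ?_
  · exact (Finset.measurable_sum _ fun k _ => ((measurable_dipoleShot L k i).const_mul _).sub
      ((measurable_dipoleShot L k k).const_mul _)).const_mul _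
  · rw [abs_mul]
    gcongr
    refine (Finset.abs_sum_le_sum_abs _ _).trans (Finset.sum_le_sum fun k _ => ?_)
    exact (abs_sub _ _).trans (add_le_add (abs_coord_mul_le k (abs_dipoleShot_le L k i S))
      (abs_coord_mul_le i (abs_dipoleShot_le L k k S)))

theorem integrable_dipoleShot (j k : Fin d) : Integrable (shot L (dipole j k)) P :=
  Integrable.of_bound (measurable_dipoleShot L j k).aestronglyMeasurable (1 + d)
    (ae_of_all _ (abs_dipoleShot_le L j k))

theorem integrable_weightedDipoleShot (j k : Fin d) :
    Integrable (shot L (weightedDipole j k)) P :=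
  Integrable.of_bound (measurable_weightedDipoleShot L j k).aestronglyMeasurable (1 + d)
    (ae_of_all _ (abs_weightedDipoleShot_le L j k))

end

variable {L}

/-- The trial field is the gradient of `c₀ e · p`, where `p` superposes the vector potentials, so
its curl vanishes by commuting derivatives. -/
theorem curlFree_trial (hL : 0 ≤ L) (P : Measure (PointSet d)) (c₀ : ℝ) (e : E d) :
    CurlFree P (trial L c₀ e) := by
  intro η hη i j
  refine ae_of_all _ fun S => ?_
  have h : ∀ i j, ∫ x, pd i η x * field (trial L c₀ e) S x j =
      c₀ * ∑ k, e k * -∫ y, pd j (pd i η) y * field (shot L (dipolePotential k)) S y := by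
    intro i j
    have h1 : ∀ x, pd i η x * field (trial L c₀ e) S x j =
        c₀ * ∑ k, e k * (pd i η x * field (shot L (dipole j k)) S x) := by
      intro x
      simp only [field, trial, Finset.mul_sum]
      exact Finset.sum_congr rfl fun k _ => by ring
    simp only [h1]
    rw [integral_const_mul, integral_finsetSum]
    · congr 1
      refine Finset.sum_congr rfl fun k _ => ?_
      rw [integral_const_mul, integral_mul_field_dipoleShot hL (hη.pd i)]
    · exact fun k _ => (integrable_mul_field_dipoleShot L (hη.pd i) j k S).const_mul _
  rw [h, h, pd_comm hη]

/-- The field has components `c₀ Σ_k ∂_k (e_k p_i - e_i p_k)` with `p` the superposed vector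
potential. It is the divergence of a skew tensor, hence divergence-free. -/
theorem divFree_trialFlux (hL : 0 ≤ L) (P : Measure (PointSet d)) (c₀ : ℝ) (e : E d) :
    DivFree P (trialFlux L c₀ e) := by
  intro η hη
  refine ae_of_all _ fun S => ?_
  set J : Fin d → Fin d → Fin d → ℝ := fun i k l =>
    ∫ y, pd k (pd i η) y * field (shot L (dipolePotential l)) S y with hJ
  have h : ∀ i, ∫ x, pd i η x * field (trialFlux L c₀ e) S x i =
      c₀ * ∑ k, (e k * -J i k i - e i * -J i k k) := by
    intro i
    have h1 : ∀ x, pd i η x * field (trialFlux L c₀ e) S x i =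
        c₀ * ∑ k, (e k * (pd i η x * field (shot L (dipole k i)) S x) -
          e i * (pd i η x * field (shot L (dipole k k)) S x)) := by
      intro x
      simp only [field, trialFlux, Finset.mul_sum]
      exact Finset.sum_congr rfl fun k _ => by ring
    have hi := fun j k => integrable_mul_field_dipoleShot L (hη.pd i) j k S
    simp only [h1]
    rw [integral_const_mul, integral_finsetSum]
    · congr 1
      refine Finset.sum_congr rfl fun k _ => ?_
      rw [integral_sub ((hi k i).const_mul _) ((hi k k).const_mul _), integral_const_mul,
        integral_const_mul, integral_mul_field_dipoleShot hL (hη.pd i),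
        integral_mul_field_dipoleShot hL (hη.pd i)]
    · exact fun k _ => ((hi k i).const_mul _).sub ((hi k k).const_mul _)
  simp only [h]
  rw [← Finset.mul_sum]
  simp only [Finset.sum_sub_distrib]
  have hsymm : ∀ i k l, J i k l = J k i l := fun i k l => by simp only [hJ, pd_comm hη]
  refine mul_eq_zero_of_right _ (sub_eq_zero.2 ?_)
  rw [Finset.sum_comm]
  exact Finset.sum_congr rfl fun i _ => Finset.sum_congr rfl fun k _ => by rw [hsymm]

variable {P : Measure (PointSet d)} [IsProbabilityMeasure P]
  [VAddInvariantMeasure (E d) (PointSet d) P]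

theorem integral_dipoleShot (hL : 0 ≤ L) (j k : Fin d) : ∫ S, shot L (dipole j k) S ∂P = 0 :=
  integral_shot_eq_zero (measurable_dipole j k) (fun _ _ => dipole_of_norm_ge j k)
    (by positivity) (fun R y _ => abs_dipole_le j k R y) (measurable_dipolePotential k)
    (fun _ _ => dipolePotential_of_norm_ge k) hL
    (fun _ y hR => abs_dipolePotential_le k hL hR y)
    (fun R _ hη => integral_mul_dipole j k R hη)

/-- The weight depends on the radius alone and is constant on each ball, so the weighted profile is
still a derivative. This mean-zero quantity removes the terms that are quadratic in the tail. -/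
theorem integral_weightedDipoleShot (hL : 0 ≤ L) (j k : Fin d) :
    ∫ S, shot L (weightedDipole j k) S ∂P = 0 := by
  refine integral_shot_eq_zero (measurable_weightedDipole j k)
    (fun _ _ => weightedDipole_of_norm_ge j k) (by positivity)
    (fun R y _ => abs_weightedDipole_le j k R y)
    (h := fun R y => weight d R * dipolePotential k R y) (j := j)
    ((measurable_weight.comp measurable_fst).mul (measurable_dipolePotential k))
    (fun R y h => by simp only [dipolePotential_of_norm_ge k h, mul_zero]) hL
    (fun R y hR => ?_) fun R η hη => ?_
  · rw [abs_mul, abs_of_nonneg (weight_nonneg R)]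
    exact (mul_le_of_le_one_left (abs_nonneg _) (weight_le_one R)).trans
      (abs_dipolePotential_le k hL hR y)
  · simp only [weightedDipole, mul_left_comm _ (weight d R)]
    rw [integral_const_mul, integral_const_mul, integral_mul_dipole j k R hη, mul_neg]

theorem integral_trial (hL : 0 ≤ L) (c₀ : ℝ) (e : E d) : ∫ S, trial L c₀ e S ∂P = 0 := by
  refine integral_toLp_eq_zero ((memLp_trial L c₀ e).integrable (by norm_num)) fun i => ?_
  rw [integral_const_mul, integral_finsetSum _ fun k _ => (integrable_dipoleShot L i k).const_mul _]
  simp [integral_const_mul, integral_dipoleShot hL]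

theorem integral_trialFlux (hL : 0 ≤ L) (c₀ : ℝ) (e : E d) :
    ∫ S, trialFlux L c₀ e S ∂P = 0 := by
  refine integral_toLp_eq_zero ((memLp_trialFlux L c₀ e).integrable (by norm_num)) fun i => ?_
  have h := fun j k (c : ℝ) => (integrable_dipoleShot (P := P) L j k).const_mul c
  rw [integral_const_mul]
  refine mul_eq_zero_of_right _ ?_
  rw [integral_finsetSum]
  swap
  · exact fun k _ => (h k i _).sub (h k k _)
  refine Finset.sum_eq_zero fun k _ => ?_
  rw [integral_sub (h k i _) (h k k _)]
  simp [integral_const_mul, integral_dipoleShot hL]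

end Trial

end

section

/-! ### The error of the dilute approximation -/

/-- The sum of the weights of the points in the unit ball. -/
def overlap (L : ℝ) (S : PointSet d) : ℝ≥0∞ :=
  ∫⁻ x, ENNReal.ofReal (weight d (isolationRadius L (-x +ᵥ S))) *
    (ball (0 : E d) 1).indicator 1 x ∂S.counting

theorem measurable_ofReal_weight (L : ℝ) :
    Measurable fun S : PointSet d => ENNReal.ofReal (weight d (isolationRadius L S)) :=
  (measurable_weight.comp (measurable_isolationRadius L)).ennreal_ofReal

theorem measurable_overlap (L : ℝ) : Measurable (overlap L : PointSet d → ℝ≥0∞) :=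
  PointSet.measurable_lintegral_counting (((measurable_ofReal_weight L).comp
    measurable_neg_vadd).mul ((measurable_one.indicator measurableSet_ball).comp measurable_snd))

theorem lintegral_overlap (P : Measure (PointSet d)) [SFinite P]
    [VAddInvariantMeasure (E d) (PointSet d) P] (L : ℝ) :
    ∫⁻ S, overlap L S ∂P =
      intensity P (fun S => ENNReal.ofReal (weight d (isolationRadius L S))) *
        volume (ball (0 : E d) 1) := by
  unfold overlap
  rw [lintegral_counting_eq_intensity_mul (measurable_ofReal_weight L)
    (measurable_one.indicator measurableSet_ball), lintegral_indicator_one measurableSet_ball]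

theorem overlap_lt_top (L : ℝ) (S : PointSet d) : overlap L S < ⊤ := by
  refine lt_of_le_of_lt ?_ (S.counting_lt_top (measurableSet_ball (x := (0 : E d)) (ε := 1))
      isBounded_ball)
  rw [← lintegral_indicator_one measurableSet_ball]
  refine lintegral_mono fun x => ?_
  refine mul_le_of_le_one_left' ?_
  simpa using weight_le_one _

theorem weight_le_overlap (L : ℝ) {S : PointSet d} {x : E d} (hx : x ∈ S.carrier) (h : ‖x‖ < 1) :
    weight d (isolationRadius L (-x +ᵥ S)) ≤ (overlap L S).toReal := by
  refine (ENNReal.ofReal_le_iff_le_toReal (overlap_lt_top L S).ne).1 ?_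
  rw [overlap, S.lintegral_counting]
  refine le_trans ?_ (ENNReal.le_tsum (⟨x, hx⟩ : S.carrier))
  simp [h]

/-- At the origin the superposed fields are those of a single point with weight `θ`. -/
theorem exists_weight (L : ℝ) (S : PointSet d) :
    ∃ θ : ℝ, 0 ≤ θ ∧ θ ≤ 1 ∧
      (∀ j k, shot L (weightedDipole j k) S = θ * shot L (dipole j k) S) ∧
      ((conductivity 0 1 S = 1 ∧ (∀ j k, shot L (dipole j k) S = if j = k then 1 - θ else 0) ∧
        θ ≤ (overlap L S).toReal) ∨
      (conductivity 0 1 S = 0 ∧ ∑ k, shot L (dipole k k) S = -(d * θ))) := by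
  have hz : ∀ j k R (y : E d), R ≤ ‖y‖ → dipole j k R y = 0 := fun j k _ _ => dipole_of_norm_ge j k
  have hz' : ∀ j k R (y : E d), R ≤ ‖y‖ → weightedDipole j k R y = 0 :=
    fun j k _ _ => weightedDipole_of_norm_ge j k
  by_cases h : ∃ x ∈ S.carrier, ‖x‖ < isolationRadius L (-x +ᵥ S) ∧
      1 < isolationRadius L (-x +ᵥ S)
  · obtain ⟨x, hx, h1, h2⟩ := h
    set R := isolationRadius L (-x +ᵥ S)
    have hs : ∀ j k, shot L (dipole j k) S = dipole j k R (-x) := fun j k =>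
      shot_eq_of_mem (hz j k) hx h1
    refine ⟨weight d R, weight_nonneg R, weight_le_one R, fun j k => ?_, ?_⟩
    · rw [shot_eq_of_mem (hz' j k) hx h1, hs]; rfl
    by_cases hin : ‖x‖ < 1
    · refine Or.inl ⟨?_, fun j k => ?_, weight_le_overlap L hx hin⟩
      · have : (0 : E d) ∈ S.inclusions := PointSet.mem_inclusions_iff.2 ⟨x, hx, by simpa using hin⟩
        simp [conductivity, this]
      · rw [hs, dipole_of_norm_lt_one _ _ (by simpa using hin)]
    · refine Or.inr ⟨?_, ?_⟩
      · have : (0 : E d) ∉ S.inclusions := by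
          rw [PointSet.mem_inclusions_iff]
          rintro ⟨x', hx', h3⟩
          have h4 : ‖x'‖ < 1 := by simpa using h3
          have hne : x ≠ x' := fun h => hin (h ▸ h4)
          -- A second point within distance one of the origin would give `2R ≤ ‖x' - x‖ < 1 + R`,
          -- against `R > 1`.
          have h5 := isolationRadius_neg_vadd_le L hx' hne
          have h6 := norm_sub_le x' x
          change R ≤ _ at h5
          linarith
        simp [conductivity, this]
      · simp only [hs]
        rw [sum_dipole (by simpa using h1) h2, norm_neg, if_neg hin]
        ring
  · push Not at h
    have hs : ∀ j k, shot L (dipole j k) S = 0 ∧ shot L (weightedDipole j k) S = 0 := by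
      intro j k
      by_cases h' : ∃ x ∈ S.carrier, ‖x‖ < isolationRadius L (-x +ᵥ S)
      · obtain ⟨x, hx, h1⟩ := h'
        rw [shot_eq_of_mem (hz j k) hx h1, shot_eq_of_mem (hz' j k) hx h1, weightedDipole,
          dipole_of_le_one j k (h x hx h1)]
        simp
      · push Not at h'
        exact ⟨shot_eq_zero (hz j k) h', shot_eq_zero (hz' j k) h'⟩
    by_cases hin : (0 : E d) ∈ S.inclusions
    -- Here every point within distance one of the origin has radius at most one; its profile is
    -- zero and its weight is one, so `θ = 1`.
    · refine ⟨1, zero_le_one, le_rfl, fun j k => by simp [hs], Or.inl ⟨by simp [conductivity, hin],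
        fun j k => by simp [hs], ?_⟩⟩
      obtain ⟨x, hx, h1⟩ := PointSet.mem_inclusions_iff.1 hin
      replace h1 : ‖x‖ < 1 := by simpa using h1
      have h2 : isolationRadius L (-x +ᵥ S) ≤ 1 := by
        by_contra h3
        exact h3 (h x hx (by linarith [not_le.1 h3]))
      have h3 := weight_le_overlap L hx h1
      rwa [weight, max_eq_right h2, one_pow, inv_one] at h3
    · exact ⟨0, le_rfl, zero_le_one, fun j k => by simp [hs],
        Or.inr ⟨by simp [conductivity, hin], by simp [hs]⟩⟩

/-- The scalar residuum of the trial field. -/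
def residual (α β c₀ L : ℝ) (S : PointSet d) : ℝ :=
  (β - α) * conductivity 0 1 S * (1 + c₀ * (∑ k, shot L (dipole k k) S) / d) +
    α * c₀ * ∑ k, shot L (dipole k k) S

theorem conductivity_eq (α β : ℝ) (S : PointSet d) :
    conductivity α β S = α + (β - α) * conductivity 0 1 S := by
  unfold conductivity
  split_ifs <;> ring

theorem measurable_residual (α β c₀ L : ℝ) :
    Measurable (residual α β c₀ L : PointSet d → ℝ) := by
  have h : Measurable fun S : PointSet d => ∑ k, shot L (dipole k k) S :=
    Finset.measurable_sum _ fun k _ => measurable_dipoleShot L k k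
  have h' := measurable_conductivity (d := d) 0 1
  unfold residual
  fun_prop

section Residual

variable {α β c₀ c : ℝ}

/-- The equation for `c₀` is `(β - α) (1 + c₀) + α c₀ d = 0`, the balance of a single ball in
infinite space. So inside an inclusion the residual only sees the cutoff, through `θ`; outside it is
the background charge times `α c₀`. -/
theorem residual_cases (hd : d ≠ 0) (hc₀ : c₀ * (β + α * (d - 1)) = α - β)
    (hc : c = -(c₀ * α * d)) (L : ℝ) (S : PointSet d) :
    ∃ θ : ℝ, 0 ≤ θ ∧ θ ≤ 1 ∧
      (∀ j k, shot L (weightedDipole j k) S = θ * shot L (dipole j k) S) ∧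
      ((conductivity 0 1 S = 1 ∧ (∀ j k, shot L (dipole j k) S = if j = k then 1 - θ else 0) ∧
        θ ≤ (overlap L S).toReal ∧ residual α β c₀ L S = (β - α) * θ) ∨
      (conductivity 0 1 S = 0 ∧ ∑ k, shot L (dipole k k) S = -(d * θ) ∧
        residual α β c₀ L S = c * θ)) := by
  have hd' : (d : ℝ) ≠ 0 := Nat.cast_ne_zero.2 hd
  obtain ⟨θ, h0, h1, hw, h | h⟩ := exists_weight L S
  · refine ⟨θ, h0, h1, hw, Or.inl ⟨h.1, h.2.1, h.2.2, ?_⟩⟩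
    rw [residual, h.1]
    simp only [h.2.1, if_true, Finset.sum_const, Finset.card_univ, Fintype.card_fin, nsmul_eq_mul]
    field_simp
    linear_combination (1 - θ) * hc₀
  · refine ⟨θ, h0, h1, hw, Or.inr ⟨h.1, h.2, ?_⟩⟩
    rw [residual, h.1, h.2, hc]
    ring

/-- Where the conductivity is `α`, the trial gradient differs from a divergence-free field only by
its trace times `e`. Inside an inclusion the trial gradient is itself a multiple of `e`. In both
cases the defect is parallel to `e`, which is why a scalar residual suffices. -/
theorem smul_trial_eq (hd : d ≠ 0) (hc₀ : c₀ * (β + α * (d - 1)) = α - β) (L : ℝ) (e : E d)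
    (S : PointSet d) :
    conductivity α β S • (e + trial L c₀ e S) =
      α • e + trialFlux L (α * c₀) e S + residual α β c₀ L S • e := by
  have hd' : (d : ℝ) ≠ 0 := Nat.cast_ne_zero.2 hd
  refine PiLp.ext fun i => ?_
  simp only [PiLp.add_apply, PiLp.smul_apply, smul_eq_mul, trial, trialFlux,
    Finset.sum_sub_distrib, ← Finset.mul_sum, conductivity_eq α β, dipole_comm _ i]
  obtain ⟨θ, -, -, -, h | h⟩ := residual_cases hd hc₀ rfl L S
  · rw [h.1, h.2.2.2]
    simp only [h.2.1, mul_ite, mul_zero, Finset.sum_ite_eq, Finset.mem_univ, if_true,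
      Finset.sum_const, Finset.card_univ, Fintype.card_fin, nsmul_eq_mul]
    linear_combination (1 - θ) * e i * hc₀
  · rw [h.1, h.2.2, h.2.1]
    ring

theorem abs_residual_le (hd : d ≠ 0) (hc₀ : c₀ * (β + α * (d - 1)) = α - β)
    (hc : c = -(c₀ * α * d)) (L : ℝ) (S : PointSet d) :
    |residual α β c₀ L S| ≤ |β - α| + |c| := by
  obtain ⟨θ, h0, h1, -, h | h⟩ := residual_cases hd hc₀ hc L S
  · rw [h.2.2.2, abs_mul, abs_of_nonneg h0]
    nlinarith [abs_nonneg (β - α), abs_nonneg c]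
  · rw [h.2.2, abs_mul, abs_of_nonneg h0]
    nlinarith [abs_nonneg (β - α), abs_nonneg c]

/-- Outside the inclusions the residual is exactly `-c/d` times the trace, which has mean zero. Only
the inclusions contribute an error, and there `θ ≤ overlap`. -/
theorem abs_residual_sub_le (hd : d ≠ 0) (hc₀ : c₀ * (β + α * (d - 1)) = α - β)
    (hc : c = -(c₀ * α * d)) (L : ℝ) (S : PointSet d) :
    |residual α β c₀ L S - c * conductivity 0 1 S + c / d * ∑ k, shot L (dipole k k) S| ≤
      |β - α - c| * (overlap L S).toReal := by
  have hd' : (d : ℝ) ≠ 0 := Nat.cast_ne_zero.2 hd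
  obtain ⟨θ, h0, h1, -, h | h⟩ := residual_cases hd hc₀ hc L S
  · rw [h.2.2.2, h.1]
    simp only [h.2.1, if_true, Finset.sum_const, Finset.card_univ, Fintype.card_fin, nsmul_eq_mul]
    have : (β - α) * θ - c * 1 + c / d * (d * (1 - θ)) = (β - α - c) * θ := by
      field_simp; ring
    rw [this, abs_mul, abs_of_nonneg h0]
    exact mul_le_mul_of_nonneg_left h.2.2.1 (abs_nonneg _)
  · rw [h.2.2, h.1, h.2.1]
    have : c * θ - c * 0 + c / d * -(d * θ) = 0 := by field_simp; ring
    rw [this, abs_zero]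
    positivity

/-- Outside the inclusions the square `c² θ²` is exactly `-c²/d` times the weighted trace, which has
mean zero. The tail is thus integrated without computing any volume. -/
theorem sq_residual_le (hd : d ≠ 0) (hc₀ : c₀ * (β + α * (d - 1)) = α - β)
    (hc : c = -(c₀ * α * d)) (L : ℝ) (S : PointSet d) :
    residual α β c₀ L S ^ 2 ≤ ((β - α) ^ 2 + c ^ 2) * (overlap L S).toReal -
      c ^ 2 / d * ∑ k, shot L (weightedDipole k k) S := by
  have hd' : (d : ℝ) ≠ 0 := Nat.cast_ne_zero.2 hd
  obtain ⟨θ, h0, h1, hw, h | h⟩ := residual_cases hd hc₀ hc L S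
  · rw [h.2.2.2]
    simp only [hw, h.2.1, if_true, Finset.sum_const, Finset.card_univ, Fintype.card_fin,
      nsmul_eq_mul]
    have : c ^ 2 / d * (d * (θ * (1 - θ))) = c ^ 2 * (θ * (1 - θ)) := by field_simp
    rw [this]
    have h2 : ((β - α) ^ 2 + c ^ 2) * θ ≤ ((β - α) ^ 2 + c ^ 2) * (overlap L S).toReal :=
      mul_le_mul_of_nonneg_left h.2.2.1 (by positivity)
    have h3 : 0 ≤ (β - α) ^ 2 * (θ * (1 - θ)) :=
      mul_nonneg (sq_nonneg _) (mul_nonneg h0 (by linarith))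
    have h4 : 0 ≤ c ^ 2 * θ ^ 2 := by positivity
    nlinarith
  · rw [h.2.2]
    simp only [hw, ← Finset.mul_sum, h.2.1]
    have : c ^ 2 / d * (θ * -(d * θ)) = -(c * θ) ^ 2 := by field_simp
    rw [this]
    have : 0 ≤ ((β - α) ^ 2 + c ^ 2) * (overlap L S).toReal := by positivity
    linarith

/-- The same cancellation: outside the inclusions the product is `c` times the weighted dipole. -/
theorem abs_residual_mul_dipole_le (hd : d ≠ 0) (hc₀ : c₀ * (β + α * (d - 1)) = α - β)
    (hc : c = -(c₀ * α * d)) (L : ℝ) (S : PointSet d) (j k : Fin d) :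
    |residual α β c₀ L S * shot L (dipole j k) S - c * shot L (weightedDipole j k) S| ≤
      |β - α - c| * (overlap L S).toReal := by
  obtain ⟨θ, h0, h1, hw, h | h⟩ := residual_cases hd hc₀ hc L S
  · rw [h.2.2.2, hw, h.2.1]
    have h2 : |β - α - c| * θ ≤ |β - α - c| * (overlap L S).toReal :=
      mul_le_mul_of_nonneg_left h.2.2.1 (abs_nonneg _)
    refine le_trans ?_ h2
    have h3 : |θ * (if j = k then 1 - θ else 0)| ≤ θ := by
      split_ifs
      · rw [abs_of_nonneg (mul_nonneg h0 (by linarith))]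
        nlinarith
      · simpa using h0
    rw [show (β - α) * θ * (if j = k then 1 - θ else 0) - c * (θ * if j = k then 1 - θ else 0) =
      (β - α - c) * (θ * if j = k then 1 - θ else 0) by ring, abs_mul]
    exact mul_le_mul_of_nonneg_left h3 (abs_nonneg _)
  · rw [h.2.2, hw]
    rw [show c * θ * shot L (dipole j k) S - c * (θ * shot L (dipole j k) S) = 0 by ring, abs_zero]
    positivity

end Residual

end

/-! ### Expectations of the residual and comparison of the corrector with the trial field -/

section

section Estimate

theorem integral_conductivity (P : Measure (PointSet d)) :
    ∫ S, conductivity 0 1 S ∂P = volumeFraction P := by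
  rw [volumeFraction, ← integral_indicator_one measurableSet_zero_mem_inclusions]
  refine integral_congr_ae (ae_of_all _ fun S => ?_)
  by_cases h : (0 : E d) ∈ S.inclusions <;> simp [conductivity, indicator, h]

theorem abs_integral_le_of_abs_le {P : Measure (PointSet d)} {f g : PointSet d → ℝ} (hg :
    Integrable g P)
    (h : ∀ S, |f S| ≤ g S) : |∫ S, f S ∂P| ≤ ∫ S, g S ∂P := by
  rw [← Real.norm_eq_abs]
  exact norm_integral_le_of_norm_le hg (ae_of_all _ h)

variable {P : Measure (PointSet d)} [IsProbabilityMeasure P] {α β c₀ c L : ℝ}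

theorem integrable_of_abs_le {f : PointSet d → ℝ} (hf : Measurable f) {M : ℝ}
    (hM : ∀ S, |f S| ≤ M) : Integrable f P :=
  Integrable.of_bound hf.aestronglyMeasurable M (ae_of_all _ hM)

theorem integrable_residual (hd : d ≠ 0) (hc₀ : c₀ * (β + α * (d - 1)) = α - β) :
    Integrable (residual α β c₀ L) P :=
  integrable_of_abs_le (measurable_residual α β c₀ L) (abs_residual_le hd hc₀ rfl L)

theorem integrable_sq_residual (hd : d ≠ 0) (hc₀ : c₀ * (β + α * (d - 1)) = α - β) :
    Integrable (fun S => residual α β c₀ L S ^ 2) P := by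
  refine integrable_of_abs_le ((measurable_residual α β c₀ L).pow_const 2)
    (M := (|β - α| + |-(c₀ * α * d)|) ^ 2) fun S => ?_
  rw [abs_pow]
  gcongr
  exact abs_residual_le hd hc₀ rfl L S

theorem integrable_conductivity : Integrable (conductivity (d := d) 0 1) P :=
  integrable_of_abs_le (measurable_conductivity 0 1) (abs_conductivity_le 0 1)

theorem memLp_trialFlux_add (e : E d) : MemLp (fun S => α • e + trialFlux L c₀ e S) 2 P :=
  (memLp_const (α • e)).add (memLp_trialFlux L c₀ e)

theorem integrable_residual_mul_inner (hd : d ≠ 0) (hc₀ : c₀ * (β + α * (d - 1)) = α - β)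
    {X : PointSet d → E d} (hX : MemLp X 2 P) (v : E d) :
    Integrable (fun S => residual α β c₀ L S * inner ℝ (X S) v) P := by
  have i1 : Integrable (fun S => inner ℝ (X S) v) P := (hX.integrable (by norm_num)).inner_const _
  exact i1.bdd_mul (measurable_residual α β c₀ L).aestronglyMeasurable
    (ae_of_all _ (abs_residual_le hd hc₀ rfl L))

variable [VAddInvariantMeasure (E d) (PointSet d) P]

theorem abs_integral_residual_sub_le (hd : d ≠ 0) (hc₀ : c₀ * (β + α * (d - 1)) = α - β)
    (hc : c = -(c₀ * α * d)) (hL : 0 ≤ L)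
    (hσ : Integrable (fun S => (overlap L S).toReal) P) :
    |(∫ S, residual α β c₀ L S ∂P) - c * volumeFraction P| ≤
      |β - α - c| * ∫ S, (overlap L S).toReal ∂P := by
  have h := abs_integral_le_of_abs_le (P := P) (hσ.const_mul _) (abs_residual_sub_le hd hc₀ hc L)
  have i1 : Integrable (residual α β c₀ L) P := integrable_residual hd hc₀
  have i2 : Integrable (fun S => c * conductivity (d := d) 0 1 S) P :=
    integrable_conductivity.const_mul c
  have i3 : Integrable (fun S => ∑ k, shot L (dipole (d := d) k k) S) P :=
    integrable_finsetSum _ fun k _ => integrable_dipoleShot L k k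
  have i12 : Integrable (fun S => residual α β c₀ L S - c * conductivity (d := d) 0 1 S) P :=
    i1.sub i2
  rw [integral_const_mul, integral_add i12 (i3.const_mul _), integral_sub i1 i2,
    integral_const_mul, integral_const_mul, integral_conductivity,
    integral_finsetSum _ fun k _ => integrable_dipoleShot L k k] at h
  simpa [integral_dipoleShot hL] using h

theorem integral_sq_residual_le (hd : d ≠ 0) (hc₀ : c₀ * (β + α * (d - 1)) = α - β)
    (hc : c = -(c₀ * α * d)) (hL : 0 ≤ L)
    (hσ : Integrable (fun S => (overlap L S).toReal) P) :
    ∫ S, residual α β c₀ L S ^ 2 ∂P ≤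
      ((β - α) ^ 2 + c ^ 2) * ∫ S, (overlap L S).toReal ∂P := by
  have i3 : Integrable (fun S => ∑ k, shot L (weightedDipole (d := d) k k) S) P :=
    integrable_finsetSum _ fun k _ => integrable_weightedDipoleShot L k k
  have i4 : Integrable (fun S => ((β - α) ^ 2 + c ^ 2) * (overlap L S).toReal -
      c ^ 2 / d * ∑ k, shot L (weightedDipole (d := d) k k) S) P :=
    (hσ.const_mul _).sub (i3.const_mul _)
  have h := integral_mono (μ := P) (integrable_sq_residual hd hc₀) i4 (sq_residual_le hd hc₀ hc L)
  rw [integral_sub (hσ.const_mul _) (i3.const_mul _), integral_const_mul, integral_const_mul,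
    integral_finsetSum _ fun k _ => integrable_weightedDipoleShot L k k] at h
  simpa [integral_weightedDipoleShot hL] using h

theorem abs_integral_residual_mul_dipole_le (hd : d ≠ 0)
    (hc₀ : c₀ * (β + α * (d - 1)) = α - β) (hc : c = -(c₀ * α * d)) (hL : 0 ≤ L)
    (hσ : Integrable (fun S => (overlap L S).toReal) P) (j k : Fin d) :
    |∫ S, residual α β c₀ L S * shot L (dipole j k) S ∂P| ≤
      |β - α - c| * ∫ S, (overlap L S).toReal ∂P := by
  have h := abs_integral_le_of_abs_le (P := P) (hσ.const_mul _)
    fun S => abs_residual_mul_dipole_le hd hc₀ hc L S j k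
  have i1 : Integrable (fun S => residual α β c₀ L S * shot L (dipole j k) S) P :=
    (integrable_residual hd hc₀).mul_bdd (measurable_dipoleShot L j k).aestronglyMeasurable
      (ae_of_all _ (abs_dipoleShot_le L j k))
  rw [integral_const_mul, integral_sub i1 ((integrable_weightedDipoleShot L j k).const_mul c),
    integral_const_mul, integral_weightedDipoleShot hL] at h
  simpa using h

theorem abs_integral_residual_mul_trial_le (hd : d ≠ 0)
    (hc₀ : c₀ * (β + α * (d - 1)) = α - β) (hc : c = -(c₀ * α * d)) (hL : 0 ≤ L)
    (hσ : Integrable (fun S => (overlap L S).toReal) P) (e v : E d) :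
    |∫ S, residual α β c₀ L S * inner ℝ (trial L c₀ e S) v ∂P| ≤
      |c₀| * d ^ 2 * |β - α - c| * (∫ S, (overlap L S).toReal ∂P) * (‖e‖ * ‖v‖) := by
  have i1 : ∀ j k, Integrable (fun S => residual α β c₀ L S * shot L (dipole j k) S) P :=
    fun j k => (integrable_residual hd hc₀).mul_bdd
      (measurable_dipoleShot L j k).aestronglyMeasurable (ae_of_all _ (abs_dipoleShot_le L j k))
  have h1 : ∀ S, residual α β c₀ L S * inner ℝ (trial L c₀ e S) v =
      ∑ i, ∑ k, c₀ * (v i * e k) * (residual α β c₀ L S * shot L (dipole i k) S) := by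
    intro S
    rw [EuclideanSpace.inner_eq_star_dotProduct]
    simp only [dotProduct, trial, star_trivial, Finset.mul_sum, Pi.star_apply]
    exact Finset.sum_congr rfl fun i _ => Finset.sum_congr rfl fun k _ => by ring
  simp only [h1]
  rw [integral_finsetSum _ fun i _ => integrable_finsetSum _ fun k _ => (i1 i k).const_mul _]
  simp only [integral_finsetSum _ fun k _ => (i1 _ k).const_mul _, integral_const_mul]
  set K := |β - α - c| * ∫ S, (overlap L S).toReal ∂P with hK
  have h2 : ∀ i k, |c₀ * (v i * e k) * ∫ S, residual α β c₀ L S * shot L (dipole i k) S ∂P| ≤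
      |c₀| * (‖v‖ * ‖e‖) * K := by
    intro i k
    rw [abs_mul, abs_mul, abs_mul]
    gcongr
    · exact abs_coord_le_norm v i
    · exact abs_coord_le_norm e k
    · exact abs_integral_residual_mul_dipole_le hd hc₀ hc hL hσ i k
  calc _ ≤ ∑ i : Fin d, ∑ k : Fin d, |c₀| * (‖v‖ * ‖e‖) * K :=
        (Finset.abs_sum_le_sum_abs _ _).trans (Finset.sum_le_sum fun i _ =>
          (Finset.abs_sum_le_sum_abs _ _).trans (Finset.sum_le_sum fun k _ => h2 i k))
    _ = _ := by
        simp only [Finset.sum_const, Finset.card_univ, Fintype.card_fin, nsmul_eq_mul, hK]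
        ring

end Estimate

section Effective

variable {P : Measure (PointSet d)} [IsProbabilityMeasure P]
  [ErgodicVAdd (E d) (PointSet d) P] {α β c₀ c L : ℝ} {e : E d}
  {φ : PointSet d → E d → ℝ} {Φ : PointSet d → E d}

theorem IsCorrector.integral_inner_flux
    (h : IsCorrector P (α • ContinuousLinearMap.id ℝ (E d)) (β • ContinuousLinearMap.id ℝ (E d))
      e φ Φ) {X : PointSet d → E d} (hX : MemLp X 2 P) (hc : CurlFree P X)
    (h0 : ∫ S, X S ∂P = 0) :
    ∫ S, inner ℝ (X S) (conductivity α β S • (Φ S + e)) ∂P = 0 := by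
  rw [integral_inner_of_curlFree_of_divFree hX hc (memLp_flux α β h.memLp e) h.divFree, h0,
    inner_zero_left]

theorem integral_inner_trialFlux (hL : 0 ≤ L) {X : PointSet d → E d} (hX : MemLp X 2 P)
    (hc : CurlFree P X) (v : E d) :
    ∫ S, inner ℝ (X S) (α • v + trialFlux L c₀ v S) ∂P = inner ℝ (∫ S, X S ∂P) (α • v) := by
  have i1 : Integrable (fun S => inner ℝ (X S) (α • v)) P :=
    (hX.integrable (by norm_num)).inner_const _
  have i2 := integrable_inner_of_memLp hX (memLp_trialFlux (P := P) L c₀ v)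
  simp only [inner_add_right]
  rw [integral_add i1 i2,
    integral_inner_of_curlFree_of_divFree hX hc (memLp_trialFlux L c₀ v)
      (divFree_trialFlux hL P c₀ v), integral_trialFlux hL, inner_zero_right, add_zero]
  have := integral_inner (𝕜 := ℝ) (hX.integrable (by norm_num)) (α • v)
  simp only [real_inner_comm] at this ⊢
  exact this

/-- The trial gradient in direction `v` is orthogonal to the flux of the corrector, so `v` may be
replaced by `v + trial`. As the conductivity is scalar it moves to the trial side, where
`smul_trial_eq` applies; the divergence-free part of the trial flux then pairs to zero with the
corrector. -/
theorem IsCorrector.inner_integral_flux (hd : d ≠ 0) (hc₀ : c₀ * (β + α * (d - 1)) = α - β)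
    (hL : 0 ≤ L)
    (h : IsCorrector P (α • ContinuousLinearMap.id ℝ (E d)) (β • ContinuousLinearMap.id ℝ (E d))
      e φ Φ) (v : E d) :
    inner ℝ (∫ S, conductivity α β S • (Φ S + e) ∂P) v =
      α * inner ℝ e v + ∫ S, residual α β c₀ L S * inner ℝ (Φ S + e) v ∂P := by
  have hX : MemLp (fun S => Φ S + e) 2 P := h.memLp.add (memLp_const e)
  have hXc : CurlFree P fun S => Φ S + e := by
    have := h.curlFree.sub (curlFree_const (-e)) h.memLp (memLp_const (-e))
    simpa [Pi.sub_def] using this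
  have hX0 : ∫ S, (Φ S + e) ∂P = e := by
    rw [integral_add (h.memLp.integrable (by norm_num)) (integrable_const e), h.mean_zero]
    simp
  have hF := memLp_flux α β h.memLp e
  have h1 := h.integral_inner_flux (memLp_trial L c₀ v) (curlFree_trial hL P c₀ v)
    (integral_trial hL c₀ v)
  have h2 := integral_inner_trialFlux (c₀ := α * c₀) (α := α) hL hX hXc v
  have i1 := integrable_inner_of_memLp (memLp_trial (P := P) L c₀ v) hF
  have i2 := integrable_inner_of_memLp hX (memLp_trialFlux_add (P := P) (α := α) (c₀ := α * c₀)
      (L := L) v)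
  have i3 := integrable_residual_mul_inner (L := L) hd hc₀ hX v
  have i4 : Integrable (fun S => inner ℝ v (conductivity α β S • (Φ S + e))) P :=
    (hF.integrable (by norm_num)).const_inner v
  rw [real_inner_comm, ← integral_inner (hF.integrable (by norm_num)), ← add_zero (∫ S, _ ∂P), ← h1,
    ← integral_add i4 i1]
  rw [hX0, inner_smul_right] at h2
  rw [← h2, ← integral_add i2 i3]
  refine integral_congr_ae (ae_of_all _ fun S => ?_)
  have h3 := smul_trial_eq (α := α) (β := β) hd hc₀ L v S
  simp only
  rw [← inner_add_left, inner_smul_right, ← real_inner_smul_left, h3, real_inner_comm,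
    inner_add_right, inner_smul_right]

/-- The error `Z = Φ - trial` is a potential, so it is orthogonal to both divergence-free fluxes.
Their difference is `a Z + residual • e`, and coercivity bounds `Z` by the residual. -/
theorem IsCorrector.integral_norm_sq_sub_trial_le (hd : d ≠ 0)
    (hc₀ : c₀ * (β + α * (d - 1)) = α - β) (hL : 0 ≤ L) (hα : 0 < α) (hβ : 0 < β)
    (h : IsCorrector P (α • ContinuousLinearMap.id ℝ (E d)) (β • ContinuousLinearMap.id ℝ (E d))
      e φ Φ) :
    min α β ^ 2 * ∫ S, ‖Φ S - trial L c₀ e S‖ ^ 2 ∂P ≤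
      ‖e‖ ^ 2 * ∫ S, residual α β c₀ L S ^ 2 ∂P := by
  set μ := min α β
  have hμ : 0 < μ := lt_min hα hβ
  have hZ : MemLp (Φ - trial L c₀ e) 2 P := h.memLp.sub (memLp_trial L c₀ e)
  have hZc : CurlFree P (Φ - trial L c₀ e) :=
    h.curlFree.sub (curlFree_trial hL P c₀ e) h.memLp (memLp_trial L c₀ e)
  have hZ0 : ∫ S, (Φ - trial L c₀ e) S ∂P = 0 := by
    simp only [Pi.sub_apply]
    rw [integral_sub (h.memLp.integrable (by norm_num))
      ((memLp_trial L c₀ e).integrable (by norm_num)), h.mean_zero, integral_trial hL, sub_zero]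
  have h1 := h.integral_inner_flux hZ hZc hZ0
  have h2 := integral_inner_trialFlux (c₀ := α * c₀) (α := α) hL hZ hZc e
  rw [hZ0, inner_zero_left] at h2
  have hF := memLp_flux α β h.memLp e
  have i1 := integrable_inner_of_memLp hZ hF
  have i2 := integrable_inner_of_memLp hZ
    (memLp_trialFlux_add (P := P) (α := α) (c₀ := α * c₀) (L := L) e)
  have i3 : Integrable (fun S => ‖(Φ - trial L c₀ e) S‖ ^ 2) P := hZ.integrable_norm_pow (by
      norm_num)
  have i4 : Integrable (fun S => residual α β c₀ L S ^ 2) P := integrable_sq_residual hd hc₀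
  -- Coercivity and Young's inequality in one square: the right-hand side exceeds the left by at
  -- least `(μ ‖Z‖ - |m| ‖e‖)²`.
  have key : ∀ S, μ ^ 2 * ‖(Φ - trial L c₀ e) S‖ ^ 2 ≤
      2 * μ * (inner ℝ ((Φ - trial L c₀ e) S) (conductivity α β S • (Φ S + e)) -
        inner ℝ ((Φ - trial L c₀ e) S) (α • e + trialFlux L (α * c₀) e S)) +
      ‖e‖ ^ 2 * residual α β c₀ L S ^ 2 := by
    intro S
    have h3 := smul_trial_eq (α := α) (β := β) hd hc₀ L e S
    set Z := (Φ - trial L c₀ e) S with hZS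
    set m := residual α β c₀ L S
    set a := conductivity α β S
    have ha : μ ≤ a := min_le_conductivity α β S
    have h4 : a • (Φ S + e) = a • Z + (α • e + trialFlux L (α * c₀) e S) + m • e := by
      rw [add_assoc, ← h3, ← smul_add]
      congr 1
      rw [hZS, Pi.sub_apply]
      abel
    rw [h4, inner_add_right, inner_add_right, inner_smul_right, inner_smul_right,
      real_inner_self_eq_norm_sq]
    have h5 : |m * inner ℝ Z e| ≤ |m| * (‖Z‖ * ‖e‖) := by
      rw [abs_mul]
      exact mul_le_mul_of_nonneg_left (abs_real_inner_le_norm Z e) (abs_nonneg m)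
    have h6 := neg_abs_le (m * inner ℝ Z e)
    have h7 : μ * ‖Z‖ ^ 2 ≤ a * ‖Z‖ ^ 2 := by gcongr
    have h8 : 0 ≤ (μ * ‖Z‖ - |m| * ‖e‖) ^ 2 := sq_nonneg _
    have h9 : |m| ^ 2 = m ^ 2 := sq_abs m
    have h10 : μ * (μ * ‖Z‖ ^ 2 - |m| * (‖Z‖ * ‖e‖)) ≤ μ * (a * ‖Z‖ ^ 2 + m * inner ℝ Z e) := by
      gcongr
      linarith
    nlinarith
  have i5 : Integrable (fun S => 2 * μ *
      (inner ℝ ((Φ - trial L c₀ e) S) (conductivity α β S • (Φ S + e)) -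
        inner ℝ ((Φ - trial L c₀ e) S) (α • e + trialFlux L (α * c₀) e S))) P :=
    (i1.sub i2).const_mul (2 * μ)
  have i6 : Integrable (fun S => 2 * μ *
      (inner ℝ ((Φ - trial L c₀ e) S) (conductivity α β S • (Φ S + e)) -
        inner ℝ ((Φ - trial L c₀ e) S) (α • e + trialFlux L (α * c₀) e S)) +
      ‖e‖ ^ 2 * residual α β c₀ L S ^ 2) P := i5.add (i4.const_mul _)
  have h5 := integral_mono (μ := P) (i3.const_mul (μ ^ 2)) i6 key
  rw [integral_add i5 (i4.const_mul _), integral_const_mul,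
    integral_const_mul, integral_const_mul, integral_sub i1 i2, h1, h2] at h5
  simpa using h5

/-- Cauchy–Schwarz against the energy estimate gives a bound quadratic in the residual, of the same
order as the mean of `overlap`. -/
theorem IsCorrector.abs_integral_residual_mul_sub_trial_le (hd : d ≠ 0)
    (hc₀ : c₀ * (β + α * (d - 1)) = α - β) (hL : 0 ≤ L) (hα : 0 < α) (hβ : 0 < β)
    (h : IsCorrector P (α • ContinuousLinearMap.id ℝ (E d)) (β • ContinuousLinearMap.id ℝ (E d))
      e φ Φ) (he : e ≠ 0) (v : E d) :
    |∫ S, residual α β c₀ L S * inner ℝ (Φ S - trial L c₀ e S) v ∂P| ≤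
      (∫ S, residual α β c₀ L S ^ 2 ∂P) / min α β * (‖e‖ * ‖v‖) := by
  have h1 := h.integral_norm_sq_sub_trial_le hd hc₀ hL hα hβ
  set μ := min α β
  have hμ : 0 < μ := lt_min hα hβ
  have he' : 0 < ‖e‖ := norm_pos_iff.2 he
  have hZ : MemLp (Φ - trial L c₀ e) 2 P := h.memLp.sub (memLp_trial L c₀ e)
  have i3 : Integrable (fun S => ‖Φ S - trial L c₀ e S‖ ^ 2) P :=
    hZ.integrable_norm_pow (by norm_num)
  have i4 : Integrable (fun S => residual α β c₀ L S ^ 2) P := integrable_sq_residual hd hc₀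
  -- The weights in Young's inequality make both terms equal under the energy estimate.
  have i5 : Integrable (fun S => ‖v‖ / 2 * (‖e‖ / μ * residual α β c₀ L S ^ 2 +
      μ / ‖e‖ * ‖Φ S - trial L c₀ e S‖ ^ 2)) P :=
    ((i4.const_mul _).add (i3.const_mul _)).const_mul _
  have h2 := abs_integral_le_of_abs_le (P := P)
    (f := fun S => residual α β c₀ L S * inner ℝ (Φ S - trial L c₀ e S) v) i5 fun S => by
      rw [abs_mul]
      have h3 := abs_real_inner_le_norm (Φ S - trial L c₀ e S) v
      set m := residual α β c₀ L S
      set z := ‖Φ S - trial L c₀ e S‖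
      have h4 : |m| * z ≤ 1 / 2 * (‖e‖ / μ * m ^ 2 + μ / ‖e‖ * z ^ 2) := by
        have h5 : ‖e‖ / μ * m ^ 2 + μ / ‖e‖ * z ^ 2 - 2 * (|m| * z) =
            (‖e‖ * |m| - μ * z) ^ 2 / (μ * ‖e‖) := by
          rw [← sq_abs m]
          field_simp
          ring
        have h6 : 0 ≤ (‖e‖ * |m| - μ * z) ^ 2 / (μ * ‖e‖) := by positivity
        linarith
      calc _ ≤ |m| * (z * ‖v‖) := mul_le_mul_of_nonneg_left h3 (abs_nonneg m)
        _ = |m| * z * ‖v‖ := by ring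
        _ ≤ 1 / 2 * (‖e‖ / μ * m ^ 2 + μ / ‖e‖ * z ^ 2) * ‖v‖ :=
          mul_le_mul_of_nonneg_right h4 (norm_nonneg v)
        _ = _ := by ring
  refine h2.trans ?_
  rw [integral_const_mul, integral_add (i4.const_mul _) (i3.const_mul _), integral_const_mul,
    integral_const_mul]
  set A := ∫ S, residual α β c₀ L S ^ 2 ∂P
  set B := ∫ S, ‖Φ S - trial L c₀ e S‖ ^ 2 ∂P
  have h7 : μ / ‖e‖ * B ≤ ‖e‖ / μ * A := by
    rw [div_mul_eq_mul_div, div_mul_eq_mul_div, div_le_div_iff₀ he' hμ]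
    nlinarith
  calc _ ≤ ‖v‖ / 2 * (‖e‖ / μ * A + ‖e‖ / μ * A) := by gcongr
    _ = _ := by ring

/-- `Φ + e` is split into `e`, the trial field and their defect. The first part yields the
Clausius–Mossotti term, and all that remains is linear in the mean of `overlap`. -/
theorem norm_effective_sub_le (hd : d ≠ 0) (hc₀ : c₀ * (β + α * (d - 1)) = α - β)
    (hc : c = -(c₀ * α * d)) (hL : 0 ≤ L) (hα : 0 < α) (hβ : 0 < β) {Abar : E d →L[ℝ] E d}
    (hA : IsEffectiveConductivity P (α • ContinuousLinearMap.id ℝ (E d))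
      (β • ContinuousLinearMap.id ℝ (E d)) Abar)
    (hσ : Integrable (fun S => (overlap L S).toReal) P) :
    ‖Abar - (α • ContinuousLinearMap.id ℝ (E d) +
      (volumeFraction P * c) • ContinuousLinearMap.id ℝ (E d))‖ ≤
      ((1 + |c₀| * d ^ 2) * |β - α - c| + ((β - α) ^ 2 + c ^ 2) / min α β) *
        ∫ S, (overlap L S).toReal ∂P := by
  have hμ : 0 < min α β := lt_min hα hβ
  set s := ∫ S, (overlap L S).toReal ∂P with hs
  have hs0 : 0 ≤ s := integral_nonneg fun S => ENNReal.toReal_nonneg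
  refine ContinuousLinearMap.opNorm_le_bound' _ (by positivity) fun e he => ?_
  obtain ⟨⟨φ, Φ, h⟩, hall⟩ := hA e
  have he' : e ≠ 0 := by simpa using he
  have hAe : Abar e = ∫ S, conductivity α β S • (Φ S + e) ∂P := by
    rw [hall φ Φ h]
    simp only [coeff_apply, field, neg_zero, zero_vadd]
  set u := (Abar - (α • ContinuousLinearMap.id ℝ (E d) +
    (volumeFraction P * c) • ContinuousLinearMap.id ℝ (E d))) e with hu
  have hv : ∀ v, inner ℝ u v ≤ ((1 + |c₀| * d ^ 2) * |β - α - c| +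
      ((β - α) ^ 2 + c ^ 2) / min α β) * s * (‖e‖ * ‖v‖) := by
    intro v
    have h1 := h.inner_integral_flux hd hc₀ hL v
    have hW := memLp_trial (P := P) L c₀ e
    have i1 : Integrable (fun S => residual α β c₀ L S * inner ℝ e v) P :=
      (integrable_residual hd hc₀).mul_const _
    have i2 := integrable_residual_mul_inner (L := L) hd hc₀ hW v
    have i3 : Integrable
        (fun S => residual α β c₀ L S * inner ℝ (Φ S - trial L c₀ e S) v) P :=
      integrable_residual_mul_inner (L := L) hd hc₀ (h.memLp.sub hW) v
    have h2 : ∫ S, residual α β c₀ L S * inner ℝ (Φ S + e) v ∂P =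
        (∫ S, residual α β c₀ L S ∂P) * inner ℝ e v +
        (∫ S, residual α β c₀ L S * inner ℝ (trial L c₀ e S) v ∂P) +
        ∫ S, residual α β c₀ L S * inner ℝ (Φ S - trial L c₀ e S) v ∂P := by
      rw [← integral_mul_const, ← integral_add i1 i2, ← integral_add _ i3]
      · refine integral_congr_ae (ae_of_all _ fun S => ?_)
        simp only [inner_add_left, inner_sub_left]
        ring
      · exact i1.add i2
    have b1 := abs_integral_residual_sub_le (P := P) hd hc₀ hc hL hσ
    have b2 := abs_integral_residual_mul_trial_le (P := P) hd hc₀ hc hL hσ e v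
    have b3 := h.abs_integral_residual_mul_sub_trial_le hd hc₀ hL hα hβ he' v
    have b4 := integral_sq_residual_le (P := P) hd hc₀ hc hL hσ
    have hu' : inner ℝ u v = ((∫ S, residual α β c₀ L S ∂P) - c * volumeFraction P) * inner ℝ e v +
        (∫ S, residual α β c₀ L S * inner ℝ (trial L c₀ e S) v ∂P) +
        ∫ S, residual α β c₀ L S * inner ℝ (Φ S - trial L c₀ e S) v ∂P := by
      have : u = Abar e - (α • e + (volumeFraction P * c) • e) := rfl
      rw [this, inner_sub_left, inner_add_left, real_inner_smul_left, real_inner_smul_left, hAe, h1,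
        h2]
      ring
    rw [hu']
    have c1 : ((∫ S, residual α β c₀ L S ∂P) - c * volumeFraction P) * inner ℝ e v ≤
        |β - α - c| * s * (‖e‖ * ‖v‖) := by
      refine (le_abs_self _).trans ?_
      rw [abs_mul]
      exact mul_le_mul b1 (abs_real_inner_le_norm e v) (abs_nonneg _) (by positivity)
    have c3 : (∫ S, residual α β c₀ L S ^ 2 ∂P) / min α β * (‖e‖ * ‖v‖) ≤
        ((β - α) ^ 2 + c ^ 2) * s / min α β * (‖e‖ * ‖v‖) := by
      gcongr
    have c2 := (le_abs_self _).trans b2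
    have c4 := (le_abs_self _).trans (b3.trans c3)
    calc _ ≤ |β - α - c| * s * (‖e‖ * ‖v‖) +
          |c₀| * d ^ 2 * |β - α - c| * s * (‖e‖ * ‖v‖) +
          ((β - α) ^ 2 + c ^ 2) * s / min α β * (‖e‖ * ‖v‖) := add_le_add (add_le_add c1 c2) c4
      _ = _ := by ring
  rcases eq_or_ne u 0 with h0 | h0
  · rw [h0, norm_zero]
    positivity
  · have h1 := hv u
    rw [real_inner_self_eq_norm_sq] at h1
    have h2 : 0 < ‖u‖ := norm_pos_iff.2 h0
    refine le_of_mul_le_mul_right ?_ h2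
    linarith

end Effective

end

section

/-! ### Pair counts and the second-order intensity -/

open Classical in
theorem PointSet.pairSum_eq (S : PointSet d) (ζ : E d × E d → ℝ≥0∞) :
    S.pairSum ζ = ∫⁻ x, ∫⁻ y, (if x ≠ y then ζ (x, y) else 0) ∂S.counting ∂S.counting := by
  simp only [PointSet.lintegral_counting]
  change ∑' p : {p : E d × E d | p.1 ∈ S.carrier ∧ p.2 ∈ S.carrier ∧ p.1 ≠ p.2}, ζ p = _
  rw [tsum_subtype {p : E d × E d | p.1 ∈ S.carrier ∧ p.2 ∈ S.carrier ∧ p.1 ≠ p.2} ζ,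
    ENNReal.tsum_prod (f := fun x y => indicator
      {p : E d × E d | p.1 ∈ S.carrier ∧ p.2 ∈ S.carrier ∧ p.1 ≠ p.2} ζ (x, y)),
    tsum_subtype S.carrier fun x => ∑' y : S.carrier, if x ≠ y then ζ (x, y) else 0]
  refine tsum_congr fun x => ?_
  by_cases hx : x ∈ S.carrier
  · rw [indicator_of_mem hx,
      tsum_subtype S.carrier fun y => if x ≠ y then ζ (x, y) else 0]
    refine tsum_congr fun y => ?_
    by_cases hy : y ∈ S.carrier <;> by_cases hxy : x = y <;> simp [indicator, hx, hy, hxy]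
  · simp [indicator, hx]

theorem PointSet.pairSum_mono (S : PointSet d) {ζ ξ : E d × E d → ℝ≥0∞} (h : ∀ p, ζ p ≤ ξ p) :
    S.pairSum ζ ≤ S.pairSum ξ :=
  ENNReal.tsum_le_tsum fun p => h p

theorem PointSet.measurable_pairSum {ζ : E d × E d → ℝ≥0∞} (hζ : Measurable ζ) :
    Measurable fun S : PointSet d => S.pairSum ζ := by
  classical
  simp only [PointSet.pairSum_eq]
  refine PointSet.measurable_lintegral_counting (f := fun (S : PointSet d) (x : E d) =>
    ∫⁻ y, (if x ≠ y then ζ (x, y) else 0) ∂S.counting) ?_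
  have h1 : Measurable fun q : (PointSet d × E d) × E d =>
      if q.1.2 ≠ q.2 then ζ (q.1.2, q.2) else 0 :=
    Measurable.ite (measurableSet_eq_fun (measurable_snd.comp measurable_fst)
      measurable_snd).compl (hζ.comp ((measurable_snd.comp measurable_fst).prodMk measurable_snd))
      measurable_const
  exact Measurable.lintegral_kernel_prod_right
    (κ := (countingKernel d).comap (Prod.fst : PointSet d × E d → PointSet d) measurable_fst)
    (f := fun (q : PointSet d × E d) (y : E d) => if q.2 ≠ y then ζ (q.2, y) else 0) h1

/-- The indicator function of `A × A`. -/
def sqIndicator (A : Set (E d)) (p : E d × E d) : ℝ≥0∞ :=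
  A.indicator 1 p.1 * A.indicator 1 p.2

theorem measurable_sqIndicator {A : Set (E d)} (hA : MeasurableSet A) :
    Measurable (sqIndicator A) := by
  have hm : Measurable (A.indicator (1 : E d → ℝ≥0∞)) := measurable_one.indicator hA
  exact (hm.comp measurable_fst).mul (hm.comp measurable_snd)

/-- The expected number of ordered pairs of distinct points in the ball of radius `r`. -/
def pairCount (P : Measure (PointSet d)) (r : ℝ) : ℝ≥0∞ :=
  ∫⁻ S, S.pairSum (sqIndicator (ball 0 r)) ∂P

theorem edist_ofLp_le {x y : E d} :
    edist (WithLp.ofLp x) (WithLp.ofLp y) ≤ edist x y :=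
  (PiLp.lipschitzWith_ofLp 2 fun _ : Fin d => ℝ).edist_le_mul x y |>.trans (by simp)

theorem PointSet.pairSum_eq_zero {S : PointSet d} {r : ℝ}
    (h : ENNReal.ofReal (2 * r) ≤ S.minDist) : S.pairSum (sqIndicator (ball 0 r)) = 0 := by
  rw [PointSet.pairSum, ENNReal.tsum_eq_zero]
  rintro ⟨⟨x, y⟩, hx, hy, hxy⟩
  by_contra hne
  simp only [sqIndicator, mul_eq_zero, indicator_apply_eq_zero, not_or,
    Classical.not_imp] at hne
  have h1 : S.minDist ≤ edist (WithLp.ofLp x) (WithLp.ofLp y) :=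
    iInf_le_of_le x (iInf_le_of_le hx (iInf_le_of_le y (iInf_le_of_le hy (iInf_le_of_le hxy
        le_rfl))))
  have h2 : edist x y < ENNReal.ofReal (2 * r) := by
    rw [edist_dist]
    have h3 : ‖x‖ < r := by simpa using hne.1.1
    have h4 : ‖y‖ < r := by simpa using hne.2.1
    have h5 := norm_nonneg x
    refine (ENNReal.ofReal_lt_ofReal_iff (by linarith)).2 ?_
    rw [dist_eq_norm]
    linarith [norm_sub_le x y]
  exact absurd (h.trans (h1.trans edist_ofLp_le)) (not_le.2 h2)

theorem pairCount_eq_zero {P : Measure (PointSet d)} {r : ℝ}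
    (h : ENNReal.ofReal (2 * r) ≤ minLength P) : pairCount P r = 0 := by
  rw [pairCount, lintegral_congr_ae (g := 0)]
  · simp
  filter_upwards [ae_essInf_le (f := fun S : PointSet d => S.minDist) (μ := P)] with S hS
  exact PointSet.pairSum_eq_zero (h.trans hS)

/-- The density is defined through continuous functions, so a bump function is inserted between the
indicators of the balls of radius `r` and `2r`. -/
theorem pairCount_le_of_isTwoPointDensity {P : Measure (PointSet d)} {f : E d × E d → ℝ≥0∞}
    (hf : IsTwoPointDensity P f) {r : ℝ} (hr : 0 < r) :
    pairCount P r ≤ essSup f volume * volume (ball (0 : E d) (2 * r)) ^ 2 := by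
  let χ : ContDiffBump (0 : E d) := ⟨r, 2 * r, hr, by linarith⟩
  let ψ : E d → ℝ≥0 := fun x => ⟨χ x, χ.nonneg⟩
  have hψc : Continuous ψ := χ.continuous.subtype_mk _
  have hψ1 : ∀ x, (ball (0 : E d) r).indicator 1 x ≤ (ψ x : ℝ≥0∞) := by
    intro x
    by_cases hx : x ∈ ball (0 : E d) r
    · have : ψ x = 1 := NNReal.coe_injective (χ.one_of_mem_closedBall (ball_subset_closedBall hx))
      simp [this, hx, indicator_of_mem]
    · simp [hx]
  have hψ2 : ∀ x, (ψ x : ℝ≥0∞) ≤ (ball (0 : E d) (2 * r)).indicator 1 x := by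
    intro x
    by_cases hx : x ∈ ball (0 : E d) (2 * r)
    · simp only [hx, indicator_of_mem, Pi.one_apply, ENNReal.coe_le_one_iff]
      exact_mod_cast χ.le_one
    · have : ψ x = 0 := NNReal.coe_injective (χ.zero_of_le_dist (not_lt.1 hx))
      simp [this]
  have hζ := hf.2 (fun p => ψ p.1 * ψ p.2) (by fun_prop) ?_
  swap
  · refine HasCompactSupport.intro (K := closedBall 0 (2 * r) ×ˢ closedBall 0 (2 * r))
      ((isCompact_closedBall _ _).prod (isCompact_closedBall _ _)) fun p hp => ?_
    have hz : ∀ x, x ∉ closedBall (0 : E d) (2 * r) → ψ x = 0 := fun x hx =>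
      NNReal.coe_injective (χ.zero_of_le_dist (not_le.1 hx).le)
    by_cases h1 : p.1 ∈ closedBall (0 : E d) (2 * r)
    · have h2 : p.2 ∉ closedBall (0 : E d) (2 * r) := fun h2 => hp ⟨h1, h2⟩
      simp [hz _ h2]
    · simp [hz _ h1]
  calc pairCount P r ≤ ∫⁻ S, S.pairSum (fun p => ((ψ p.1 * ψ p.2 : ℝ≥0) : ℝ≥0∞)) ∂P := by
        refine lintegral_mono fun S => S.pairSum_mono fun p => ?_
        rw [ENNReal.coe_mul]
        exact mul_le_mul' (hψ1 _) (hψ1 _)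
    _ = ∫⁻ p, ((ψ p.1 * ψ p.2 : ℝ≥0) : ℝ≥0∞) * f p := hζ
    _ ≤ ∫⁻ p, sqIndicator (ball 0 (2 * r)) p * essSup f volume := by
        refine lintegral_mono_ae ?_
        filter_upwards [ENNReal.ae_le_essSup f] with p hp
        rw [ENNReal.coe_mul]
        exact mul_le_mul' (mul_le_mul' (hψ2 _) (hψ2 _)) hp
    _ = _ := by
        have hm : Measurable ((ball (0 : E d) (2 * r)).indicator (1 : E d → ℝ≥0∞)) :=
          measurable_one.indicator measurableSet_ball
        rw [lintegral_mul_const _ (measurable_sqIndicator measurableSet_ball), mul_comm]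
        congr 1
        rw [Measure.volume_eq_prod]
        simp only [sqIndicator]
        rw [lintegral_prod_mul hm.aemeasurable hm.aemeasurable,
          lintegral_indicator_one measurableSet_ball, sq]

/-- The cubes are open with half-side `ℓ / 2`; centers on the lattice of spacing `ℓ / 2` make them
cover the ball without gaps, rounding each coordinate down. -/
theorem sqIndicator_ball_le_sum {ℓ r : ℝ} (hℓ : 0 < ℓ) (n : ℕ) (hn : 2 * r / ℓ ≤ n)
    (p : E d × E d) :
    sqIndicator (ball 0 r) p ≤
      ∑ k ∈ Fintype.piFinset (fun _ : Fin d => Finset.Icc (-(n : ℤ)) n),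
        ∑ k' ∈ Fintype.piFinset (fun _ : Fin d => Finset.Icc (-(n : ℤ)) n),
          (cube (ENNReal.ofReal ℓ) (WithLp.toLp 2 fun i => (k i : ℝ) * (ℓ / 2))).indicator 1 p.1 *
          (cube (ENNReal.ofReal ℓ)
            (WithLp.toLp 2 fun i => (k' i : ℝ) * (ℓ / 2))).indicator 1 p.2 := by
  have key : ∀ x : E d, ‖x‖ < r → ∃ k ∈ Fintype.piFinset
      (fun _ : Fin d => Finset.Icc (-(n : ℤ)) n),
      x ∈ cube (ENNReal.ofReal ℓ) (WithLp.toLp 2 fun i => (k i : ℝ) * (ℓ / 2)) := by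
    intro x hx
    have hxi : ∀ i, |x i * (2 / ℓ)| ≤ n := by
      intro i
      rw [abs_mul, abs_of_pos (by positivity : 0 < 2 / ℓ)]
      have := (abs_coord_le_norm x i).trans hx.le
      calc |x i| * (2 / ℓ) ≤ r * (2 / ℓ) := by gcongr
        _ = 2 * r / ℓ := by ring
        _ ≤ n := hn
    refine ⟨fun i => ⌊x i * (2 / ℓ)⌋, ?_, ?_⟩
    · rw [Fintype.mem_piFinset]
      intro i
      have h := abs_le.1 (hxi i)
      rw [Finset.mem_Icc]
      constructor
      · rw [Int.le_floor]
        push_cast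
        exact h.1
      · have := (Int.floor_le (x i * (2 / ℓ))).trans h.2
        exact (Int.cast_le (R := ℝ)).1 (by push_cast; exact this)
    · have h2 : ENNReal.ofReal ℓ / 2 = ENNReal.ofReal (ℓ / 2) := by
        rw [ENNReal.ofReal_div_of_pos (by norm_num)]
        simp
      change edist (WithLp.ofLp x) _ < ENNReal.ofReal ℓ / 2
      rw [h2, edist_dist, ENNReal.ofReal_lt_ofReal_iff (by positivity),
        dist_pi_lt_iff (by positivity)]
      intro i
      rw [Real.dist_eq]
      have h3 := Int.floor_le (x i * (2 / ℓ))
      have h4 := Int.lt_floor_add_one (x i * (2 / ℓ))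
      have h5 : x i = x i * (2 / ℓ) * (ℓ / 2) := by field_simp
      have h6 : 0 < ℓ / 2 := by positivity
      rw [abs_lt]
      constructor
      · nlinarith
      · nlinarith
  by_cases hp : ‖p.1‖ < r ∧ ‖p.2‖ < r
  · obtain ⟨k, hk, h1⟩ := key _ hp.1
    obtain ⟨k', hk', h2⟩ := key _ hp.2
    refine le_trans ?_ (Finset.single_le_sum (fun _ _ => zero_le) hk)
    refine le_trans ?_ (Finset.single_le_sum (fun _ _ => zero_le) hk')
    rw [indicator_of_mem h1, indicator_of_mem h2]
    simp [sqIndicator, hp]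
  · rw [not_and_or] at hp
    rcases hp with hp | hp <;> simp [sqIndicator, hp]

theorem measurableSet_cube (ℓ : ℝ≥0∞) (z : E d) : MeasurableSet (cube ℓ z) := by
  have : Continuous fun x : E d => edist (WithLp.ofLp x) (WithLp.ofLp z) :=
    (PiLp.continuous_ofLp 2 _).edist continuous_const
  exact measurableSet_lt this.measurable measurable_const

theorem PointSet.pairSum_finsetSum {ι : Type*} (S : PointSet d) (s : Finset ι)
    (ζ : ι → E d × E d → ℝ≥0∞) :
    S.pairSum (fun p => ∑ i ∈ s, ζ i p) = ∑ i ∈ s, S.pairSum (ζ i) := by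
  unfold PointSet.pairSum
  exact Summable.tsum_finsetSum fun _ _ => ENNReal.summable

end

/-! ### Pair counts at all scales, and the mean weight of a point -/

section

/-- The constant in the bound on pair counts. -/
def pairConst (d : ℕ) : ℝ≥0∞ := volume (ball (0 : E d) 2) ^ 2 + 10 ^ (2 * d)

theorem pairConst_ne_top : pairConst d ≠ ⊤ :=
  ENNReal.add_ne_top.2 ⟨ENNReal.pow_ne_top measure_ball_lt_top.ne,
    ENNReal.pow_ne_top (ENNReal.natCast_ne_top 10)⟩

theorem volume_ball_mul {r : ℝ} (hr : 0 < r) (s : ℝ) :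
    volume (ball (0 : E d) (r * s)) = ENNReal.ofReal r ^ d * volume (ball (0 : E d) s) := by
  have := Measure.addHaar_ball_mul_of_pos (volume : Measure (E d)) 0 hr s
  rw [this, ENNReal.ofReal_pow hr.le]
  simp

theorem lintegral_cube_pair_le {P : Measure (PointSet d)} {ℓ : ℝ} (hℓ : 0 < ℓ)
    (h : minLength P = ENNReal.ofReal ℓ) (z z' : E d) :
    ∫⁻ S, S.pairSum (fun p => (cube (ENNReal.ofReal ℓ) z).indicator 1 p.1 *
      (cube (ENNReal.ofReal ℓ) z').indicator 1 p.2) ∂P ≤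
      ENNReal.ofReal ℓ ^ (2 * d) * secondIntensity P := by
  set l := ENNReal.ofReal ℓ
  have hl0 : l ≠ 0 := by simpa [l] using hℓ
  have hlt : l ≠ ⊤ := ENNReal.ofReal_ne_top
  have hd0 : l ^ d ≠ 0 := pow_ne_zero _ hl0
  have hdt : l ^ d ≠ ⊤ := ENNReal.pow_ne_top hlt
  have hm : Measurable fun p : E d × E d => (l ^ d)⁻¹ * (cube l z).indicator (1 : E d → ℝ≥0∞) p.1 *
      ((l ^ d)⁻¹ * (cube l z').indicator 1 p.2) :=
    (((measurable_one.indicator (measurableSet_cube l z)).comp measurable_fst).const_mul _).mul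
      (((measurable_one.indicator (measurableSet_cube l z')).comp measurable_snd).const_mul _)
  have h1 : ∫⁻ S, S.pairSum (fun p => (l ^ d)⁻¹ * (cube l z).indicator 1 p.1 *
      ((l ^ d)⁻¹ * (cube l z').indicator 1 p.2)) ∂P ≤ secondIntensity P := by
    rw [secondIntensity, h, if_neg hl0]
    exact le_iSup₂ (f := fun z z' => ∫⁻ S, S.pairSum (fun p => (l ^ d)⁻¹ *
      (cube l z).indicator 1 p.1 * ((l ^ d)⁻¹ * (cube l z').indicator 1 p.2)) ∂P) z z'
  refine le_trans (le_of_eq ?_) (mul_le_mul_right h1 _)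
  rw [← lintegral_const_mul _ (PointSet.measurable_pairSum hm)]
  refine lintegral_congr fun S => ?_
  rw [PointSet.pairSum, PointSet.pairSum, ← ENNReal.tsum_mul_left]
  refine tsum_congr fun p => ?_
  have h2 : l ^ (2 * d) * ((l ^ d)⁻¹ * (l ^ d)⁻¹) = 1 := by
    rw [two_mul, pow_add, mul_mul_mul_comm, ENNReal.mul_inv_cancel hd0 hdt, one_mul]
  rw [mul_mul_mul_comm, ← mul_assoc, h2, one_mul]

theorem pairCount_le_of_minLength {P : Measure (PointSet d)} {ℓ r : ℝ} (hℓ : 0 < ℓ)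
    (h : minLength P = ENNReal.ofReal ℓ) (hr : ℓ < 2 * r) :
    pairCount P r ≤ 10 ^ (2 * d) * secondIntensity P * ENNReal.ofReal r ^ (2 * d) := by
  have hr0 : 0 < r := by linarith
  set n := ⌈2 * r / ℓ⌉₊
  have hn : 2 * r / ℓ ≤ n := Nat.le_ceil _
  -- With `t = 2r/ℓ > 1` and `n < t + 1` one has `2n + 1 < 2t + 3 < 5t`.
  have hn' : (2 * n + 1 : ℝ) ≤ 10 * r / ℓ := by
    have h1 : (n : ℝ) < 2 * r / ℓ + 1 := Nat.ceil_lt_add_one (by positivity)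
    have h2 : 1 < 2 * r / ℓ := (one_lt_div hℓ).2 hr
    have h3 : 10 * r / ℓ = 5 * (2 * r / ℓ) := by ring
    linarith
  set G := Fintype.piFinset (fun _ : Fin d => Finset.Icc (-(n : ℤ)) n)
  have hG : (G.card : ℝ≥0∞) * ENNReal.ofReal ℓ ^ d ≤ (10 * ENNReal.ofReal r) ^ d := by
    have h1 : G.card = (2 * n + 1) ^ d := by
      rw [Fintype.card_piFinset_const]
      congr 1
      rw [Int.card_Icc]
      omega
    rw [h1]
    push_cast
    rw [← mul_pow]
    gcongr ?_ ^ d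
    have h2 : (2 * (n : ℝ≥0∞) + 1) = ENNReal.ofReal (2 * n + 1) := by
      rw [ENNReal.ofReal_add (by positivity) (by norm_num), ENNReal.ofReal_mul (by norm_num)]
      simp
    have h3 : (10 * ENNReal.ofReal r) = ENNReal.ofReal (10 * r) := by
      rw [ENNReal.ofReal_mul (by norm_num)]
      simp
    rw [h2, h3, ← ENNReal.ofReal_mul (by positivity)]
    refine ENNReal.ofReal_le_ofReal ?_
    rwa [← le_div_iff₀ hℓ]
  have hm : ∀ z z' : E d, Measurable fun p : E d × E d =>
      (cube (ENNReal.ofReal ℓ) z).indicator (1 : E d → ℝ≥0∞) p.1 *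
        (cube (ENNReal.ofReal ℓ) z').indicator 1 p.2 := fun z z' =>
    ((measurable_one.indicator (measurableSet_cube _ z)).comp measurable_fst).mul
      ((measurable_one.indicator (measurableSet_cube _ z')).comp measurable_snd)
  calc pairCount P r ≤ ∑ k ∈ G, ∑ k' ∈ G, ENNReal.ofReal ℓ ^ (2 * d) * secondIntensity P := by
        refine (lintegral_mono fun S => S.pairSum_mono
          (sqIndicator_ball_le_sum hℓ n hn)).trans ?_
        simp only [PointSet.pairSum_finsetSum]
        rw [lintegral_finsetSum _ fun k _ => Finset.measurable_sum _ fun k' _ =>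
          PointSet.measurable_pairSum (hm _ _)]
        refine Finset.sum_le_sum fun k _ => ?_
        rw [lintegral_finsetSum _ fun k' _ => PointSet.measurable_pairSum (hm _ _)]
        exact Finset.sum_le_sum fun k' _ => lintegral_cube_pair_le hℓ h _ _
    _ = (G.card * ENNReal.ofReal ℓ ^ d) * (G.card * ENNReal.ofReal ℓ ^ d) * secondIntensity P := by
        simp only [Finset.sum_const, nsmul_eq_mul]
        ring
    _ ≤ (10 * ENNReal.ofReal r) ^ d * (10 * ENNReal.ofReal r) ^ d * secondIntensity P := by
        gcongr
    _ = _ := by ring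

/-- Three regimes: with zero minimal length the two-point density is used; at radii with `2r ≤ ℓ`
there are no pairs; at larger radii the ball is covered by cubes of side `ℓ`. -/
theorem pairCount_le (P : Measure (PointSet d)) {r : ℝ} (hr : 0 < r) :
    pairCount P r ≤ pairConst d * secondIntensity P * ENNReal.ofReal r ^ (2 * d) := by
  by_cases h0 : minLength P = 0
  · have hv0 : volume (ball (0 : E d) (2 * r)) ^ 2 ≠ 0 :=
      pow_ne_zero _ (measure_ball_pos _ _ (by positivity)).ne'
    have hvt : volume (ball (0 : E d) (2 * r)) ^ 2 ≠ ⊤ :=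
      ENNReal.pow_ne_top measure_ball_lt_top.ne
    have h1 : pairCount P r / volume (ball (0 : E d) (2 * r)) ^ 2 ≤ secondIntensity P := by
      rw [secondIntensity, if_pos h0]
      exact le_iInf₂ fun f hf => (ENNReal.div_le_iff hv0 hvt).2
        (pairCount_le_of_isTwoPointDensity hf hr)
    rw [ENNReal.div_le_iff hv0 hvt] at h1
    refine h1.trans ?_
    rw [mul_comm 2 r, volume_ball_mul hr, mul_pow, ← pow_mul, mul_comm d 2, ← mul_assoc,
        mul_right_comm,
      mul_comm (secondIntensity P)]
    gcongr
    exact le_self_add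
  by_cases h1 : ENNReal.ofReal (2 * r) ≤ minLength P
  · rw [pairCount_eq_zero h1]
    exact zero_le
  · have hlt : minLength P ≠ ⊤ := (not_le.1 h1).ne_top
    have hℓ : 0 < (minLength P).toReal := ENNReal.toReal_pos h0 hlt
    have h := (ENNReal.ofReal_toReal hlt).symm
    refine (pairCount_le_of_minLength hℓ h ?_).trans ?_
    · rw [h, not_le] at h1
      exact (ENNReal.ofReal_lt_ofReal_iff (by positivity)).1 h1
    · gcongr
      exact le_add_self

theorem measurable_counting_apply {D : Set (E d)} (hD : MeasurableSet D) :
    Measurable fun S : PointSet d => S.counting D :=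
  (Measure.measurable_coe hD).comp PointSet.measurable_counting

/-- A point of the ball of radius `r` and a neighbor within distance `r` of it form an ordered pair
in the ball of radius `2r`. -/
theorem intensity_neighbors_le (P : Measure (PointSet d)) [SFinite P]
    [VAddInvariantMeasure (E d) (PointSet d) P] (r : ℝ) :
    intensity P (fun S => S.counting (ball 0 r \ {0})) * volume (ball (0 : E d) r) ≤
      pairCount P (2 * r) := by
  classical
  have hD : MeasurableSet (ball (0 : E d) r \ {0}) :=
    measurableSet_ball.diff (measurableSet_singleton 0)
  rw [← lintegral_indicator_one measurableSet_ball, ← lintegral_counting_eq_intensity_mul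
    (measurable_counting_apply hD) (measurable_one.indicator measurableSet_ball)]
  refine lintegral_mono fun S => ?_
  rw [PointSet.pairSum_eq]
  refine lintegral_mono fun x => ?_
  have h1 : (-x +ᵥ S).counting (ball 0 r \ {0}) =
      ∫⁻ y, (ball (0 : E d) r \ {0}).indicator 1 (-x + y) ∂S.counting := by
    rw [← lintegral_indicator_one hD, PointSet.lintegral_counting_vadd _ _
      (measurable_one.indicator hD)]
  simp only
  rw [h1, ← lintegral_mul_const' _ _ (by by_cases hx : x ∈ ball (0 : E d) r <;> simp [hx,
      indicator])]
  refine lintegral_mono fun y => ?_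
  by_cases hx : x ∈ ball (0 : E d) r
  · by_cases hy : -x + y ∈ ball (0 : E d) r \ {0}
    · have hne : x ≠ y := fun h => hy.2 (by simp [h])
      have hxr : ‖x‖ < r := by simpa using hx
      have hyr : ‖-x + y‖ < r := by simpa using hy.1
      have hx2 : x ∈ ball (0 : E d) (2 * r) := by
        rw [mem_ball_zero_iff]; linarith [norm_nonneg x]
      have hy2 : y ∈ ball (0 : E d) (2 * r) := by
        rw [mem_ball_zero_iff]
        have := norm_add_le x (-x + y)
        rw [add_neg_cancel_left] at this
        linarith
      simp only [indicator_of_mem hx, indicator_of_mem hy, sqIndicator, indicator_of_mem hx2,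
        indicator_of_mem hy2, if_pos hne]
      simp
    · simp only [indicator_of_notMem hy, zero_mul]
      exact zero_le
  · simp only [indicator_of_notMem hx, mul_zero]
    exact zero_le

/-- Once one point `x₀` of `A` is fixed, every other point of `A` gives a pair with it. -/
theorem PointSet.counting_le_pairSum (S : PointSet d) {A : Set (E d)} (hA : MeasurableSet A) :
    S.counting A ≤ S.pairSum (sqIndicator A) + 1 := by
  classical
  rw [← lintegral_indicator_one hA, S.lintegral_counting]
  by_cases h : ∃ x₀ ∈ S.carrier, x₀ ∈ A
  · obtain ⟨x₀, hx₀, hA₀⟩ := h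
    rw [PointSet.pairSum_eq, S.lintegral_counting]
    refine le_trans ?_ (add_le_add_left (ENNReal.le_tsum (⟨x₀, hx₀⟩ : S.carrier)) 1)
    rw [S.lintegral_counting, ← tsum_ite_eq (⟨x₀, hx₀⟩ : S.carrier) (fun _ => (1 : ℝ≥0∞)),
      ← ENNReal.tsum_add]
    refine ENNReal.tsum_le_tsum fun y => ?_
    by_cases hy : y = ⟨x₀, hx₀⟩
    · simp only [hy, if_true]
      refine le_add_left ?_
      simp [hA₀]
    · have hne : x₀ ≠ y := fun h => hy (Subtype.ext h.symm)
      simp [hy, hne, sqIndicator, hA₀, indicator_of_mem]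
  · push Not at h
    rw [ENNReal.tsum_eq_zero.2]
    · exact zero_le
    · rintro ⟨x, hx⟩
      simp [h x hx]

theorem intensity_one_mul_le (P : Measure (PointSet d)) [IsProbabilityMeasure P]
    [VAddInvariantMeasure (E d) (PointSet d) P] (r : ℝ) :
    intensity P (fun _ => 1) * volume (ball (0 : E d) r) ≤ pairCount P r + 1 := by
  rw [← lintegral_indicator_one measurableSet_ball, ← lintegral_counting_eq_intensity_mul
    measurable_const (measurable_one.indicator measurableSet_ball), pairCount]
  have h1 : (1 : ℝ≥0∞) = ∫⁻ _ : PointSet d, 1 ∂P := by simp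
  conv_rhs => rw [h1]
  rw [← lintegral_add_right _ measurable_const]
  refine lintegral_mono fun S => ?_
  simp only [one_mul]
  rw [lintegral_indicator_one measurableSet_ball]
  exact S.counting_le_pairSum measurableSet_ball

/-- Dyadic decomposition by induction on `K`: a radius below `2^{K+1}` is paid for by the new
summand, and for a larger one the weight is at most `2^{-(K+1)d}`. -/
theorem ofReal_weight_le_sum (R : ℝ) (K : ℕ) :
    ENNReal.ofReal (weight d R) ≤ ((2 ^ K) ^ d)⁻¹ +
      ∑ k ∈ Finset.range K, ((2 ^ k) ^ d)⁻¹ * (if R < 2 ^ (k + 1) then (1 : ℝ≥0∞) else 0) := by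
  induction K with
  | zero => simpa using weight_le_one R
  | succ K ih =>
    by_cases h : R < 2 ^ (K + 1)
    · rw [Finset.sum_range_succ, if_pos h, mul_one]
      refine ih.trans ?_
      rw [add_comm]
      exact le_add_self
    · refine le_trans ?_ le_self_add
      rw [weight]
      have h1 : (2 : ℝ) ^ (K + 1) ≤ max R 1 := le_max_of_le_left (not_lt.1 h)
      rw [ENNReal.ofReal_inv_of_pos (by positivity)]
      gcongr
      rw [ENNReal.ofReal_pow (by positivity)]
      gcongr
      have h2 : (2 : ℝ≥0∞) ^ (K + 1) = ENNReal.ofReal (2 ^ (K + 1)) := by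
        rw [ENNReal.ofReal_pow (by norm_num)]; simp
      rw [h2]
      exact ENNReal.ofReal_le_ofReal h1

theorem indicator_isolationRadius_le {K k : ℕ} (hk : k < K) (S : PointSet d) :
    (if isolationRadius (2 ^ K) S < 2 ^ (k + 1) then (1 : ℝ≥0∞) else 0) ≤
      S.counting (ball 0 (2 ^ (k + 2)) \ {0}) := by
  split_ifs with h
  · rw [isolationRadius_lt_iff] at h
    -- The cap `2^K` is not below `2^{k+1}`, so a small radius is caused by a genuine neighbor.
    have h1 : ¬ (2 : ℝ) ^ K < 2 ^ (k + 1) := by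
      rw [not_lt]
      exact pow_le_pow_right₀ (by norm_num) hk
    obtain ⟨x, hx, h0, hn⟩ := h.resolve_left h1
    rw [S.counting_apply (measurableSet_ball.diff (measurableSet_singleton 0))]
    have : (1 : ℕ∞) ≤ (S.carrier ∩ (ball 0 (2 ^ (k + 2)) \ {0})).encard := by
      rw [one_le_encard_iff_nonempty]
      refine ⟨x, hx, ?_, h0⟩
      rw [mem_ball_zero_iff]
      calc ‖x‖ < 2 * 2 ^ (k + 1) := hn
        _ = 2 ^ (k + 2) := by ring
    exact_mod_cast this
  · exact zero_le

theorem intensity_finsetSum {ι : Type*} (P : Measure (PointSet d)) [SFinite P]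
    [VAddInvariantMeasure (E d) (PointSet d) P] (s : Finset ι) {F : ι → PointSet d → ℝ≥0∞}
    (hF : ∀ i, Measurable (F i)) :
    intensity P (fun S => ∑ i ∈ s, F i S) = ∑ i ∈ s, intensity P (F i) := by
  classical
  induction s using Finset.induction_on with
  | empty => simp [intensity]
  | insert a s ha ih =>
    simp only [Finset.sum_insert ha]
    rw [intensity_add (hF a), ih]

/-- The constant in the bound on close neighbors. -/
def neighborConst (d : ℕ) : ℝ≥0∞ := pairConst d * 16 ^ d / volume (ball (0 : E d) 1)

theorem neighborConst_ne_top : neighborConst d ≠ ⊤ :=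
  (ENNReal.div_lt_top (ENNReal.mul_ne_top pairConst_ne_top
    (ENNReal.pow_ne_top (ENNReal.natCast_ne_top 16)))
    (measure_ball_pos _ _ one_pos).ne').ne

/-- At scale `2^k` the weight `2^{-kd}` cancels the intensity of points with a neighbor that close,
of order `λ₂ 2^{kd}`. Every scale costs the same, which gives the factor `K` and in the end the
logarithm. -/
theorem intensity_weight_le (P : Measure (PointSet d)) [SFinite P]
    [VAddInvariantMeasure (E d) (PointSet d) P] (K : ℕ) :
    intensity P (fun S => ENNReal.ofReal (weight d (isolationRadius (2 ^ K) S))) ≤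
      ((2 ^ K) ^ d)⁻¹ * intensity P (fun _ => 1) + K * (neighborConst d * secondIntensity P) := by
  set N : ℕ → PointSet d → ℝ≥0∞ := fun k S => S.counting (ball 0 (2 ^ (k + 2)) \ {0})
  have hN : ∀ k, Measurable (N k) := fun k =>
    measurable_counting_apply (measurableSet_ball.diff (measurableSet_singleton 0))
  have h1 : ∀ S : PointSet d, ENNReal.ofReal (weight d (isolationRadius (2 ^ K) S)) ≤
      ((2 ^ K) ^ d)⁻¹ * 1 + ∑ k ∈ Finset.range K, ((2 ^ k) ^ d)⁻¹ * N k S := by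
    intro S
    refine (ofReal_weight_le_sum _ K).trans ?_
    rw [mul_one]
    gcongr with k hk
    exact indicator_isolationRadius_le (Finset.mem_range.1 hk) S
  refine (intensity_mono h1).trans ?_
  rw [intensity_add measurable_const, intensity_const_mul measurable_const,
    intensity_finsetSum P _ fun k => (hN k).const_mul _]
  gcongr
  rw [← Finset.card_range K, ← nsmul_eq_mul, Finset.card_range]
  refine (Finset.sum_le_card_nsmul _ _ _ fun k _ => ?_).trans (by rw [Finset.card_range])
  rw [intensity_const_mul (hN k)]
  set r : ℝ := 2 ^ (k + 2) with hr
  have hr0 : 0 < r := by positivity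
  set V := volume (ball (0 : E d) 1)
  have hV0 : V ≠ 0 := (measure_ball_pos _ _ one_pos).ne'
  have hVt : V ≠ ⊤ := measure_ball_lt_top.ne
  set t : ℝ≥0∞ := (2 ^ k) ^ d
  have ht0 : t ≠ 0 := by simp [t]
  have htt : t ≠ ⊤ := by simp [t]
  have hor : ENNReal.ofReal r ^ d = 4 ^ d * t := by
    rw [hr, ENNReal.ofReal_pow (by norm_num), ENNReal.ofReal_ofNat, pow_add, mul_pow, mul_comm]
    norm_num
    rfl
  have hvol : volume (ball (0 : E d) r) = 4 ^ d * t * V := by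
    rw [← hor, ← volume_ball_mul hr0, mul_one]
  have h2 : intensity P (N k) * volume (ball (0 : E d) r) ≤
      pairConst d * secondIntensity P * ENNReal.ofReal (2 * r) ^ (2 * d) :=
    (intensity_neighbors_le P r).trans (pairCount_le P (by positivity))
  have h3 : (2 : ℝ≥0∞) ^ (2 * d) = 4 ^ d := by rw [pow_mul]; norm_num
  -- Pairs are counted at radius `2r` with `r = 4 · 2^k`: the power `(2r)^{2d}` divided by the
  -- volume factor `r^d` leaves `16^d 2^{kd}`.
  have h4 : (4 : ℝ≥0∞) ^ d * 4 ^ d = 16 ^ d := by rw [← mul_pow]; norm_num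
  have h5 : (4 : ℝ≥0∞) ^ d * t ≠ 0 := by simp [ht0]
  have h6 : (4 : ℝ≥0∞) ^ d * t ≠ ⊤ := ENNReal.mul_ne_top (by simp) htt
  rw [hvol, ENNReal.ofReal_mul (by norm_num), ENNReal.ofReal_ofNat, mul_pow, mul_comm 2 d,
    pow_mul (ENNReal.ofReal r), hor, mul_comm d 2, h3] at h2
  have h7 : intensity P (N k) * V ≤ pairConst d * 16 ^ d * secondIntensity P * t := by
    refine (ENNReal.mul_le_mul_iff_right h5 h6).1 ?_
    calc _ = intensity P (N k) * (4 ^ d * t * V) := by ring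
      _ ≤ pairConst d * secondIntensity P * (4 ^ d * (4 ^ d * t) ^ 2) := h2
      _ = 4 ^ d * t * (pairConst d * (4 ^ d * 4 ^ d) * secondIntensity P * t) := by ring
      _ = _ := by rw [h4]
  rw [← ENNReal.le_div_iff_mul_le (Or.inl hV0) (Or.inl hVt)] at h7
  refine (mul_le_mul_right h7 _).trans (le_of_eq ?_)
  rw [neighborConst, ENNReal.div_eq_inv_mul, ENNReal.div_eq_inv_mul]
  calc _ = t⁻¹ * t * (V⁻¹ * (pairConst d * 16 ^ d) * secondIntensity P) := by ring
    _ = _ := by rw [ENNReal.inv_mul_cancel ht0 htt, one_mul]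

end

section

/-! ### The error bound -/

/-- A ball of radius `r` contains on average at most one point more than ordered pairs, so `λ₁ V
r^d` is at most `C λ₂ r^{2d} + 1` for all `r`. As a quadratic inequality in `t = r^d` it forces a
nonpositive discriminant. -/
theorem intensity_one_bound (hd : d ≠ 0) (P : Measure (PointSet d)) [IsProbabilityMeasure P]
    [VAddInvariantMeasure (E d) (PointSet d) P] (h : secondIntensity P ≠ ⊤) :
    intensity P (fun _ => 1) ≠ ⊤ ∧
      ((intensity P fun _ => 1).toReal * (volume (ball (0 : E d) 1)).toReal) ^ 2 ≤
        4 * (pairConst d).toReal * (secondIntensity P).toReal := by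
  set V := volume (ball (0 : E d) 1)
  have hV0 : V ≠ 0 := (measure_ball_pos _ _ one_pos).ne'
  have hVt : V ≠ ⊤ := measure_ball_lt_top.ne
  have key : ∀ r : ℝ, 0 < r → intensity P (fun _ => 1) * (ENNReal.ofReal r ^ d * V) ≤
      pairConst d * secondIntensity P * ENNReal.ofReal r ^ (2 * d) + 1 := by
    intro r hr
    have h1 := intensity_one_mul_le P (r * 1)
    rw [volume_ball_mul hr, mul_one] at h1
    exact h1.trans (add_le_add_left (pairCount_le P hr) 1)
  have hfin : ∀ r : ℝ, pairConst d * secondIntensity P * ENNReal.ofReal r ^ (2 * d) ≠ ⊤ := fun r =>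
    ENNReal.mul_ne_top (ENNReal.mul_ne_top pairConst_ne_top h) (ENNReal.pow_ne_top
        ENNReal.ofReal_ne_top)
  have hlt : intensity P (fun _ => 1) ≠ ⊤ := by
    intro htop
    have h1 := key 1 one_pos
    rw [htop, ENNReal.ofReal_one, one_pow, one_mul, ENNReal.top_mul hV0, top_le_iff,
      ENNReal.add_eq_top] at h1
    have h2 := hfin 1
    rw [ENNReal.ofReal_one] at h2
    exact h1.elim h2 ENNReal.one_ne_top
  refine ⟨hlt, ?_⟩
  set a := (intensity P fun _ => 1).toReal * V.toReal
  set b := (pairConst d).toReal * (secondIntensity P).toReal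
  have ha : 0 ≤ a := by positivity
  have hb : 0 ≤ b := by positivity
  have hpos : ∀ t : ℝ, 0 < t → a * t ≤ b * t ^ 2 + 1 := by
    intro t ht
    -- Every `t > 0` is the power `r^d` of some radius, because `d ≠ 0`.
    set r := t ^ ((d : ℝ)⁻¹)
    have hr : 0 < r := Real.rpow_pos_of_pos ht _
    have hrd : r ^ d = t := Real.rpow_inv_natCast_pow ht.le hd
    have h1 := ENNReal.toReal_mono (ENNReal.add_ne_top.2 ⟨hfin r, ENNReal.one_ne_top⟩) (key r hr)
    rw [ENNReal.toReal_add (hfin r) ENNReal.one_ne_top] at h1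
    simp only [ENNReal.toReal_mul, ENNReal.toReal_pow, ENNReal.toReal_ofReal hr.le,
      ENNReal.toReal_one] at h1
    rw [mul_comm 2 d, pow_mul, hrd] at h1
    calc a * t = _ := by simp only [a]; ring
      _ ≤ _ := h1
  have hall : ∀ t : ℝ, 0 ≤ b * (t * t) + -a * t + 1 := by
    intro t
    rcases le_or_gt t 0 with ht | ht
    · have h1 : 0 ≤ b * (t * t) := mul_nonneg hb (mul_self_nonneg t)
      nlinarith
    · nlinarith [hpos t ht]
  have := discrim_le_zero hall
  rw [discrim] at this
  nlinarith

/-- Below one, `K` is taken just large enough for `2^{-K} ≤ l₂`, of order `|log l₂|`. Above one no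
dyadic scale is needed, since `l₁` is already at most a multiple of `l₂`. In both cases the gap `δ`
gives `|log l₂| ≥ log (1 + δ)`, which absorbs the terms without logarithm. -/
theorem exists_dyadic_bound (hd : d ≠ 0) {δ : ℝ} (hδ : 0 < δ) {D n l₁ l₂ : ℝ} (hD : 0 ≤ D)
    (hn : 0 ≤ n) (h₁ : 0 ≤ l₁) (h₂ : 0 ≤ l₂) (h : l₁ ^ 2 ≤ D ^ 2 * l₂) (hl : δ ≤ |l₂ - 1|) :
    ∃ K : ℕ, ((2 ^ K) ^ d)⁻¹ * l₁ + K * (n * l₂) ≤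
      ((D + n) / Real.log (1 + δ) + n / Real.log 2) * (l₂ * |Real.log l₂|) := by
  have hκ : 0 < Real.log (1 + δ) := Real.log_pos (by linarith)
  have hlog2 : 0 < Real.log 2 := Real.log_pos (by norm_num)
  rcases h₂.eq_or_lt with h0 | h0
  · have : l₁ = 0 := by
      rw [← h0, mul_zero] at h
      exact pow_eq_zero_iff (two_ne_zero) |>.1 (le_antisymm h (sq_nonneg _))
    exact ⟨0, by simp [← h0, this]⟩
  have hκδ : Real.log (1 + δ) ≤ δ := by
    have := Real.log_le_sub_one_of_pos (show 0 < 1 + δ by linarith)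
    linarith
  rcases le_or_gt l₂ 1 with h1 | h1
  · have hlog : l₂ - 1 ≤ -δ := by
      rw [abs_of_nonpos (by linarith)] at hl
      linarith
    have hle := Real.log_le_sub_one_of_pos h0
    have habs : |Real.log l₂| = -Real.log l₂ := abs_of_nonpos (by linarith)
    have hκ1 : Real.log (1 + δ) ≤ |Real.log l₂| := by rw [habs]; linarith
    have hl₁ : l₁ ≤ D := (le_abs_self _).trans
      (abs_le_of_sq_le_sq (h.trans (mul_le_of_le_one_right (sq_nonneg D) h1)) hD)
    set K := ⌈|Real.log l₂| / Real.log 2⌉₊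
    have hK : |Real.log l₂| / Real.log 2 ≤ K := Nat.le_ceil _
    have hK' : (K : ℝ) < |Real.log l₂| / Real.log 2 + 1 := Nat.ceil_lt_add_one (by positivity)
    refine ⟨K, ?_⟩
    have hpow : ((2 ^ K : ℝ) ^ d)⁻¹ ≤ l₂ := by
      have h3 : l₂⁻¹ ≤ 2 ^ K := by
        rw [← Real.log_le_log_iff (by positivity) (by positivity), Real.log_inv, Real.log_pow, ←
            habs]
        exact (div_le_iff₀ hlog2).1 hK
      have h4 : (2 : ℝ) ^ K ≤ (2 ^ K) ^ d := le_self_pow₀ (one_le_pow₀ (by norm_num)) hd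
      exact inv_le_of_inv_le₀ h0 (h3.trans h4)
    set g := |Real.log l₂|
    have hg : 1 ≤ g / Real.log (1 + δ) := (one_le_div hκ).2 hκ1
    calc ((2 ^ K) ^ d)⁻¹ * l₁ + K * (n * l₂) ≤ l₂ * D + (g / Real.log 2 + 1) * (n * l₂) := by
          gcongr
      _ = l₂ * (D + n) * 1 + n / Real.log 2 * (l₂ * g) := by ring
      _ ≤ l₂ * (D + n) * (g / Real.log (1 + δ)) + n / Real.log 2 * (l₂ * g) := by gcongr
      _ = _ := by ring
  · have hl2 : 1 + δ ≤ l₂ := by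
      rw [abs_of_pos (by linarith)] at hl
      linarith
    have hlog : Real.log (1 + δ) ≤ Real.log l₂ := Real.log_le_log (by linarith) hl2
    have habs : |Real.log l₂| = Real.log l₂ := abs_of_pos (by linarith)
    have hl₁ : l₁ ≤ D * l₂ := by
      refine (le_abs_self _).trans (abs_le_of_sq_le_sq (h.trans ?_) (by positivity))
      rw [mul_pow]
      gcongr
      nlinarith
    refine ⟨0, ?_⟩
    rw [habs]
    have hg : 1 ≤ Real.log l₂ / Real.log (1 + δ) := (one_le_div hκ).2 hlog
    have hg0 : 0 ≤ Real.log l₂ := by linarith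
    calc ((2 ^ 0) ^ d)⁻¹ * l₁ + ((0 : ℕ) : ℝ) * (n * l₂) = l₁ := by simp
      _ ≤ D * l₂ * 1 := by linarith
      _ ≤ D * l₂ * (Real.log l₂ / Real.log (1 + δ)) := by gcongr
      _ = D / Real.log (1 + δ) * (l₂ * Real.log l₂) := by ring
      _ ≤ _ := by
          gcongr
          have : D / Real.log (1 + δ) ≤ (D + n) / Real.log (1 + δ) := by gcongr; linarith
          have : 0 ≤ n / Real.log 2 := by positivity
          linarith

/-- The cap `L = 2^K` is adapted to the process; the constant depends only on `d` and `δ`. -/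
theorem exists_overlap_bound (hd : d ≠ 0) {δ : ℝ} (hδ : 0 < δ) :
    ∃ C : ℝ, ∀ P : Measure (PointSet d), IsProbabilityMeasure P →
      VAddInvariantMeasure (E d) (PointSet d) P → secondIntensity P ≠ ⊤ →
      δ ≤ |(secondIntensity P).toReal - 1| →
      ∃ L : ℝ, 0 ≤ L ∧ Integrable (fun S => (overlap L S).toReal) P ∧
        ∫ S, (overlap L S).toReal ∂P ≤
          C * ((secondIntensity P).toReal * |Real.log (secondIntensity P).toReal|) := by
  set V := volume (ball (0 : E d) 1)
  have hVt : V ≠ ⊤ := measure_ball_lt_top.ne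
  have hV : 0 < V.toReal := ENNReal.toReal_pos (measure_ball_pos _ _ one_pos).ne' hVt
  -- Chosen so that `intensity_one_bound` reads `l₁² ≤ D² l₂`.
  set D := √(4 * (pairConst d).toReal) / V.toReal
  have hD : D ^ 2 * V.toReal ^ 2 = 4 * (pairConst d).toReal := by
    rw [div_pow, Real.sq_sqrt (by positivity)]
    field_simp
  refine ⟨V.toReal * ((D + (neighborConst d).toReal) / Real.log (1 + δ) +
    (neighborConst d).toReal / Real.log 2), fun P hP hv hfin hl => ?_⟩
  obtain ⟨h1, h2⟩ := intensity_one_bound hd P hfin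
  set l₁ := (intensity P fun _ => 1).toReal
  set l₂ := (secondIntensity P).toReal
  have h3 : l₁ ^ 2 ≤ D ^ 2 * l₂ := by
    refine le_of_mul_le_mul_right ?_ (pow_pos hV 2)
    calc l₁ ^ 2 * V.toReal ^ 2 = (l₁ * V.toReal) ^ 2 := by ring
      _ ≤ _ := h2
      _ = D ^ 2 * l₂ * V.toReal ^ 2 := by rw [← hD]; ring
  obtain ⟨K, hK⟩ := exists_dyadic_bound hd hδ (D := D) (n := (neighborConst d).toReal)
    (by positivity) ENNReal.toReal_nonneg ENNReal.toReal_nonneg ENNReal.toReal_nonneg h3 hl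
  have h4 := intensity_weight_le P K
  have ht1 : (((2 : ℝ≥0∞) ^ K) ^ d)⁻¹ * intensity P (fun _ => 1) ≠ ⊤ :=
    ENNReal.mul_ne_top (by simp) h1
  have ht2 : (K : ℝ≥0∞) * (neighborConst d * secondIntensity P) ≠ ⊤ :=
    ENNReal.mul_ne_top (by simp) (ENNReal.mul_ne_top neighborConst_ne_top hfin)
  have h5 := ENNReal.toReal_mono (ENNReal.add_ne_top.2 ⟨ht1, ht2⟩) h4
  rw [ENNReal.toReal_add ht1 ht2] at h5
  simp only [ENNReal.toReal_mul, ENNReal.toReal_inv, ENNReal.toReal_pow, ENNReal.toReal_ofNat,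
    ENNReal.toReal_natCast] at h5
  have h6 := ne_top_of_le_ne_top (ENNReal.add_ne_top.2 ⟨ht1, ht2⟩) h4
  have h7 : ∫⁻ S, overlap (2 ^ K) S ∂P ≠ ⊤ := by
    rw [lintegral_overlap]
    exact ENNReal.mul_ne_top h6 hVt
  refine ⟨2 ^ K, by positivity,
    integrable_toReal_of_lintegral_ne_top (measurable_overlap _).aemeasurable h7, ?_⟩
  rw [integral_toReal (measurable_overlap _).aemeasurable (ae_of_all _ (overlap_lt_top _)),
    lintegral_overlap, ENNReal.toReal_mul, mul_comm, mul_assoc]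
  exact mul_le_mul_of_nonneg_left (h5.trans hK) hV.le

theorem exists_effective_bound (hd : d ≠ 0) {α β δ : ℝ} (hα : 0 < α) (hβ : 0 < β) (hδ : 0 < δ) :
    ∃ C : ℝ, ∀ P : Measure (PointSet d), IsProbabilityMeasure P →
      ErgodicVAdd (E d) (PointSet d) P →
      ∃ Abar : E d →L[ℝ] E d,
        IsEffectiveConductivity P (α • ContinuousLinearMap.id ℝ (E d))
          (β • ContinuousLinearMap.id ℝ (E d)) Abar ∧
        (secondIntensity P ≠ ⊤ → δ ≤ |(secondIntensity P).toReal - 1| →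
          ‖Abar - (α • ContinuousLinearMap.id ℝ (E d) +
              (volumeFraction P * (α * d * (β - α) / (β + α * (d - 1)))) •
                ContinuousLinearMap.id ℝ (E d))‖ ≤
            C * ((secondIntensity P).toReal * |Real.log (secondIntensity P).toReal|)) := by
  obtain ⟨C, hC⟩ := exists_overlap_bound hd hδ
  have hden : β + α * (d - 1) ≠ 0 := by
    have : (1 : ℝ) ≤ d := by exact_mod_cast Nat.one_le_iff_ne_zero.2 hd
    have : 0 ≤ α * (d - 1) := mul_nonneg hα.le (by linarith)
    linarith
  -- The amplitude of the single-ball solution; the gradient of the total potential inside the ball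
  -- is `(1 + c₀) e`.
  set c₀ := (α - β) / (β + α * (d - 1)) with hc₀
  set c := α * d * (β - α) / (β + α * (d - 1)) with hc
  have h1 : c₀ * (β + α * (d - 1)) = α - β := div_mul_cancel₀ _ hden
  have h2 : c = -(c₀ * α * d) := by rw [hc, hc₀]; ring
  have hμ : 0 < min α β := lt_min hα hβ
  refine ⟨((1 + |c₀| * d ^ 2) * |β - α - c| + ((β - α) ^ 2 + c ^ 2) / min α β) * C,
    fun P hP hE => ?_⟩
  obtain ⟨Abar, hA⟩ := exists_isEffectiveConductivity (P := P) hα hβ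
  refine ⟨Abar, hA, fun hfin hl => ?_⟩
  obtain ⟨L, hL, hi, hb⟩ := hC P hP inferInstance hfin hl
  refine (norm_effective_sub_le hd h1 h2 hL hα hβ hA hi).trans ?_
  rw [mul_assoc]
  exact mul_le_mul_of_nonneg_left hb (by positivity)

end

end ClausiusMossotti

end


theorem theorem1 (d : ℕ) (hd : 1 ≤ d) (α β : ℝ) (hα : 0 < α) (hβ : 0 < β)
    (δ : ℝ) (hδ : 0 < δ) :
    ∃ C : ℝ, ∀ P : MeasureTheory.Measure (ClausiusMossotti.PointSet d),
      MeasureTheory.IsProbabilityMeasure P →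
      ErgodicVAdd (ClausiusMossotti.E d) (ClausiusMossotti.PointSet d) P →
      ∃ Abar : ClausiusMossotti.E d →L[ℝ] ClausiusMossotti.E d,
        ClausiusMossotti.IsEffectiveConductivity P
          (α • ContinuousLinearMap.id ℝ (ClausiusMossotti.E d))
          (β • ContinuousLinearMap.id ℝ (ClausiusMossotti.E d)) Abar ∧
        (ClausiusMossotti.secondIntensity P ≠ ⊤ →
          δ ≤ |(ClausiusMossotti.secondIntensity P).toReal - 1| →
          ‖Abar - (α • ContinuousLinearMap.id ℝ (ClausiusMossotti.E d) +
              (ClausiusMossotti.volumeFraction P *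
                (α * d * (β - α) / (β + α * (d - 1)))) •
                  ContinuousLinearMap.id ℝ (ClausiusMossotti.E d))‖ ≤
            C * ((ClausiusMossotti.secondIntensity P).toReal *
              |Real.log (ClausiusMossotti.secondIntensity P).toReal|)) := by
  exact ClausiusMossotti.exists_effective_bound (Nat.one_le_iff_ne_zero.1 hd) hα hβ hδ
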